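/- Let $d$ be a dimension. For a tempered distribution $u$ on $\mathbb R^d$ let $\dot\Delta_j u=\varphi(2^{-j}D)u$, $j\in\mathbb Z$, be its homogeneous Littlewood–Paley blocks, where $\varphi(\xi)=\chi(\xi/2)-\chi(\xi)$ and $\chi$ is a smooth radial cut-off with values in $[0,1]$, equal to $1$ for $|\xi|\le 3/4$, to $0$ for $|\xi|\ge 4/3$, and with $\chi(\xi)\le\chi(\xi/2)$. Put $$\|u\|_{\dot B^s_{p,r}}=\Big\|\big(2^{js}\|\dot\Delta_j u\|_{L^p}\big)_{j\in\mathbb Z}\Big\|_{\ell^r},\qquad \|w\|_{\tilde L^\rho_T(\dot B^s_{p,r})}=\Big\|\big(2^{js}\|\dot\Delta_j w\|_{L^\rho(0,T;L^p)}\big)_{j\in\mathbb Z}\Big\|_{\ell^r}$$ (with value $\infty$ where a block is not in $L^p$). Let $\Lambda_1$ be the Fourier multiplier with symbol $|\xi|_1=\sum_{i=1}^d|\xi_i|$; the multiplier $e^{\sqrt{c_0t}\Lambda_1}$ acts on each block, $\dot\Delta_j e^{\sqrt{c_0t}\Lambda_1}u=e^{\sqrt{c_0t}\Lambda_1}\dot\Delta_j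 u$. Let $1<p<\infty$ and $\kappa\in\mathbb R$. There is a constant $C$, depending only on $d$, $p$, $\kappa$ and $\chi$, such that the following holds for all $T>0$, $\sigma\in\mathbb R$, $1\le\rho_2,r\le\infty$, and all $c_0,\mu>0$ with $c_0/\mu\le\kappa$. Let $v\in C([0,T);\mathcal S')$ solve, in the sense of distributions, $$\partial_t v-\mu\Delta v=F,\qquad v|_{t=0}=v_0,$$ with $v_0\in\mathcal S'$ and $F\in L^1_{\rm loc}([0,T);\mathcal S')$, and put $V(t)=e^{\sqrt{c_0t}\Lambda_1}v(t)$. Then, for all $\rho_1\in[\rho_2,\infty]$, $$\mu^{\frac1{\rho_1}}\|V\|_{\tilde L^{\rho_1}_T(\dot B^{\sigma+\frac2{\rho_1}}_{p,r})}\le C\Big(\|v_0\|_{\dot B^\sigma_{p,r}}+\mu^{\frac1{\rho_2}-1}\big\|e^{\sqrt{c_0t}\Lambda_1}F\big\|_{\tilde L^{\rho_2}_T(\dot B^{\sigma-2+\frac2{\rho_2}}_{p,r})}\Big).$$ -/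

import Mathlib

open MeasureTheory FourierTransform Laplacian
open scoped ENNReal NNReal SchwartzMap ContDiff

noncomputable section

namespace GevreyHeat

/-- The space `ℝ^d` with its Euclidean norm. -/
abbrev Space (d : ℕ) : Type := EuclideanSpace ℝ (Fin d)

/-! ### Littlewood-Paley blocks

Mathlib's Fourier transform is `𝓕 u ξ = ∫ e^{-2πi x·ξ} u x dx`, so the frequency variable of the
convention `û ξ = ∫ e^{-i x·ξ} u x dx` is `2π ξ`. All symbols below are symbols in the second
convention, evaluated at `2π ξ`. -/

/-- The cut-off function `χ` of a dyadic partition of unity: smooth, radial, with values in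
`[0, 1]`, equal to `1` on the ball of radius `3/4`, vanishing outside the ball of radius `4/3`,
and with `χ ≤ χ (· / 2)`. -/
structure DyadicCutoff (d : ℕ) where
  χ : Space d → ℝ
  smooth : ContDiff ℝ ∞ χ
  radial : ∀ ξ η : Space d, ‖ξ‖ = ‖η‖ → χ ξ = χ η
  nonneg : ∀ ξ, 0 ≤ χ ξ
  le_one : ∀ ξ, χ ξ ≤ 1
  eq_one : ∀ ξ, ‖ξ‖ ≤ 3 / 4 → χ ξ = 1
  eq_zero : ∀ ξ, 4 / 3 ≤ ‖ξ‖ → χ ξ = 0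
  le_half : ∀ ξ, χ ξ ≤ χ ((1 / 2 : ℝ) • ξ)

instance DyadicCutoff.instNonempty (d : ℕ) : Nonempty (DyadicCutoff d) := by
  refine ⟨{ χ := fun ξ ↦ Real.smoothTransition ((16 / 9 - ‖ξ‖ ^ 2) / (16 / 9 - 9 / 16)), smooth := ?_, radial := ?_, nonneg := ?_,
            le_one := ?_, eq_one := ?_, eq_zero := ?_, le_half := ?_ }⟩
  · exact Real.smoothTransition.contDiff.comp
      ((contDiff_const.sub (contDiff_norm_sq ℝ)).div_const _)
  · intro ξ η h
    simp only [h]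
  · exact fun ξ ↦ Real.smoothTransition.nonneg _
  · exact fun ξ ↦ Real.smoothTransition.le_one _
  · intro ξ h
    apply Real.smoothTransition.one_of_one_le
    rw [le_div_iff₀ (by norm_num)]
    nlinarith [norm_nonneg ξ]
  · intro ξ h
    apply Real.smoothTransition.zero_of_nonpos
    apply div_nonpos_of_nonpos_of_nonneg _ (by norm_num)
    nlinarith [norm_nonneg ξ]
  · intro ξ
    apply Real.smoothTransition.monotone
    rw [norm_smul, Real.norm_of_nonneg (by norm_num)]
    apply div_le_div_of_nonneg_right _ (by norm_num)
    nlinarith [norm_nonneg ξ]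

/-- `φ ξ = χ (ξ / 2) - χ ξ`, supported in the annulus `3/4 ≤ |ξ| ≤ 8/3`, so that
`∑_{j ∈ ℤ} φ (2^{-j} ξ) = 1` for `ξ ≠ 0`. -/
def DyadicCutoff.φ {d : ℕ} (Θ : DyadicCutoff d) (ξ : Space d) : ℝ :=
  Θ.χ ((1 / 2 : ℝ) • ξ) - Θ.χ ξ

/-- The homogeneous dyadic block `Δ̇_j u = φ(2^{-j} D) u` of a tempered distribution. -/
def dyadicBlock {d : ℕ} (Θ : DyadicCutoff d) (j : ℤ) (u : 𝓢'(Space d, ℂ)) : 𝓢'(Space d, ℂ) :=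
  TemperedDistribution.fourierMultiplierCLM ℂ
    (fun ξ ↦ ((Θ.φ (((2 : ℝ) ^ (-j) * (2 * Real.pi)) • ξ) : ℝ) : ℂ)) u

/-! ### Lebesgue norms of distributions and homogeneous Besov norms -/

/-- The tempered distribution `u` is (represented by) the function `f ∈ L^p`. -/
def IsLpFunction {d : ℕ} (p : ℝ≥0∞) (u : 𝓢'(Space d, ℂ)) (f : Space d → ℂ) : Prop :=
  MemLp f p volume ∧ ∀ ψ : 𝓢(Space d, ℂ), u ψ = ∫ x, f x * ψ x

/-- `‖u‖_{L^p}` for a tempered distribution `u`; it is `∞` if `u` is not in `L^p`. -/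
def distLpNorm {d : ℕ} (p : ℝ≥0∞) (u : 𝓢'(Space d, ℂ)) : ℝ≥0∞ :=
  ⨅ (f : Space d → ℂ) (_ : IsLpFunction p u f), eLpNorm f p volume

/-- The norm of `ℓ^r(ℤ)` of the sequence `2^{js} a_j`. -/
def weightedSeqNorm (s : ℝ) (r : ℝ≥0∞) (a : ℤ → ℝ≥0∞) : ℝ≥0∞ :=
  eLpNorm (fun j : ℤ ↦ ENNReal.ofReal ((2 : ℝ) ^ ((j : ℝ) * s)) * a j) r Measure.count

/-- The homogeneous Besov norm `‖u‖_{Ḃ^s_{p,r}}`. -/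
def besovNorm {d : ℕ} (Θ : DyadicCutoff d) (s : ℝ) (p r : ℝ≥0∞) (u : 𝓢'(Space d, ℂ)) : ℝ≥0∞ :=
  weightedSeqNorm s r fun j ↦ distLpNorm p (dyadicBlock Θ j u)

/-! ### The Gevrey multiplier -/

/-- The `ℓ¹` norm `|ξ|₁`, the symbol of `Λ₁`. -/
def l1Norm {d : ℕ} (ξ : Space d) : ℝ := ∑ i, |ξ i|

/-- `e^{a Λ₁} ψ` for a test function `ψ` whose Fourier transform has compact support (an
integrable and bounded function). -/
def gevreyTest {d : ℕ} (a : ℝ) (ψ : 𝓢(Space d, ℂ)) : Space d → ℂ :=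
  𝓕⁻ (fun ξ : Space d ↦ ((Real.exp (a * l1Norm ((2 * Real.pi) • ξ)) : ℝ) : ℂ) * (𝓕 ψ) ξ)

/-- `u` and `e^{a Λ₁} u` both belong to `L^p`, and `e^{a Λ₁} u` is the function `g`. The symbol
`e^{a |ξ|₁}` is neither smooth nor of moderate growth, so the multiplier is defined by duality
(the symbol is even, so the operator is symmetric for the bilinear pairing): `⟨g, ψ⟩ = ⟨u, e^{a Λ₁} ψ⟩`
for all test functions `ψ` with compactly supported Fourier transform. These are dense in the
Schwartz space, so that `g` is unique almost everywhere. -/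
def IsGevreyExp {d : ℕ} (p : ℝ≥0∞) (a : ℝ) (u : 𝓢'(Space d, ℂ)) (g : Space d → ℂ) : Prop :=
  MemLp g p volume ∧ ∃ f : Space d → ℂ, IsLpFunction p u f ∧
    ∀ ψ : 𝓢(Space d, ℂ), HasCompactSupport (fun ξ ↦ (𝓕 ψ) ξ) →
      ∫ x, g x * ψ x = ∫ x, f x * gevreyTest a ψ x

/-- `‖e^{a Λ₁} u‖_{L^p}`; it is `∞` if `e^{a Λ₁} u` is not defined in `L^p`. -/
def gevreyLpNorm {d : ℕ} (p : ℝ≥0∞) (a : ℝ) (u : 𝓢'(Space d, ℂ)) : ℝ≥0∞ :=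
  ⨅ (g : Space d → ℂ) (_ : IsGevreyExp p a u g), eLpNorm g p volume

/-- The Chemin-Lerner norm `‖e^{√(c₀ t) Λ₁} u‖_{L̃^ρ_T(Ḃ^s_{p,r})}` of a time-dependent tempered
distribution `u`: the `ℓ^r` norm of `2^{js} ‖Δ̇_j e^{√(c₀ t) Λ₁} u‖_{L^ρ(0,T; L^p)}`, where
`Δ̇_j e^{√(c₀ t) Λ₁} u = e^{√(c₀ t) Λ₁} Δ̇_j u`. -/
def gevreyCheminLernerNorm {d : ℕ} (Θ : DyadicCutoff d) (c₀ T : ℝ) (ρ : ℝ≥0∞) (s : ℝ)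
    (p r : ℝ≥0∞) (u : ℝ → 𝓢'(Space d, ℂ)) : ℝ≥0∞ :=
  weightedSeqNorm s r fun j ↦
    eLpNorm (fun t : ℝ ↦ gevreyLpNorm p (Real.sqrt (c₀ * t)) (dyadicBlock Θ j (u t))) ρ
      (volume.restrict (Set.Ioo 0 T))

/-! ### The heat equation -/

/-- `v ∈ C([0,T); 𝓢')` solves `∂_t v - μ Δ v = F`, `v|_{t=0} = v₀` in the sense of distributions,
with `F ∈ L¹_loc([0,T); 𝓢')`: the equation is tested against Schwartz functions of the space
variable and integrated in time. -/
structure IsHeatSolution {d : ℕ} (μ T : ℝ) (v₀ : 𝓢'(Space d, ℂ)) (F v : ℝ → 𝓢'(Space d, ℂ)) :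
    Prop where
  continuousOn : ∀ ψ : 𝓢(Space d, ℂ), ContinuousOn (fun t ↦ v t ψ) (Set.Ico 0 T)
  integrableOn : ∀ ψ : 𝓢(Space d, ℂ), ∀ t ∈ Set.Ico 0 T,
    IntegrableOn (fun s ↦ F s ψ) (Set.Ioc 0 t) volume
  initial : v 0 = v₀
  equation : ∀ ψ : 𝓢(Space d, ℂ), ∀ t ∈ Set.Ico 0 T,
    v t ψ - v₀ ψ = ∫ s in (0 : ℝ)..t, ((μ : ℂ) * (Δ (v s)) ψ + F s ψ)

end GevreyHeat

end

/-!
The estimate is proved for one dyadic block at a time, with a constant which does not depend on the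
block, and then summed in `ℓ^r`.

On the annulus `|ξ| ~ 2^j`, Duhamel's formula for `V = e^{√(c₀t)Λ₁} v` involves the multipliers with
symbol `e^{(√(c₀t) - √(c₀s))|ξ|₁ - μ(t-s)|ξ|²}`, `0 ≤ s < t`. Since
`(√(c₀t) - √(c₀s))² ≤ c₀(t - s) ≤ κ μ(t - s)`, the exponential growth is absorbed by the Gaussian: the
symbol `e^{a|ξ|₁ - b|ξ|²}` is a product over the coordinates, and on the line
`e^{a|x|} = e^{ax} + e^{-ax} - e^{-a|x|}` writes it through Gaussian and Poisson kernels, whose `L¹`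
norms are at most `e^{a²/4b}`, a constant depending on `κ`. Half of the Gaussian gives the decay `(1 + (μ 4^j (t-s))²)⁻¹`
on the annulus (`exists_isL1Multiplier_fat_gevreyHeat`). The multipliers thus are convolutions with
integrable kernels, hence bounded on every Lebesgue space.

As the solution is only a distribution, Duhamel's formula is established in duality
(`IsHeatSolution.duhamel`). For a test function `ψ` with compactly supported Fourier transform the
backward heat evolution is a power series `∑ cₙ(s) Δⁿψ`, and the equation can be tested against each
term. The exchange of sums and integrals needs a bound, uniform in `n`, of `∫ |⟨F(s), Rⁿ/n! Δⁿψ⟩| ds`.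
It follows from the closed graph theorem on `ℓ¹`, because the functions `Rⁿ/n! Δⁿψ` are bounded in
the Schwartz space (`exists_integral_norm_le_of_weakly_integrable`,
`exists_clm_ellOne_laplacian_pow`).

The formula bounds `⟨Δ̇_j v(t), ψ⟩` by the dual norm of `ψ`. The representation of the dual of `L^q`
and the Hahn-Banach theorem (`exists_memLp_of_schwartz_functional`) then produce the functions of
`L^p` which represent `Δ̇_j v(t)` and `e^{√(c₀t)Λ₁} Δ̇_j v(t)`; this is where `1 < p < ∞` is used. The
result is `IsHeatSolution.gevreyLpNorm_dyadicBlock_le`, the Duhamel formula for norms.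

It remains to apply Young's inequality in time to the kernel `(1 + (μ 4^j τ)²)⁻¹`, whose integral is
`π/(μ 4^j)` (`eLpNorm_duhamelBound_le`); the powers of `μ 4^j` are those of the weights of the norms.
The norm of the forcing need not be a measurable function of time. Its lower integrals, which are
Mathlib's integrals, are those of its largest measurable minorant, to which Young's inequality
applies.
-/

noncomputable section

namespace GevreyHeat

/-! ### Lower integrals of non-measurable functions and Young's inequality -/

/-- Every `ℝ≥0∞`-valued function, measurable or not, has an essentially largest measurable
minorant with respect to a finite measure: transport `N` to a bounded function by the increasing
bijection `x ↦ (x⁻¹ + 1)⁻¹` of `[0, ∞]` onto `[0, 1]` and take a minorant realising the (lower)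
Lebesgue integral. -/
theorem exists_largest_measurable_minorant {α : Type*} [MeasurableSpace α] (ν : Measure α)
    [IsFiniteMeasure ν] (N : α → ℝ≥0∞) :
    ∃ G : α → ℝ≥0∞, Measurable G ∧ G ≤ N ∧
      ∀ H : α → ℝ≥0∞, Measurable H → H ≤ N → H ≤ᵐ[ν] G := by
  obtain ⟨g, hgm, hgle, hgint⟩ :=
    exists_measurable_le_lintegral_eq ν (fun x ↦ ((N x)⁻¹ + 1)⁻¹)
  refine ⟨fun x ↦ ((g x)⁻¹ - 1)⁻¹, (hgm.inv.sub measurable_const).inv, fun x ↦ ?_, ?_⟩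
  · rw [ENNReal.inv_le_iff_inv_le]
    apply ENNReal.le_sub_of_add_le_right ENNReal.one_ne_top
    have := hgle x
    rwa [ENNReal.le_inv_iff_le_inv] at this
  · intro H hH hHN
    have hm : Measurable fun x ↦ ((H x)⁻¹ + 1)⁻¹ := (hH.inv.add measurable_const).inv
    have hle : ∀ x, max (g x) ((H x)⁻¹ + 1)⁻¹ ≤ ((N x)⁻¹ + 1)⁻¹ := fun x ↦ by
      apply max_le (hgle x)
      have := hHN x
      exact ENNReal.inv_le_inv.2 (add_le_add (ENNReal.inv_le_inv.2 this) le_rfl)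
    have hfin : ∫⁻ x, g x ∂ν ≠ ⊤ := by
      refine ((lintegral_mono (g := fun _ ↦ 1) fun x ↦ (hgle x).trans ?_).trans_lt ?_).ne
      · rw [ENNReal.inv_le_one]
        exact le_add_self
      · simp
    have hmax : g =ᵐ[ν] fun x ↦ max (g x) ((H x)⁻¹ + 1)⁻¹ :=
      ae_eq_of_ae_le_of_lintegral_le (.of_forall fun x ↦ le_max_left _ _) hfin
        (hgm.max hm).aemeasurable (hgint ▸ lintegral_mono hle)
    filter_upwards [hmax] with x hx
    have h1 : ((H x)⁻¹ + 1)⁻¹ ≤ g x := by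
      rw [hx]
      exact le_max_right _ _
    rw [ENNReal.le_inv_iff_le_inv, tsub_le_iff_right]
    rwa [ENNReal.inv_le_iff_inv_le] at h1

/-- Lower integrals against a positive weight only see the largest measurable minorant. -/
theorem lintegral_mul_le_of_largest_minorant {α : Type*} [MeasurableSpace α] {ν ν' : Measure α}
    (hν : ν' ≪ ν) {N G : α → ℝ≥0∞}
    (hG : ∀ H : α → ℝ≥0∞, Measurable H → H ≤ N → H ≤ᵐ[ν] G)
    {k : α → ℝ≥0∞} (hk : Measurable k) (hk0 : ∀ x, k x ≠ 0) (hkt : ∀ x, k x ≠ ⊤) :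
    ∫⁻ x, k x * N x ∂ν' ≤ ∫⁻ x, k x * G x ∂ν' := by
  obtain ⟨h, hhm, hhle, hhint⟩ := exists_measurable_le_lintegral_eq ν' (fun x ↦ k x * N x)
  rw [hhint]
  apply lintegral_mono_ae
  have := hG (fun x ↦ h x / k x) (hhm.div hk) fun x ↦ by
    rw [ENNReal.div_le_iff (hk0 x) (hkt x), mul_comm]
    exact hhle x
  filter_upwards [hν.ae_le this] with x hx
  rwa [ENNReal.div_le_iff (hk0 x) (hkt x), mul_comm] at hx

/-- Jensen's inequality for the measure `k dν`, in homogeneous form. -/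
theorem lintegral_mul_rpow_le {α : Type*} [MeasurableSpace α] (ν : Measure α)
    {k f : α → ℝ≥0∞} (hk : AEMeasurable k ν) (hf : AEMeasurable f ν) {p : ℝ} (hp : 1 ≤ p) :
    (∫⁻ x, k x * f x ∂ν) ^ p ≤ (∫⁻ x, k x ∂ν) ^ (p - 1) * ∫⁻ x, k x * f x ^ p ∂ν := by
  rcases hp.eq_or_lt with rfl | hp
  · simp
  have hpq := Real.HolderConjugate.conjExponent hp
  set q := p.conjExponent
  have hp0 : 0 < p := hpq.pos
  have hq0 : 0 < q := hpq.symm.pos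
  have hsum : 1 / q + 1 / p = 1 := by
    have := hpq.inv_add_inv_eq_one
    simp only [one_div]
    linarith
  have h := ENNReal.lintegral_mul_le_Lp_mul_Lq ν hpq.symm (f := fun x ↦ k x ^ (1 / q))
    (g := fun x ↦ k x ^ (1 / p) * f x) (hk.pow_const _) ((hk.pow_const _).mul hf)
  have e1 : ∀ x, k x ^ (1 / q) * (k x ^ (1 / p) * f x) = k x * f x := fun x ↦ by
    rw [← mul_assoc, ← ENNReal.rpow_add_of_nonneg _ _ (by positivity) (by positivity), hsum,
      ENNReal.rpow_one]
  have e2 : ∀ x, (k x ^ (1 / q)) ^ q = k x := fun x ↦ by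
    rw [← ENNReal.rpow_mul, one_div_mul_cancel hq0.ne', ENNReal.rpow_one]
  have e3 : ∀ x, (k x ^ (1 / p) * f x) ^ p = k x * f x ^ p := fun x ↦ by
    rw [ENNReal.mul_rpow_of_nonneg _ _ hp0.le, ← ENNReal.rpow_mul, one_div_mul_cancel hp0.ne',
      ENNReal.rpow_one]
  simp only [Pi.mul_apply, e1, e2, e3] at h
  calc _ ≤ ((∫⁻ x, k x ∂ν) ^ (1 / q) * (∫⁻ x, k x * f x ^ p ∂ν) ^ (1 / p)) ^ p := by gcongr
    _ = _ := by
      rw [ENNReal.mul_rpow_of_nonneg _ _ hp0.le, ← ENNReal.rpow_mul, ← ENNReal.rpow_mul,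
        one_div_mul_cancel hp0.ne', ENNReal.rpow_one]
      congr 2
      have : 1 / q = 1 - 1 / p := by linarith
      rw [this]
      field_simp

theorem eLpNorm_ennreal_eq {α : Type*} [MeasurableSpace α] {ν : Measure α} (f : α → ℝ≥0∞)
    {ρ : ℝ≥0∞} (h0 : ρ ≠ 0) (ht : ρ ≠ ⊤) :
    eLpNorm f ρ ν = (∫⁻ x, f x ^ ρ.toReal ∂ν) ^ (1 / ρ.toReal) := by
  rw [eLpNorm_eq_lintegral_rpow_enorm_toReal h0 ht]
  simp

theorem ae_le_eLpNorm_top {α : Type*} [MeasurableSpace α] {ν : Measure α} (f : α → ℝ≥0∞) :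
    ∀ᵐ x ∂ν, f x ≤ eLpNorm f ⊤ ν := by
  rw [eLpNorm_exponent_top]
  simpa using enorm_ae_le_eLpNormEssSup f ν

theorem eLpNorm_top_le_of_forall {α : Type*} [MeasurableSpace α] {ν : Measure α} {f : α → ℝ≥0∞}
    {C : ℝ≥0∞} (h : ∀ x, f x ≤ C) : eLpNorm f ⊤ ν ≤ C := by
  rw [eLpNorm_exponent_top, eLpNormEssSup_eq_essSup_enorm]
  exact essSup_le_of_ae_le _ (.of_forall fun x ↦ by simpa using h x)

section Young

set_option linter.unusedSectionVars false

variable {G : Type*} [AddCommGroup G] [MeasurableSpace G] [MeasurableAdd₂ G] [MeasurableNeg G]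
  {ν : Measure G} [SFinite ν] [ν.IsAddLeftInvariant] [ν.IsNegInvariant]

theorem measurable_lintegral_convolution {k f : G → ℝ≥0∞} (hk : Measurable k)
    (hf : Measurable f) : Measurable fun x ↦ ∫⁻ y, k (x - y) * f y ∂ν := by
  have : Measurable fun z : G × G ↦ k (z.1 - z.2) * f z.2 :=
    (hk.comp (measurable_fst.sub measurable_snd)).mul (hf.comp measurable_snd)
  exact this.lintegral_prod_right'

theorem lintegral_lintegral_convolution {k f : G → ℝ≥0∞} (hk : Measurable k)
    (hf : Measurable f) :
    ∫⁻ x, ∫⁻ y, k (x - y) * f y ∂ν ∂ν = (∫⁻ x, k x ∂ν) * ∫⁻ y, f y ∂ν := by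
  rw [lintegral_lintegral_swap]
  · have : ∀ y, ∫⁻ x, k (x - y) * f y ∂ν = (∫⁻ x, k x ∂ν) * f y := fun y ↦ by
      have hm : Measurable fun x ↦ k (x - y) := hk.comp (measurable_id.sub_const y)
      rw [lintegral_mul_const _ hm, lintegral_sub_right_eq_self k y]
    simp_rw [this]
    rw [lintegral_const_mul _ hf]
  · exact ((hk.comp (measurable_fst.sub measurable_snd)).mul
      (hf.comp measurable_snd)).aemeasurable

theorem lintegral_convolution_kernel (k : G → ℝ≥0∞) (x : G) :
    ∫⁻ y, k (x - y) ∂ν = ∫⁻ y, k y ∂ν :=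
  lintegral_sub_left_eq_self k x

/-- Young's inequality `L¹ * L^p → L^p`. -/
theorem lintegral_convolution_rpow_le {k f : G → ℝ≥0∞} (hk : Measurable k)
    (hf : Measurable f) {p : ℝ} (hp : 1 ≤ p) :
    ∫⁻ x, (∫⁻ y, k (x - y) * f y ∂ν) ^ p ∂ν ≤ (∫⁻ x, k x ∂ν) ^ p * ∫⁻ y, f y ^ p ∂ν := by
  calc _ ≤ ∫⁻ x, (∫⁻ y, k y ∂ν) ^ (p - 1) * ∫⁻ y, k (x - y) * f y ^ p ∂ν ∂ν := by
        apply lintegral_mono fun x ↦ ?_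
        have := lintegral_mul_rpow_le ν (k := fun y ↦ k (x - y))
          (hk.comp (measurable_const.sub measurable_id)).aemeasurable hf.aemeasurable hp
        rwa [lintegral_convolution_kernel k x] at this
    _ = _ := by
        rw [lintegral_const_mul _ (measurable_lintegral_convolution hk (hf.pow_const p)),
          lintegral_lintegral_convolution hk (hf.pow_const p), ← mul_assoc]
        congr 1
        nth_rw 2 [← ENNReal.rpow_one (∫⁻ x, k x ∂ν)]
        rw [← ENNReal.rpow_add_of_nonneg _ _ (by linarith) zero_le_one]
        simp

/-- Young's inequality `L^q * L^{ρ₂} → L^{ρ₁}` for a kernel `0 ≤ k ≤ 1`, whose `L^q` norms are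
controlled by its integral: interpolate between `ρ₁ = ρ₂` and `ρ₁ = ∞`. -/
theorem eLpNorm_convolution_le {k f : G → ℝ≥0∞} (hk : Measurable k) (hk1 : ∀ x, k x ≤ 1)
    (hf : Measurable f) {ρ₁ ρ₂ : ℝ≥0∞} (h₂ : 1 ≤ ρ₂) (h₁ : ρ₂ ≤ ρ₁) :
    eLpNorm (fun x ↦ ∫⁻ y, k (x - y) * f y ∂ν) ρ₁ ν ≤
      (∫⁻ x, k x ∂ν) ^ (1 - (ρ₂⁻¹).toReal + (ρ₁⁻¹).toReal) * eLpNorm f ρ₂ ν := by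
  set I := ∫⁻ x, k x ∂ν
  rcases eq_or_ne ρ₂ ⊤ with rfl | h₂t
  · obtain rfl : ρ₁ = ⊤ := top_le_iff.mp h₁
    simp only [ENNReal.inv_top, ENNReal.toReal_zero, sub_zero, add_zero, ENNReal.rpow_one]
    apply eLpNorm_top_le_of_forall fun x ↦ ?_
    calc _ ≤ ∫⁻ y, k (x - y) * eLpNorm f ⊤ ν ∂ν := by
          apply lintegral_mono_ae
          filter_upwards [ae_le_eLpNorm_top (ν := ν) f] with y hy
          gcongr
      _ = _ := by
          have hm : Measurable fun y ↦ k (x - y) := hk.comp (measurable_const.sub measurable_id)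
          rw [lintegral_mul_const _ hm, lintegral_convolution_kernel k x]
  have h₂0 : ρ₂ ≠ 0 := (zero_lt_one.trans_le h₂).ne'
  set b := ρ₂.toReal with hb
  have hb1 : 1 ≤ b := by
    rw [hb, ← ENNReal.toReal_one]
    exact ENNReal.toReal_mono h₂t h₂
  have hb0 : 0 < b := by linarith
  rw [eLpNorm_ennreal_eq f h₂0 h₂t, ← hb, ENNReal.toReal_inv ρ₂, ← hb]
  set A := (∫⁻ x, f x ^ b ∂ν) ^ (1 / b) with hA
  clear_value A
  have hAb : A ^ b = ∫⁻ x, f x ^ b ∂ν := by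
    rw [hA, ← ENNReal.rpow_mul, one_div_mul_cancel hb0.ne', ENNReal.rpow_one]
  have hbinv : b⁻¹ ≤ 1 := inv_le_one_of_one_le₀ hb1
  have hsup : ∀ x, ∫⁻ y, k (x - y) * f y ∂ν ≤ I ^ (1 - b⁻¹) * A := fun x ↦ by
    have h := lintegral_mul_rpow_le ν (k := fun y ↦ k (x - y))
      (hk.comp (measurable_const.sub measurable_id)).aemeasurable hf.aemeasurable hb1
    rw [lintegral_convolution_kernel k x] at h
    have h' : (∫⁻ y, k (x - y) * f y ∂ν) ^ b ≤ (I ^ (1 - b⁻¹) * A) ^ b := by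
      refine h.trans ?_
      rw [ENNReal.mul_rpow_of_nonneg _ _ hb0.le, ← ENNReal.rpow_mul, hAb]
      have : (1 - b⁻¹) * b = b - 1 := by field_simp
      rw [this]
      gcongr with y
      exact mul_le_of_le_one_left (by positivity) (hk1 _)
    exact (ENNReal.rpow_le_rpow_iff hb0).mp h'
  rcases eq_or_ne ρ₁ ⊤ with rfl | h₁t
  · simpa using eLpNorm_top_le_of_forall hsup
  have h₁0 : ρ₁ ≠ 0 := (zero_lt_one.trans_le (h₂.trans h₁)).ne'
  rw [eLpNorm_ennreal_eq _ h₁0 h₁t, ENNReal.toReal_inv ρ₁]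
  set a := ρ₁.toReal with ha
  have hab : b ≤ a := ENNReal.toReal_mono h₁t h₁
  have ha0 : 0 < a := by linarith
  rw [one_div, ENNReal.rpow_inv_le_iff ha0]
  calc ∫⁻ x, (∫⁻ y, k (x - y) * f y ∂ν) ^ a ∂ν
      ≤ ∫⁻ x, (I ^ (1 - b⁻¹) * A) ^ (a - b) * (∫⁻ y, k (x - y) * f y ∂ν) ^ b ∂ν := by
        apply lintegral_mono fun x ↦ ?_
        nth_rw 1 [show a = (a - b) + b by ring]
        rw [ENNReal.rpow_add_of_nonneg _ _ (by linarith) hb0.le]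
        have := hsup x
        gcongr
    _ ≤ (I ^ (1 - b⁻¹) * A) ^ (a - b) * (I ^ b * A ^ b) := by
        rw [lintegral_const_mul _ ((measurable_lintegral_convolution hk hf).pow_const b), hAb]
        gcongr
        exact lintegral_convolution_rpow_le hk hf hb1
    _ = _ := by
        rw [ENNReal.mul_rpow_of_nonneg _ _ (by linarith : 0 ≤ a - b),
          ENNReal.mul_rpow_of_nonneg _ _ ha0.le, ← ENNReal.rpow_mul, ← ENNReal.rpow_mul,
          mul_mul_mul_comm, ← ENNReal.rpow_add_of_nonneg _ _ _ hb0.le,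
          ← ENNReal.rpow_add_of_nonneg _ _ (by linarith) hb0.le]
        · congr 2
          · field_simp
            ring
          · ring
        · exact mul_nonneg (by linarith) (by linarith)

end Young

/-! ### Fourier multipliers with integrable kernel -/

/-- `m` is the Fourier transform of an integrable function `K` with `‖K‖_{L¹} ≤ A`, so that the
multiplier `m(D)`, the convolution with `K`, is bounded on every `L^q` with norm at most `A`. -/
def IsL1Multiplier {E : Type*} [NormedAddCommGroup E] [InnerProductSpace ℝ E]
    [FiniteDimensional ℝ E] [MeasurableSpace E] [BorelSpace E] (m : E → ℂ) (A : ℝ) : Prop :=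
  ∃ K : E → ℂ, Measurable K ∧ Integrable K ∧ ∫ x, ‖K x‖ ≤ A ∧ 𝓕 K = m

namespace IsL1Multiplier

section General

variable {E : Type*} [NormedAddCommGroup E] [InnerProductSpace ℝ E]
    [FiniteDimensional ℝ E] [MeasurableSpace E] [BorelSpace E] {m m₁ m₂ : E → ℂ} {A A₁ A₂ : ℝ}

theorem nonneg (h : IsL1Multiplier m A) : 0 ≤ A := by
  obtain ⟨K, -, -, hA, -⟩ := h
  exact (integral_nonneg fun x ↦ norm_nonneg _).trans hA

theorem mono (h : IsL1Multiplier m A₁) (hA : A₁ ≤ A₂) : IsL1Multiplier m A₂ := by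
  obtain ⟨K, hm, hi, h, e⟩ := h
  exact ⟨K, hm, hi, h.trans hA, e⟩

theorem add (h₁ : IsL1Multiplier m₁ A₁) (h₂ : IsL1Multiplier m₂ A₂) :
    IsL1Multiplier (fun ξ ↦ m₁ ξ + m₂ ξ) (A₁ + A₂) := by
  obtain ⟨K, hm, hi, h, e⟩ := h₁
  obtain ⟨L, hm', hi', h', e'⟩ := h₂
  refine ⟨fun x ↦ K x + L x, hm.add hm', hi.add hi', ?_, ?_⟩
  · calc _ ≤ ∫ x, (‖K x‖ + ‖L x‖) :=
          integral_mono (hi.add hi').norm (hi.norm.add hi'.norm) fun x ↦ norm_add_le _ _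
      _ ≤ _ := by
          rw [integral_add hi.norm hi'.norm]
          gcongr
  · ext ξ
    rw [← e, ← e']
    simp only [Real.fourier_eq, smul_add]
    exact integral_add ((Real.fourierIntegral_convergent_iff ξ).2 hi)
      ((Real.fourierIntegral_convergent_iff ξ).2 hi')

theorem const_mul (c : ℂ) (h : IsL1Multiplier m A) :
    IsL1Multiplier (fun ξ ↦ c * m ξ) (‖c‖ * A) := by
  obtain ⟨K, hm, hi, h, e⟩ := h
  refine ⟨fun x ↦ c * K x, hm.const_mul c, hi.const_mul c, ?_, ?_⟩
  · simp only [norm_mul]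
    rw [integral_const_mul]
    gcongr
  · ext ξ
    rw [← e]
    simp only [Real.fourier_eq]
    rw [← integral_const_mul]
    congr with x
    simp only [Circle.smul_def, smul_eq_mul]
    ring

theorem mul (h₁ : IsL1Multiplier m₁ A₁) (h₂ : IsL1Multiplier m₂ A₂) :
    IsL1Multiplier (fun ξ ↦ m₁ ξ * m₂ ξ) (A₁ * A₂) := by
  obtain ⟨K, hm, hi, h, e⟩ := h₁
  obtain ⟨L, hm', hi', h', e'⟩ := h₂
  have hint : Integrable (MeasureTheory.convolution K L (ContinuousLinearMap.mul ℂ ℂ) volume) :=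
    hi.integrable_convolution _ hi'
  refine ⟨MeasureTheory.convolution K L (ContinuousLinearMap.mul ℂ ℂ) volume, ?_, hint, ?_, ?_⟩
  · have : StronglyMeasurable fun z : E × E ↦ K z.2 * L (z.1 - z.2) :=
      ((hm.comp measurable_snd).mul
        (hm'.comp (measurable_fst.sub measurable_snd))).stronglyMeasurable
    exact this.integral_prod_right'.measurable
  · have hA₁ : 0 ≤ A₁ := (integral_nonneg fun x ↦ norm_nonneg _).trans h
    have key : ∫⁻ x, ‖MeasureTheory.convolution K L (ContinuousLinearMap.mul ℂ ℂ) volume x‖ₑ ≤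
        (∫⁻ x, ‖L x‖ₑ) * ∫⁻ x, ‖K x‖ₑ := by
      rw [← lintegral_lintegral_convolution hm'.enorm hm.enorm]
      apply lintegral_mono fun x ↦ ?_
      refine (enorm_integral_le_lintegral_enorm _).trans (lintegral_mono fun y ↦ ?_)
      simp [enorm_mul, mul_comm]
    rw [← ENNReal.ofReal_le_ofReal_iff (mul_nonneg hA₁
        ((integral_nonneg fun x ↦ norm_nonneg _).trans h')),
      ofReal_integral_norm_eq_lintegral_enorm hint, ENNReal.ofReal_mul hA₁, mul_comm]
    refine key.trans ?_
    rw [← ofReal_integral_norm_eq_lintegral_enorm hi, ← ofReal_integral_norm_eq_lintegral_enorm hi']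
    gcongr
  · ext ξ
    rw [Real.fourier_mul_convolution_eq hi hi', e, e']

theorem comp_smul (h : IsL1Multiplier m A) {c : ℝ} (hc : 0 < c) :
    IsL1Multiplier (fun ξ ↦ m (c • ξ)) A := by
  obtain ⟨K, hm, hi, h, e⟩ := h
  set n := Module.finrank ℝ E
  have hcn : |((c⁻¹ ^ n)⁻¹ : ℝ)| = c ^ n := by
    rw [abs_of_pos (by positivity), inv_pow, inv_inv]
  have hcn0 : (c ^ n : ℝ) ≠ 0 := by positivity
  refine ⟨fun x ↦ ((c ^ n)⁻¹ : ℝ) • K (c⁻¹ • x), ?_, ?_, ?_, ?_⟩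
  · exact (hm.comp (measurable_const_smul (c⁻¹ : ℝ))).const_smul ((c ^ n)⁻¹ : ℝ)
  · exact (hi.comp_smul (inv_ne_zero hc.ne')).smul ((c ^ n)⁻¹ : ℝ)
  · simp only [norm_smul]
    rw [integral_const_mul, Measure.integral_comp_smul volume (fun x ↦ ‖K x‖) c⁻¹, hcn,
      Real.norm_of_nonneg (by positivity), smul_eq_mul, inv_mul_cancel_left₀ hcn0]
    exact h
  · ext ξ
    rw [← e]
    simp only [Real.fourier_eq]
    have := Measure.integral_comp_smul volume
      (fun v ↦ Real.fourierChar (-inner ℝ v (c • ξ)) • K v) c⁻¹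
    rw [hcn] at this
    have h2 : ∫ v, Real.fourierChar (-inner ℝ v (c • ξ)) • K v = ((c ^ n)⁻¹ : ℝ) •
        ∫ v, Real.fourierChar (-inner ℝ (c⁻¹ • v) (c • ξ)) • K (c⁻¹ • v) := by
      rw [this, smul_smul, inv_mul_cancel₀ hcn0, one_smul]
    rw [h2, ← integral_smul]
    congr with v
    rw [smul_comm]
    congr 4
    rw [real_inner_smul_left, real_inner_smul_right, inv_mul_cancel_left₀ hc.ne']

theorem schwartz (f : 𝓢(E, ℂ)) : IsL1Multiplier f (∫ x, ‖(𝓕⁻ f : 𝓢(E, ℂ)) x‖) :=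
  ⟨(𝓕⁻ f : 𝓢(E, ℂ)), (𝓕⁻ f : 𝓢(E, ℂ)).continuous.measurable, (𝓕⁻ f : 𝓢(E, ℂ)).integrable, le_rfl,
    by rw [← SchwartzMap.fourier_coe, FourierTransform.fourier_fourierInv_eq]⟩

end General

/-! ### Gaussian and Poisson kernels on the line -/

/-- The multiplier `e^{2πax - b(2πx)²}` is the Fourier transform of a modulated complex Gaussian of
`L¹` norm `e^{a²/4b}`. -/
theorem exp_linear_sub_sq (a : ℝ) {b : ℝ} (hb : 0 < b) :
    IsL1Multiplier
      (fun x : ℝ ↦ ((Real.exp (a * (2 * Real.pi * x) - b * (2 * Real.pi * x) ^ 2) : ℝ) : ℂ))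
      (Real.exp (a ^ 2 / (4 * b))) := by
  set β : ℝ := 1 / (4 * Real.pi * b) with hβ
  have hβ0 : 0 < β := by positivity
  set c : ℂ := Complex.I * ((a * β : ℝ) : ℂ) with hc
  have hF := fourier_gaussian_pi' (b := (β : ℂ)) (by simpa using hβ0) c
  set K : ℝ → ℂ := fun x ↦ Complex.exp (-Real.pi * β * x ^ 2 + 2 * Real.pi * c * x) with hK
  have hKc : Continuous K := by fun_prop
  have hKn : ∀ x, ‖K x‖ = Real.exp (-(Real.pi * β) * x ^ 2) := fun x ↦ by
    rw [hK, Complex.norm_exp]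
    congr 1
    simp [hc, ← Complex.ofReal_pow]
  have hKi : Integrable K := by
    rw [← integrable_norm_iff hKc.aestronglyMeasurable]
    simp_rw [hKn]
    exact integrable_exp_neg_mul_sq (by positivity)
  have hI : ∫ x, ‖K x‖ = 1 / Real.sqrt β := by
    simp_rw [hKn]
    rw [integral_gaussian, ← div_div, div_self Real.pi_ne_zero, Real.sqrt_div zero_le_one,
      Real.sqrt_one]
  have hsq : (β : ℂ) ^ (1 / 2 : ℂ) = (Real.sqrt β : ℝ) := by
    rw [Real.sqrt_eq_rpow, Complex.ofReal_cpow hβ0.le]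
    simp
  have hs0 : (0 : ℝ) < Real.sqrt β := Real.sqrt_pos.2 hβ0
  have h1 : IsL1Multiplier (𝓕 K) (1 / Real.sqrt β) := ⟨K, hKc.measurable, hKi, hI.le, rfl⟩
  have h2 := h1.const_mul ((Real.exp (a ^ 2 / (4 * b)) * Real.sqrt β : ℝ) : ℂ)
  convert h2 using 1
  · ext x
    rw [hF, hsq, Complex.ofReal_mul]
    have : (Real.sqrt β : ℂ) ≠ 0 := by exact_mod_cast hs0.ne'
    rw [show ∀ u v w : ℂ, v ≠ 0 → u * v * (1 / v * w) = u * w from fun u v w hv ↦ by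
      field_simp, Complex.ofReal_exp, Complex.ofReal_exp, ← Complex.exp_add]
    · congr 1
      have hb' : (b : ℂ) ≠ 0 := by exact_mod_cast hb.ne'
      have hpi : (Real.pi : ℂ) ≠ 0 := by exact_mod_cast Real.pi_ne_zero
      rw [hc, hβ]
      push_cast
      field_simp
      ring_nf
      simp only [Complex.I_sq, Complex.I_pow_four]
      ring
    · exact this
  · rw [Complex.norm_real, Real.norm_of_nonneg (by positivity)]
    field_simp

/-- The Fourier transform of `e^{-2πa|x|}` is the Poisson kernel. -/
theorem fourier_exp_neg_abs {a : ℝ} (ha : 0 < a) :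
    𝓕 (fun x : ℝ ↦ ((Real.exp (-a * (2 * Real.pi * |x|)) : ℝ) : ℂ)) =
      fun y : ℝ ↦ ((a / (Real.pi * (a ^ 2 + y ^ 2)) : ℝ) : ℂ) := by
  ext y
  rw [Real.fourier_real_eq_integral_exp_smul]
  set z₁ : ℂ := ((-(2 * Real.pi * a) : ℝ) : ℂ) + ((-(2 * Real.pi * y) : ℝ) : ℂ) * Complex.I with hz₁
  set z₂ : ℂ := (((2 * Real.pi * a) : ℝ) : ℂ) + ((-(2 * Real.pi * y) : ℝ) : ℂ) * Complex.I with hz₂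
  have hr₁ : z₁.re < 0 := by simp [hz₁]; positivity
  have hr₂ : 0 < z₂.re := by simp [hz₂]; positivity
  set f : ℝ → ℂ := fun v ↦ Complex.exp (((-2 * Real.pi * v * y : ℝ) : ℂ) * Complex.I) •
    ((Real.exp (-a * (2 * Real.pi * |v|)) : ℝ) : ℂ) with hf
  have e₁ : Set.EqOn (fun v : ℝ ↦ Complex.exp (z₁ * v)) f (Set.Ioi 0) := fun v hv ↦ by
    have hv : 0 < v := hv
    simp only [hf, smul_eq_mul, Complex.ofReal_exp, ← Complex.exp_add, abs_of_pos hv, hz₁]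
    congr 1
    push_cast
    ring
  have e₂ : Set.EqOn (fun v : ℝ ↦ Complex.exp (z₂ * v)) f (Set.Iic 0) := fun v hv ↦ by
    have hv : v ≤ 0 := hv
    simp only [hf, smul_eq_mul, Complex.ofReal_exp, ← Complex.exp_add, abs_of_nonpos hv, hz₂]
    congr 1
    push_cast
    ring
  have i₁ : IntegrableOn f (Set.Ioi 0) :=
    (integrableOn_exp_mul_complex_Ioi hr₁ 0).congr_fun e₁ measurableSet_Ioi
  have i₂ : IntegrableOn f (Set.Iic 0) :=
    (integrableOn_exp_mul_complex_Iic hr₂ 0).congr_fun e₂ measurableSet_Iic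
  rw [← intervalIntegral.integral_Iic_add_Ioi i₂ i₁, ← setIntegral_congr_fun measurableSet_Ioi e₁,
    ← setIntegral_congr_fun measurableSet_Iic e₂, integral_exp_mul_complex_Ioi hr₁,
    integral_exp_mul_complex_Iic hr₂]
  have n₁ : z₁ ≠ 0 := fun h ↦ by simp [h] at hr₁
  have n₂ : z₂ ≠ 0 := fun h ↦ by simp [h] at hr₂
  have n₃ : (((Real.pi * (a ^ 2 + y ^ 2)) : ℝ) : ℂ) ≠ 0 := by
    exact_mod_cast (by positivity : Real.pi * (a ^ 2 + y ^ 2) ≠ 0)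
  simp only [Complex.ofReal_zero, mul_zero, Complex.exp_zero]
  rw [Complex.ofReal_div, eq_div_iff n₃]
  field_simp
  rw [hz₁, hz₂]
  push_cast
  ring_nf
  simp only [Complex.I_sq]
  ring

/-- The multiplier `e^{-2πa|x|}`: its kernel is the Poisson kernel, nonnegative of integral `1`. -/
theorem exp_neg_abs {a : ℝ} (ha : 0 < a) :
    IsL1Multiplier (fun x : ℝ ↦ ((Real.exp (-a * (2 * Real.pi * |x|)) : ℝ) : ℂ)) 1 := by
  set f : ℝ → ℂ := fun x ↦ ((Real.exp (-a * (2 * Real.pi * |x|)) : ℝ) : ℂ) with hf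
  set k : ℝ → ℝ := fun y ↦ a / (Real.pi * (a ^ 2 + y ^ 2)) with hk
  have hF : 𝓕 f = fun y ↦ (k y : ℂ) := fourier_exp_neg_abs ha
  have hkc : Continuous k := by
    apply Continuous.div continuous_const (by fun_prop)
    intro y
    positivity
  have hfc : Continuous f := by fun_prop
  have hki : Integrable k := by
    have := (integrable_inv_one_add_sq.comp_mul_left' (inv_ne_zero ha.ne')).const_mul
      (1 / (Real.pi * a))
    convert this using 1
    ext y
    simp only [hk]
    field_simp
  have hfi : Integrable f := by
    have : Integrable fun x : ℝ ↦ Real.exp (-a * (2 * Real.pi * |x|)) := by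
      have hc : 0 < 2 * Real.pi * a := by positivity
      have i₁ : IntegrableOn (fun x : ℝ ↦ Real.exp (-a * (2 * Real.pi * |x|))) (Set.Ioi 0) :=
        (integrableOn_exp_mul_Ioi (neg_lt_zero.2 hc) 0).congr_fun (fun x hx ↦ by
          rw [abs_of_pos hx]
          ring_nf) measurableSet_Ioi
      have i₂ : IntegrableOn (fun x : ℝ ↦ Real.exp (-a * (2 * Real.pi * |x|))) (Set.Iic 0) :=
        (integrableOn_exp_mul_Iic hc 0).congr_fun (fun x hx ↦ by
          rw [abs_of_nonpos hx]
          ring_nf) measurableSet_Iic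
      rw [← integrableOn_univ, ← Set.Iic_union_Ioi]
      exact i₂.union i₁
    exact this.ofReal
  have hF' : 𝓕⁻ f = fun y ↦ (k y : ℂ) := by
    rw [Real.fourierInv_eq_fourier_comp_neg]
    simpa [hf] using hF
  have hinv : 𝓕 (fun y ↦ (k y : ℂ)) = f := by
    rw [← hF']
    exact hfc.fourier_fourierInv_eq hfi (hF ▸ hki.ofReal)
  refine ⟨fun y ↦ (k y : ℂ), (Complex.continuous_ofReal.comp hkc).measurable, hki.ofReal, ?_, hinv⟩
  have h0 := congrFun hinv 0
  rw [Real.fourier_real_eq] at h0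
  simp only [mul_zero, neg_zero, AddChar.map_zero_eq_one, one_smul] at h0
  rw [integral_complex_ofReal] at h0
  have : ∫ y, k y = 1 := by
    have h1 : f 0 = 1 := by simp [hf]
    rw [h1] at h0
    exact_mod_cast h0
  rw [← this]
  apply le_of_eq
  congr with y
  rw [Complex.norm_real, Real.norm_of_nonneg]
  positivity

/-- `e^{a|x|} = e^{ax} + e^{-ax} - e^{-a|x|}` reduces the growing symbol to Gaussian and Poisson
kernels. -/
theorem exp_abs_sub_sq {a b : ℝ} (ha : 0 ≤ a) (hb : 0 < b) :
    IsL1Multiplier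
      (fun x : ℝ ↦ ((Real.exp (a * (2 * Real.pi * |x|) - b * (2 * Real.pi * x) ^ 2) : ℝ) : ℂ))
      (4 * Real.exp (a ^ 2 / (4 * b))) := by
  have h1 := exp_linear_sub_sq a hb
  rcases ha.eq_or_lt with rfl | ha
  · simp only [zero_mul] at h1 ⊢
    exact h1.mono (by nlinarith [Real.exp_pos (0 ^ 2 / (4 * b))])
  have h2 := exp_linear_sub_sq (-a) hb
  have h3 := ((exp_linear_sub_sq 0 hb).mul (exp_neg_abs ha)).const_mul (-1)
  have h := (h1.add h2).add h3
  have hexp : 1 ≤ Real.exp (a ^ 2 / (4 * b)) := Real.one_le_exp (by positivity)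
  have h' := h.mono (A₂ := 4 * Real.exp (a ^ 2 / (4 * b))) (by
    simp
    linarith)
  convert h' using 1
  ext x
  rw [← Complex.ofReal_mul, ← Real.exp_add, neg_one_mul, ← Complex.ofReal_neg,
    ← Complex.ofReal_add, ← Complex.ofReal_add]
  congr 1
  simp only [sub_eq_add_neg, Real.exp_add]
  rcases le_total 0 x with hx | hx
  · rw [abs_of_nonneg hx]
    ring_nf
    simp
  · rw [abs_of_nonpos hx]
    ring_nf
    simp

end IsL1Multiplier

/-! ### Multipliers on `ℝ^d`: tensor products and localised Gevrey-heat symbols -/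

theorem IsL1Multiplier.pi {m : ℝ → ℂ} {A : ℝ} (h : IsL1Multiplier m A) (d : ℕ) :
    IsL1Multiplier (fun ξ : Space d ↦ ∏ i, m (ξ i)) (A ^ d) := by
  obtain ⟨K, hm, hi, hA, rfl⟩ := h
  have hmp := PiLp.volume_preserving_toLp (Fin d)
  have hme := (MeasurableEquiv.toLp 2 (Fin d → ℝ)).measurableEmbedding
  refine ⟨fun x ↦ ∏ i, K (x i), ?_, ?_, ?_, ?_⟩
  · exact Finset.measurable_fun_prod _ fun i _ ↦ hm.comp (by fun_prop)
  · rw [← hmp.integrable_comp_emb hme]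
    exact Integrable.fintype_prod (f := fun _ ↦ K) fun _ ↦ hi
  · rw [← hmp.integral_comp hme]
    simp only [norm_prod]
    have := integral_fintype_prod_volume_eq_pow (ι := Fin d) (fun x ↦ ‖K x‖)
    simp only [Fintype.card_fin] at this
    refine this.le.trans ?_
    gcongr
  · ext ξ
    rw [Real.fourier_eq, ← hmp.integral_comp hme]
    simp only [Real.fourier_real_eq]
    rw [← integral_fintype_prod_volume_eq_prod
      (fun i (v : ℝ) ↦ Real.fourierChar (-(v * ξ i)) • K v)]
    congr with x
    simp only [Circle.smul_def, smul_eq_mul, Finset.prod_mul_distrib]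
    congr 1
    rw [PiLp.inner_apply]
    simp only [Real.fourierChar_apply, ← Complex.exp_sum]
    congr 1
    simp [Finset.mul_sum, mul_comm]

theorem l1Norm_two_pi_smul {d : ℕ} (ξ : Space d) :
    l1Norm ((2 * Real.pi) • ξ) = ∑ i, 2 * Real.pi * |ξ i| := by
  simp [l1Norm, abs_mul, abs_of_pos Real.pi_pos]

theorem norm_sq_two_pi_smul {d : ℕ} (ξ : Space d) :
    ‖(2 * Real.pi) • ξ‖ ^ 2 = ∑ i, (2 * Real.pi * ξ i) ^ 2 := by
  rw [EuclideanSpace.norm_sq_eq]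
  simp [abs_of_pos Real.pi_pos, mul_pow]

/-- The symbol `e^{a|ξ|₁ - b|ξ|²}` factors over the coordinates. -/
theorem isL1Multiplier_exp_l1Norm_sub_sq (d : ℕ) {a b : ℝ} (ha : 0 ≤ a) (hb : 0 < b) :
    IsL1Multiplier (fun ξ : Space d ↦ ((Real.exp (a * l1Norm ((2 * Real.pi) • ξ)
      - b * ‖(2 * Real.pi) • ξ‖ ^ 2) : ℝ) : ℂ)) ((4 * Real.exp (a ^ 2 / (4 * b))) ^ d) := by
  convert (IsL1Multiplier.exp_abs_sub_sq ha hb).pi d using 1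
  ext ξ
  rw [← Complex.ofReal_prod, ← Real.exp_sum, l1Norm_two_pi_smul, norm_sq_two_pi_smul,
    Finset.sum_sub_distrib, Finset.mul_sum, Finset.mul_sum]

theorem isL1Multiplier_exp_neg_l1Norm (d : ℕ) {a : ℝ} (ha : 0 < a) :
    IsL1Multiplier (fun ξ : Space d ↦ ((Real.exp (-a * l1Norm ((2 * Real.pi) • ξ)) : ℝ) : ℂ)) 1 := by
  have h := (IsL1Multiplier.exp_neg_abs ha).pi d
  rw [one_pow] at h
  convert h using 1
  ext ξ
  rw [← Complex.ofReal_prod, ← Real.exp_sum, l1Norm_two_pi_smul, Finset.mul_sum]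

section Gaussian

variable (E : Type*) [NormedAddCommGroup E] [InnerProductSpace ℝ E]

theorem one_add_pow_le_exp (M : ℕ) {r : ℝ} (hr : 0 ≤ r) :
    (1 + r) ^ M ≤ 4 ^ M * M.factorial * Real.exp (1 / 2) * Real.exp (r ^ 2 / 2) := by
  have h1 : (1 + r) ^ M ≤ (1 + r) ^ (2 * M) := pow_le_pow_right₀ (by linarith) (by omega)
  have h2 : (1 + r) ^ (2 * M) ≤ (4 * (1 / 2 + r ^ 2 / 2)) ^ M := by
    rw [pow_mul]
    gcongr
    nlinarith [sq_nonneg (r - 1)]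
  have h3 := Real.pow_div_factorial_le_exp (1 / 2 + r ^ 2 / 2) (by positivity) M
  rw [div_le_iff₀ (by positivity), Real.exp_add] at h3
  calc _ ≤ _ := h1.trans h2
    _ = 4 ^ M * (1 / 2 + r ^ 2 / 2) ^ M := mul_pow _ _ _
    _ ≤ 4 ^ M * (Real.exp (1 / 2) * Real.exp (r ^ 2 / 2) * M.factorial) := by gcongr
    _ = _ := by ring

/-- The Gaussian `e^{-|x|²/2}` as a Schwartz function; its derivatives are estimated by the
Faà di Bruno bound for a composition. -/
def gaussianSchwartz : 𝓢(E, ℝ) where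
  toFun x := Real.exp (-(‖x‖ ^ 2 / 2))
  smooth' := by
    apply Real.contDiff_exp.comp
    exact ((contDiff_norm_sq ℝ).div_const 2).neg
  decay' := by
    intro k n
    have hf : Function.HasTemperateGrowth (fun x : E ↦ -(‖x‖ ^ 2 / 2)) := by
      have : (fun x : E ↦ -(‖x‖ ^ 2 / 2)) = fun x : E ↦ (-(1 / 2) : ℝ) * ‖x‖ ^ 2 := by
        ext x
        ring
      rw [this]
      fun_prop
    obtain ⟨l, C, hC, hb⟩ := hf.norm_iteratedFDeriv_le_uniform n
    set M := k + l * n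
    refine ⟨n.factorial * (max C 1) ^ n * (4 ^ M * M.factorial * Real.exp (1 / 2)), fun x ↦ ?_⟩
    have hD : ∀ i, 1 ≤ i → i ≤ n → ‖iteratedFDeriv ℝ i (fun x : E ↦ -(‖x‖ ^ 2 / 2)) x‖ ≤
        (max C 1 * (1 + ‖x‖) ^ l) ^ i := fun i hi hin ↦ by
      refine (hb i hin x).trans ?_
      have h1 : 1 ≤ max C 1 * (1 + ‖x‖) ^ l := by
        refine one_le_mul_of_one_le_of_one_le (le_max_right _ _) (one_le_pow₀ ?_)
        linarith [norm_nonneg x]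
      calc _ ≤ max C 1 * (1 + ‖x‖) ^ l := by
            gcongr
            exact le_max_left _ _
        _ ≤ _ := le_self_pow₀ h1 (by omega)
    have hE : ∀ i, i ≤ n → ‖iteratedFDeriv ℝ i Real.exp (-(‖x‖ ^ 2 / 2))‖ ≤
        Real.exp (-(‖x‖ ^ 2 / 2)) := fun i _ ↦ by
      rw [norm_iteratedFDeriv_eq_norm_iteratedDeriv, iteratedDeriv_eq_iterate, Real.iter_deriv_exp,
        Real.norm_of_nonneg (Real.exp_pos _).le]
    have key := norm_iteratedFDeriv_comp_le (n := n) (N := ∞) Real.contDiff_exp hf.1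
      (by exact_mod_cast le_top) x hE hD
    calc ‖x‖ ^ k * ‖iteratedFDeriv ℝ n (fun x : E ↦ Real.exp (-(‖x‖ ^ 2 / 2))) x‖
        ≤ (1 + ‖x‖) ^ k * (n.factorial * Real.exp (-(‖x‖ ^ 2 / 2)) *
          (max C 1 * (1 + ‖x‖) ^ l) ^ n) := by
          gcongr
          · linarith
          · exact key
      _ = n.factorial * (max C 1) ^ n * Real.exp (-(‖x‖ ^ 2 / 2)) * (1 + ‖x‖) ^ M := by
          rw [mul_pow, ← pow_mul, pow_add]
          ring
      _ ≤ n.factorial * (max C 1) ^ n * Real.exp (-(‖x‖ ^ 2 / 2)) *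
          (4 ^ M * M.factorial * Real.exp (1 / 2) * Real.exp (‖x‖ ^ 2 / 2)) := by
          gcongr
          exact one_add_pow_le_exp M (norm_nonneg x)
      _ = n.factorial * (max C 1) ^ n * (4 ^ M * M.factorial * Real.exp (1 / 2)) *
          (Real.exp (-(‖x‖ ^ 2 / 2)) * Real.exp (‖x‖ ^ 2 / 2)) := by ring
      _ = _ := by rw [← Real.exp_add, neg_add_cancel, Real.exp_zero, mul_one]

theorem exists_schwartz_pow_four_mul_gaussian :
    ∃ f : 𝓢(E, ℂ), ∀ x, f x = ((‖x‖ ^ 4 * Real.exp (-(‖x‖ ^ 2 / 2)) : ℝ) : ℂ) := by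
  have hg : Function.HasTemperateGrowth (fun x : E ↦ (‖x‖ ^ 2) ^ 2) := by fun_prop
  refine ⟨SchwartzMap.postcompCLM Complex.ofRealCLM
    (SchwartzMap.smulLeftCLM ℝ (fun x : E ↦ (‖x‖ ^ 2) ^ 2) (gaussianSchwartz E)), fun x ↦ ?_⟩
  rw [SchwartzMap.postcompCLM_apply, SchwartzMap.smulLeftCLM_apply_apply hg]
  simp only [Complex.ofRealCLM_apply, smul_eq_mul, ← pow_mul]
  rfl

end Gaussian

namespace DyadicCutoff

variable {d : ℕ} (Θ : DyadicCutoff d)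

/-- A cut-off equal to `1` on the support of `φ` and vanishing near `0` and near infinity. -/
def fat (η : Space d) : ℝ := Θ.χ ((1 / 4 : ℝ) • η) - Θ.χ ((2 : ℝ) • η)

theorem φ_eq_zero_of_le {η : Space d} (h : ‖η‖ ≤ 3 / 4) : Θ.φ η = 0 := by
  rw [φ, Θ.eq_one η h, Θ.eq_one, sub_self]
  rw [norm_smul, Real.norm_of_nonneg (by norm_num)]
  linarith [norm_nonneg η]

theorem φ_eq_zero_of_ge {η : Space d} (h : 8 / 3 ≤ ‖η‖) : Θ.φ η = 0 := by
  rw [φ, Θ.eq_zero η (by linarith), Θ.eq_zero, sub_self]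
  rw [norm_smul, Real.norm_of_nonneg (by norm_num)]
  linarith

theorem fat_eq_one {η : Space d} (h : 3 / 4 ≤ ‖η‖) (h' : ‖η‖ ≤ 8 / 3) : Θ.fat η = 1 := by
  rw [fat, Θ.eq_one ((1 / 4 : ℝ) • η), Θ.eq_zero, sub_zero]
  · rw [norm_smul, Real.norm_of_nonneg (by norm_num)]
    linarith
  · rw [norm_smul, Real.norm_of_nonneg (by norm_num)]
    linarith

theorem fat_eq_zero_of_le {η : Space d} (h : ‖η‖ ≤ 3 / 8) : Θ.fat η = 0 := by
  rw [fat, Θ.eq_one ((1 / 4 : ℝ) • η), Θ.eq_one, sub_self]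
  · rw [norm_smul, Real.norm_of_nonneg (by norm_num)]
    linarith
  · rw [norm_smul, Real.norm_of_nonneg (by norm_num)]
    linarith [norm_nonneg η]

theorem fat_eq_zero_of_ge {η : Space d} (h : 16 / 3 ≤ ‖η‖) : Θ.fat η = 0 := by
  rw [fat, Θ.eq_zero ((1 / 4 : ℝ) • η), Θ.eq_zero, sub_self]
  · rw [norm_smul, Real.norm_of_nonneg (by norm_num)]
    linarith
  · rw [norm_smul, Real.norm_of_nonneg (by norm_num)]
    linarith [norm_nonneg η]

theorem fat_mul_φ (η : Space d) : Θ.fat η * Θ.φ η = Θ.φ η := by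
  by_cases h : ‖η‖ ≤ 3 / 4
  · rw [Θ.φ_eq_zero_of_le h, mul_zero]
  by_cases h' : 8 / 3 ≤ ‖η‖
  · rw [Θ.φ_eq_zero_of_ge h', mul_zero]
  · rw [Θ.fat_eq_one (not_le.1 h).le (not_le.1 h').le, one_mul]

theorem fat_contDiff : ContDiff ℝ ∞ Θ.fat :=
  (Θ.smooth.comp (contDiff_const_smul _)).sub (Θ.smooth.comp (contDiff_const_smul _))

theorem φ_contDiff : ContDiff ℝ ∞ Θ.φ :=
  (Θ.smooth.comp (contDiff_const_smul _)).sub Θ.smooth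

theorem hasCompactSupport_of_ge {f : Space d → ℂ} {R : ℝ} (h : ∀ η, R ≤ ‖η‖ → f η = 0) :
    HasCompactSupport f :=
  HasCompactSupport.of_support_subset_isCompact (isCompact_closedBall (0 : Space d) R) fun η hη ↦ by
    rw [mem_closedBall_zero_iff]
    by_contra hlt
    exact hη (h η (not_le.1 hlt).le)

/-- Division by a power of `|η|` is harmless on the support of the fattened cut-off. -/
theorem exists_schwartz_fat_div (n : ℕ) :
    ∃ f : 𝓢(Space d, ℂ), ∀ η, f η = ((Θ.fat η / (‖η‖ ^ 2) ^ n : ℝ) : ℂ) := by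
  have hsm : ContDiff ℝ ∞ (fun η : Space d ↦ Θ.fat η / (‖η‖ ^ 2) ^ n) := by
    rw [contDiff_iff_contDiffAt]
    intro η
    by_cases h : η = 0
    · have : (fun η : Space d ↦ Θ.fat η / (‖η‖ ^ 2) ^ n) =ᶠ[nhds η] fun _ ↦ 0 := by
        filter_upwards [Metric.ball_mem_nhds η (show (0 : ℝ) < 3 / 8 by norm_num)] with ζ hζ
        rw [h, mem_ball_zero_iff] at hζ
        rw [Θ.fat_eq_zero_of_le hζ.le, zero_div]
      exact contDiffAt_const.congr_of_eventuallyEq this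
    · exact Θ.fat_contDiff.contDiffAt.div ((contDiff_norm_sq ℝ).pow n).contDiffAt
        (pow_ne_zero _ (pow_ne_zero _ (norm_ne_zero_iff.2 h)))
  have hs : HasCompactSupport (fun η : Space d ↦ ((Θ.fat η / (‖η‖ ^ 2) ^ n : ℝ) : ℂ)) :=
    hasCompactSupport_of_ge (R := 16 / 3) fun η hη ↦ by
      rw [Θ.fat_eq_zero_of_ge hη, zero_div, Complex.ofReal_zero]
  exact ⟨hs.toSchwartzMap (Complex.ofRealCLM.contDiff.comp hsm), fun η ↦ rfl⟩

end DyadicCutoff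

/-- The multiplier of a heat semigroup with Gevrey weight on a dyadic annulus decays like
`(1 + τ²)⁻¹` in the parabolic time `τ = b/λ²`, uniformly in the scale. -/
theorem exists_isL1Multiplier_fat_gevreyHeat {d : ℕ} (Θ : DyadicCutoff d) (κ : ℝ) :
    ∃ C : ℝ, 0 < C ∧ ∀ (a b l : ℝ), 0 ≤ a → 0 < b → 0 < l → a ^ 2 ≤ κ * b →
      IsL1Multiplier (fun ξ : Space d ↦
        ((Θ.fat (l • ((2 * Real.pi) • ξ)) : ℝ) : ℂ) *
          ((Real.exp (a * l1Norm ((2 * Real.pi) • ξ) - b * ‖(2 * Real.pi) • ξ‖ ^ 2) : ℝ) : ℂ))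
        (C * (1 + (b / l ^ 2) ^ 2)⁻¹) := by
  obtain ⟨f₀, hf₀⟩ := Θ.exists_schwartz_fat_div 0
  obtain ⟨f₂, hf₂⟩ := Θ.exists_schwartz_fat_div 2
  obtain ⟨h, hh⟩ := exists_schwartz_pow_four_mul_gaussian (Space d)
  have m₀ := IsL1Multiplier.schwartz f₀
  have m₂ := IsL1Multiplier.schwartz f₂
  have mh := IsL1Multiplier.schwartz h
  set S₀ := ∫ x, ‖(𝓕⁻ f₀ : 𝓢(Space d, ℂ)) x‖
  set S₂ := ∫ x, ‖(𝓕⁻ f₂ : 𝓢(Space d, ℂ)) x‖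
  set Sh := ∫ x, ‖(𝓕⁻ h : 𝓢(Space d, ℂ)) x‖
  set Gd := (4 * Real.exp (κ / 2)) ^ d
  have n₀ := m₀.nonneg
  have n₂ := m₂.nonneg
  have nh := mh.nonneg
  refine ⟨Gd * (S₀ + Sh * S₂ + 1), by positivity, fun a b l ha hb hl hab ↦ ?_⟩
  have hpi := Real.two_pi_pos
  have hle₁ : a ^ 2 / (4 * b) ≤ κ / 2 := by
    rw [div_le_div_iff₀ (by positivity) (by positivity)]
    nlinarith [sq_nonneg a]
  have hle₂ : a ^ 2 / (4 * (b / 2)) ≤ κ / 2 := by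
    rw [div_le_div_iff₀ (by positivity) (by positivity)]
    nlinarith [sq_nonneg a]
  have g₁ := (isL1Multiplier_exp_l1Norm_sub_sq d ha hb).mono (A₂ := Gd) (by simp only [Gd]; gcongr)
  have g₂ := (isL1Multiplier_exp_l1Norm_sub_sq d ha (half_pos hb)).mono (A₂ := Gd) (by simp only [Gd]; gcongr)
  have c₀ := m₀.comp_smul (mul_pos hl hpi)
  have c₂ := m₂.comp_smul (mul_pos hl hpi)
  have ch := mh.comp_smul (mul_pos (Real.sqrt_pos.2 hb) hpi)
  set τ := b / l ^ 2 with hτ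
  -- Write `1 = (1 + τ²)⁻¹ (1 + τ²)`. In the part with `τ²`, half of the Gaussian is used to bound
  -- `τ² = (b |ξ|²)² / (l |ξ|)⁴`, where `(l |ξ|)⁻⁴` is harmless on the annulus.
  have key := ((g₁.mul c₀).add (g₂.mul (ch.mul c₂))).const_mul (((1 + τ ^ 2)⁻¹ : ℝ) : ℂ)
  have hτ0 : (0 : ℝ) < 1 + τ ^ 2 := by positivity
  refine (show IsL1Multiplier _ _ from ?_ : IsL1Multiplier _
    (‖(((1 + τ ^ 2)⁻¹ : ℝ) : ℂ)‖ * (Gd * S₀ + Gd * (Sh * S₂)))).mono ?_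
  · convert key using 1
    ext ξ
    set ζ := (2 * Real.pi) • ξ with hζ
    have e1 : ∀ c : ℝ, (c * (2 * Real.pi)) • ξ = c • ζ := fun c ↦ by rw [hζ, smul_smul]
    clear_value ζ
    simp only [e1, hf₀, hf₂, hh, ← Complex.ofReal_mul, ← Complex.ofReal_add]
    congr 1
    rw [norm_smul, norm_smul, Real.norm_of_nonneg hl.le, Real.norm_of_nonneg (Real.sqrt_nonneg b),
      mul_pow _ _ 4, mul_pow (Real.sqrt b) _ 2, show Real.sqrt b ^ 4 = b ^ 2 by
        rw [show 4 = 2 * 2 from rfl, pow_mul, Real.sq_sqrt hb.le], Real.sq_sqrt hb.le, pow_zero,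
      div_one]
    by_cases hz : ζ = 0
    · rw [hz, smul_zero, Θ.fat_eq_zero_of_le (by rw [norm_zero]; norm_num)]
      simp
    · have hz' : ‖ζ‖ ≠ 0 := norm_ne_zero_iff.2 hz
      have hexp : Real.exp (a * l1Norm ζ - b / 2 * ‖ζ‖ ^ 2) * Real.exp (-(b * ‖ζ‖ ^ 2 / 2)) =
          Real.exp (a * l1Norm ζ - b * ‖ζ‖ ^ 2) := by
        rw [← Real.exp_add]
        congr 1
        ring
      rw [← hexp]
      rw [hτ] at hτ0 ⊢
      field_simp
  · rw [Complex.norm_real, Real.norm_of_nonneg (inv_nonneg.2 hτ0.le), mul_comm]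
    gcongr
    have : 0 < Gd := by positivity
    nlinarith

/-! ### The dual of `L^q` -/

section Riesz

variable {α : Type*} [MeasurableSpace α]

theorem indicatorConstLp_eq_smul_one {m : Measure α} {q : ℝ≥0∞} {s : Set α}
    (hs : MeasurableSet s) (hμ : m s ≠ ⊤) (c : ℂ) :
    indicatorConstLp q hs hμ c = c • indicatorConstLp q hs hμ (1 : ℂ) := by
  ext1
  filter_upwards [indicatorConstLp_coeFn (p := q) (hs := hs) (hμs := hμ) (c := c),
    indicatorConstLp_coeFn (p := q) (hs := hs) (hμs := hμ) (c := (1 : ℂ)),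
    Lp.coeFn_smul c (indicatorConstLp q hs hμ (1 : ℂ))] with x h1 h2 h3
  rw [h1, h3, Pi.smul_apply, h2]
  by_cases hx : x ∈ s <;> simp [hx]

theorem clm_ext_indicatorConstLp {m : Measure α} {q : ℝ≥0∞} [Fact (1 ≤ q)] (hq : q ≠ ⊤)
    {S T : Lp ℂ q m →L[ℂ] ℂ}
    (h : ∀ (s : Set α) (hs : MeasurableSet s) (hμ : m s ≠ ⊤),
      S (indicatorConstLp q hs hμ (1 : ℂ)) = T (indicatorConstLp q hs hμ (1 : ℂ))) : S = T := by
  ext u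
  induction u using Lp.induction hq with
  | indicatorConst c hs hμs =>
    rw [Lp.simpleFunc.coe_indicatorConst, indicatorConstLp_eq_smul_one, map_smul, map_smul, h]
  | add hf hg _ h1 h2 => rw [map_add, map_add, h1, h2]
  | isClosed => exact isClosed_eq S.continuous T.continuous

/-- The set function `s ↦ Λ(1_s)` attached to a continuous functional on `L^q` of a finite
measure. -/
def dualMeasure {m : Measure α} [IsFiniteMeasure m] {q : ℝ≥0∞} [Fact (1 ≤ q)] (hq : q ≠ ⊤)
    (Λ : Lp ℂ q m →L[ℂ] ℂ) : ComplexMeasure α where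
  measureOf' s := open Classical in
    if hs : MeasurableSet s then Λ (indicatorConstLp q hs (measure_ne_top m s) (1 : ℂ)) else 0
  empty' := by
    rw [dif_pos MeasurableSet.empty]
    simp
  not_measurable' s hs := by rw [dif_neg hs]
  m_iUnion' := by
    intro f hf hd
    have hU : MeasurableSet (⋃ i, f i) := MeasurableSet.iUnion hf
    have hb : ∀ t : Finset ℕ, MeasurableSet (⋃ i ∈ t, f i) := fun t ↦
      t.measurableSet_biUnion fun i _ ↦ hf i
    rw [dif_pos hU]
    simp only [hf, ↓reduceDIte]
    apply Λ.hasSum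
    have hsum : ∀ t : Finset ℕ, ∑ i ∈ t, indicatorConstLp q (hf i) (measure_ne_top m _) (1 : ℂ) =
        indicatorConstLp q (hb t) (measure_ne_top m _) (1 : ℂ) := by
      intro t
      induction t using Finset.induction_on with
      | empty => simp
      | insert a t ha ih =>
        rw [Finset.sum_insert ha, ih, ← indicatorConstLp_disjoint_union]
        · congr 1
          simp
        · rw [Set.disjoint_iUnion₂_right]
          intro i hi
          exact hd (fun h ↦ ha (h ▸ hi))
    rw [HasSum]
    simp only [hsum]
    refine tendsto_indicatorConstLp_set hq ?_
    have he : ∀ t : Finset ℕ, symmDiff (⋃ i ∈ t, f i) (⋃ i, f i) =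
        (⋃ i, f i) \ ⋃ i ∈ t, f i := fun t ↦ by
      rw [symmDiff_of_le]
      exact Set.iUnion₂_subset_iUnion _ _
    simp only [he]
    have hanti : Antitone fun t : Finset ℕ ↦ (⋃ i, f i) \ ⋃ i ∈ t, f i := fun s t hst ↦
      Set.sdiff_subset_sdiff_right (Set.biUnion_subset_biUnion_left hst)
    have := tendsto_measure_iInter_atTop (μ := m)
      (fun t ↦ (hU.diff (hb t)).nullMeasurableSet) hanti ⟨∅, measure_ne_top m _⟩
    have hempty : ⋂ t : Finset ℕ, ((⋃ i, f i) \ ⋃ i ∈ t, f i) = ∅ := by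
      ext x
      simp only [Set.mem_iInter, Set.mem_sdiff, Set.mem_iUnion, Set.mem_empty_iff_false, iff_false]
      intro h
      obtain ⟨⟨i, hi⟩, -⟩ := h ∅
      exact (h {i}).2 ⟨i, Finset.mem_singleton_self i, hi⟩
    rw [hempty, measure_empty] at this
    exact this

theorem dualMeasure_apply {m : Measure α} [IsFiniteMeasure m] {q : ℝ≥0∞} [Fact (1 ≤ q)]
    (hq : q ≠ ⊤) (Λ : Lp ℂ q m →L[ℂ] ℂ) {s : Set α} (hs : MeasurableSet s) :
    dualMeasure hq Λ s = Λ (indicatorConstLp q hs (measure_ne_top m s) (1 : ℂ)) :=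
  dif_pos hs

/-- The Radon-Nikodym density representing a functional on `L^q` of a finite measure on
characteristic functions. -/
theorem exists_density_of_dual {m : Measure α} [IsFiniteMeasure m] {q : ℝ≥0∞} [Fact (1 ≤ q)]
    (hq : q ≠ ⊤) (Λ : Lp ℂ q m →L[ℂ] ℂ) :
    ∃ h : α → ℂ, Measurable h ∧ Integrable h m ∧ ∀ (s : Set α) (hs : MeasurableSet s),
      Λ (indicatorConstLp q hs (measure_ne_top m s) (1 : ℂ)) = ∫ x in s, h x ∂m := by
  set c := dualMeasure hq Λ with hc
  have hac : ∀ s, MeasurableSet s → m s = 0 → c s = 0 := fun s hs h0 ↦ by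
    rw [hc, dualMeasure_apply hq Λ hs]
    have : indicatorConstLp q hs (measure_ne_top m s) (1 : ℂ) = 0 := by
      rw [← norm_eq_zero, norm_indicatorConstLp (zero_lt_one.trans_le Fact.out).ne' hq]
      have hq0 : 0 < q.toReal :=
        ENNReal.toReal_pos (zero_lt_one.trans_le Fact.out).ne' hq
      simp [Measure.real, h0, hq0.ne']
    rw [this, map_zero]
  have hre : ∀ s, ComplexMeasure.re c s = (c s).re := fun s ↦ rfl
  have him : ∀ s, ComplexMeasure.im c s = (c s).im := fun s ↦ rfl
  have acre : ComplexMeasure.re c ≪ᵥ m.toENNRealVectorMeasure :=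
    VectorMeasure.AbsolutelyContinuous.mk fun s hs h0 ↦ by
      rw [Measure.toENNRealVectorMeasure_apply_measurable hs] at h0
      rw [hre, hac s hs h0, Complex.zero_re]
  have acim : ComplexMeasure.im c ≪ᵥ m.toENNRealVectorMeasure :=
    VectorMeasure.AbsolutelyContinuous.mk fun s hs h0 ↦ by
      rw [Measure.toENNRealVectorMeasure_apply_measurable hs] at h0
      rw [him, hac s hs h0, Complex.zero_im]
  have dre := SignedMeasure.withDensityᵥ_rnDeriv_eq _ m acre
  have dim := SignedMeasure.withDensityᵥ_rnDeriv_eq _ m acim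
  set u := (ComplexMeasure.re c).rnDeriv m
  set v := (ComplexMeasure.im c).rnDeriv m
  have hu : Integrable u m := SignedMeasure.integrable_rnDeriv _ m
  have hv : Integrable v m := SignedMeasure.integrable_rnDeriv _ m
  have hum : Measurable u := SignedMeasure.measurable_rnDeriv _ m
  have hvm : Measurable v := SignedMeasure.measurable_rnDeriv _ m
  refine ⟨fun x ↦ (u x : ℂ) + v x * Complex.I, by fun_prop,
    hu.ofReal.add (hv.ofReal.mul_const _), fun s hs ↦ ?_⟩
  have hu' : Integrable (fun x ↦ (u x : ℂ)) (m.restrict s) := hu.ofReal.restrict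
  have hv' : Integrable (fun x ↦ (v x : ℂ) * Complex.I) (m.restrict s) :=
    (hv.ofReal.mul_const _).restrict
  rw [integral_add hu' hv',
    integral_mul_const, integral_complex_ofReal, integral_complex_ofReal,
    ← dualMeasure_apply hq Λ hs, ← hc, ← withDensityᵥ_apply hu hs, ← withDensityᵥ_apply hv hs, dre,
    dim, hre, him, Complex.re_add_im]

/-- Multiplication by the characteristic function of a measurable set, on `L^q`. -/
def indicatorLpLM (q : ℝ≥0∞) [Fact (1 ≤ q)] (m : Measure α) {A : Set α} (hA : MeasurableSet A) :
    Lp ℂ q m →ₗ[ℂ] Lp ℂ q m where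
  toFun u := ((Lp.memLp u).indicator hA).toLp
  map_add' u v := by
    rw [← MemLp.toLp_add]
    apply MemLp.toLp_congr
    filter_upwards [Lp.coeFn_add u v] with x hx
    by_cases h : x ∈ A
    · simpa [h] using hx
    · simp [h]
  map_smul' c u := by
    rw [RingHom.id_apply, ← MemLp.toLp_const_smul]
    apply MemLp.toLp_congr
    filter_upwards [Lp.coeFn_smul c u] with x hx
    by_cases h : x ∈ A
    · simpa [h] using hx
    · simp [h]

theorem indicatorLpLM_apply {q : ℝ≥0∞} [Fact (1 ≤ q)] {m : Measure α} {A : Set α}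
    (hA : MeasurableSet A) (u : Lp ℂ q m) :
    indicatorLpLM q m hA u = ((Lp.memLp u).indicator hA).toLp := rfl

theorem norm_indicatorLpLM_le {q : ℝ≥0∞} [Fact (1 ≤ q)] {m : Measure α} {A : Set α}
    (hA : MeasurableSet A) (u : Lp ℂ q m) : ‖indicatorLpLM q m hA u‖ ≤ 1 * ‖u‖ := by
  rw [one_mul, indicatorLpLM_apply, Lp.norm_toLp, Lp.norm_def]
  exact ENNReal.toReal_mono (Lp.eLpNorm_ne_top u) (eLpNorm_indicator_le _)

/-- `indicatorLpLM` as a continuous linear map. -/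
def indicatorLpCLM (q : ℝ≥0∞) [Fact (1 ≤ q)] (m : Measure α) {A : Set α} (hA : MeasurableSet A) :
    Lp ℂ q m →L[ℂ] Lp ℂ q m :=
  LinearMap.mkContinuous (indicatorLpLM q m hA) 1 (norm_indicatorLpLM_le hA)

theorem coeFn_indicatorLpCLM {q : ℝ≥0∞} [Fact (1 ≤ q)] {m : Measure α} {A : Set α}
    (hA : MeasurableSet A) (u : Lp ℂ q m) : indicatorLpCLM q m hA u =ᵐ[m] A.indicator u := by
  have h : indicatorLpCLM q m hA u = indicatorLpLM q m hA u := rfl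
  rw [h, indicatorLpLM_apply]
  exact MemLp.coeFn_toLp _

/-- The Riesz representation of `(L^q)*` for a finite measure. The density is tested against
`conj h |h|^{p-2}` on the sets `{|h| ≤ n}`, where it is bounded. -/
theorem exists_memLp_of_dual_of_finite {m : Measure α} [IsFiniteMeasure m] {p q : ℝ≥0∞}
    [Fact (1 ≤ p)] [Fact (1 ≤ q)] (hp1 : 1 < p) (hp : p ≠ ⊤) (hq : q ≠ ⊤)
    [hpq : ENNReal.HolderConjugate p q]
    (Λ : Lp ℂ q m →L[ℂ] ℂ) :
    ∃ h : α → ℂ, MemLp h p m ∧ eLpNorm h p m ≤ ‖Λ‖ₑ ∧ ∀ u : Lp ℂ q m, Λ u = ∫ x, h x * u x ∂m := by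
  obtain ⟨h, hm, hi, hh⟩ := exists_density_of_dual hq Λ
  have hpqr : p.toReal.HolderConjugate q.toReal := ENNReal.HolderConjugate.toReal_of_ne_top hp hq
  set P := p.toReal with hP
  set Q := q.toReal with hQ
  have hp0 : p ≠ 0 := (zero_lt_one.trans hp1).ne'
  have hq0 : q ≠ 0 := (zero_lt_one.trans_le (Fact.out : 1 ≤ q)).ne'
  have hP0 : 0 < P := hpqr.pos
  have hQ0 : 0 < Q := hpqr.symm.pos
  have hP1 : 1 < P := hpqr.lt
  -- the representation on `{|h| ≤ n}`
  have hA : ∀ n : ℕ, MeasurableSet {x | ‖h x‖ ≤ n} := fun n ↦ measurableSet_le hm.norm measurable_const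
  have hrep : ∀ (n : ℕ) (u : α → ℂ) (hu : MemLp ({x | ‖h x‖ ≤ n}.indicator u) q m),
      Λ hu.toLp = ∫ x in {x | ‖h x‖ ≤ n}, h x * u x ∂m := by
    intro n u hu
    set A := {x | ‖h x‖ ≤ n} with hAdef
    have hAm : MeasurableSet A := hA n
    have hhA : MemLp (A.indicator h) p m := by
      refine (MemLp.of_bound (C := n) (hm.indicator hAm).aestronglyMeasurable ?_)
      refine Filter.Eventually.of_forall fun x ↦ ?_
      by_cases hx : x ∈ A
      · rw [Set.indicator_of_mem hx]; exact hx
      · rw [Set.indicator_of_notMem hx, norm_zero]; positivity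
    have key : Λ.comp (indicatorLpCLM q m hAm) =
        (ContinuousLinearMap.mul ℂ ℂ).lpPairing m p q hhA.toLp := by
      refine clm_ext_indicatorConstLp hq fun s hs hμ ↦ ?_
      have e1 : indicatorLpCLM q m hAm (indicatorConstLp q hs hμ (1 : ℂ)) =
          indicatorConstLp q (hAm.inter hs) (measure_ne_top m _) (1 : ℂ) := by
        ext1
        filter_upwards [coeFn_indicatorLpCLM (q := q) (m := m) hAm (indicatorConstLp q hs hμ (1 : ℂ)),
          indicatorConstLp_coeFn (p := q) (hs := hs) (hμs := hμ) (c := (1 : ℂ)),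
          indicatorConstLp_coeFn (p := q) (hs := hAm.inter hs) (hμs := measure_ne_top m _)
            (c := (1 : ℂ))] with x h1 h2 h3
        rw [h1, h3]
        by_cases hx' : x ∈ A <;> by_cases hx : x ∈ s <;> simp [hx, hx', h2]
      rw [ContinuousLinearMap.comp_apply, e1, hh _ (hAm.inter hs),
        ContinuousLinearMap.lpPairing_eq_integral, ← integral_indicator (hAm.inter hs)]
      apply integral_congr_ae
      filter_upwards [indicatorConstLp_coeFn (p := q) (hs := hs) (hμs := hμ) (c := (1 : ℂ)),
        hhA.coeFn_toLp] with x h1 h2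
      rw [h1, h2]
      by_cases hx : x ∈ s <;> by_cases hx' : x ∈ A <;> simp [hx, hx']
    have e2 : indicatorLpCLM q m hAm hu.toLp = hu.toLp := by
      ext1
      filter_upwards [coeFn_indicatorLpCLM (q := q) (m := m) hAm hu.toLp, hu.coeFn_toLp] with x h1 h2
      rw [h1]
      by_cases hx : x ∈ A
      · rw [Set.indicator_of_mem hx]
      · rw [Set.indicator_of_notMem hx, h2, Set.indicator_of_notMem hx]
    rw [← e2, ← ContinuousLinearMap.comp_apply, key, ContinuousLinearMap.lpPairing_eq_integral,
      ← integral_indicator hAm]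
    apply integral_congr_ae
    filter_upwards [hu.coeFn_toLp, hhA.coeFn_toLp] with x h1 h2
    rw [h1, h2]
    by_cases hx' : x ∈ A <;> simp [hx']
  have hbound : ∀ n : ℕ, ∫⁻ x in {x | ‖h x‖ ≤ n}, ‖h x‖ₑ ^ P ∂m ≤ ‖Λ‖ₑ ^ P := by
    intro n
    set A := {x | ‖h x‖ ≤ n} with hAdef
    have hAm : MeasurableSet A := hA n
    set J := ∫⁻ x in A, ‖h x‖ₑ ^ P ∂m with hJ
    have hJtop : J ≠ ⊤ := by
      refine ne_top_of_le_ne_top (b := ((n : ℝ≥0∞) ^ P) * m A) ?_ ?_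
      · exact ENNReal.mul_ne_top (ENNReal.rpow_ne_top_of_nonneg hP0.le (by simp))
          (measure_ne_top m A)
      · rw [hJ, ← setLIntegral_const]
        refine setLIntegral_mono measurable_const fun x hx ↦ ENNReal.rpow_le_rpow ?_ hP0.le
        rw [← ofReal_norm, ← ENNReal.ofReal_natCast]
        exact ENNReal.ofReal_le_ofReal hx
    set u : α → ℂ := fun x ↦ (starRingEnd ℂ) (h x) * ((‖h x‖ ^ (P - 2) : ℝ) : ℂ) with hu
    have hum : Measurable u := by
      rw [hu]
      exact (Complex.continuous_conj.measurable.comp hm).mul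
        (Complex.measurable_ofReal.comp (hm.norm.pow_const _))
    have hhu : ∀ x, h x * u x = ((‖h x‖ ^ P : ℝ) : ℂ) := fun x ↦ by
      rw [hu]
      simp only
      rw [← mul_assoc, Complex.mul_conj, Complex.normSq_eq_norm_sq, ← Complex.ofReal_mul]
      congr 1
      rcases (norm_nonneg (h x)).eq_or_lt with h0 | h0
      · rw [← h0, Real.zero_rpow hP0.ne']; simp
      · rw [← Real.rpow_natCast, ← Real.rpow_add h0]; congr 1; push_cast; ring
    have hun : ∀ x, ‖u x‖ₑ ^ Q = ‖h x‖ₑ ^ P := fun x ↦ by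
      have : ‖u x‖ = ‖h x‖ ^ (P - 1) := by
        rw [hu]
        simp only
        rw [norm_mul, RCLike.norm_conj, Complex.norm_real,
          Real.norm_of_nonneg (Real.rpow_nonneg (norm_nonneg _) _)]
        rcases (norm_nonneg (h x)).eq_or_lt with h0 | h0
        · rw [← h0, zero_mul, Real.zero_rpow (by linarith)]
        · rw [← Real.rpow_one_add' h0.le (by linarith)]; congr 1; ring
      rw [← ofReal_norm, ← ofReal_norm, this,
        ENNReal.ofReal_rpow_of_nonneg (by positivity) hQ0.le,
        ENNReal.ofReal_rpow_of_nonneg (by positivity) hP0.le, ← Real.rpow_mul (norm_nonneg _),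
        hpqr.sub_one_mul_conj]
    have huA : eLpNorm (A.indicator u) q m = J ^ (1 / Q) := by
      rw [eLpNorm_indicator_eq_eLpNorm_restrict hAm,
        eLpNorm_eq_lintegral_rpow_enorm_toReal hq0 hq]
      simp only [← hQ, hun]
      rw [hJ]
    have huL : MemLp (A.indicator u) q m :=
      ⟨(hum.indicator hAm).aestronglyMeasurable, by
        rw [huA]; exact ENNReal.rpow_lt_top_of_nonneg (by positivity) hJtop⟩
    have h1 := hrep n u huL
    simp only [← hAdef, hhu] at h1
    rw [integral_complex_ofReal] at h1
    have h2 : J = ‖Λ huL.toLp‖ₑ := by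
      rw [h1, ← ofReal_norm, Complex.norm_real, Real.norm_of_nonneg (by positivity),
        ofReal_integral_eq_lintegral_ofReal, hJ]
      · refine lintegral_congr fun x ↦ ?_
        rw [← ofReal_norm, ENNReal.ofReal_rpow_of_nonneg (by positivity) hP0.le]
      · refine ⟨(hm.norm.pow_const _).aestronglyMeasurable, ?_⟩
        rw [hasFiniteIntegral_iff_enorm]
        refine lt_of_le_of_lt (le_of_eq ?_) hJtop.lt_top
        refine lintegral_congr fun x ↦ ?_
        rw [← ofReal_norm, ← ofReal_norm,
          ENNReal.ofReal_rpow_of_nonneg (by positivity) hP0.le,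
          Real.norm_of_nonneg (by positivity)]
      · exact Filter.Eventually.of_forall fun x ↦ by positivity
    have h3 : J ≤ ‖Λ‖ₑ * J ^ (1 / Q) := by
      calc J = ‖Λ huL.toLp‖ₑ := h2
        _ ≤ ‖Λ‖ₑ * ‖huL.toLp‖ₑ := Λ.le_opENorm _
        _ = ‖Λ‖ₑ * J ^ (1 / Q) := by rw [Lp.enorm_toLp, huA]
    rcases eq_or_ne J 0 with h0 | h0
    · rw [h0]; positivity
    · have hne : J ^ (1 / Q) ≠ 0 := by simp [h0, hQ0, hJtop]
      have hnt : J ^ (1 / Q) ≠ ⊤ := (ENNReal.rpow_lt_top_of_nonneg (by positivity) hJtop).ne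
      have h4 : J ^ (1 / P) ≤ ‖Λ‖ₑ := by
        rw [← ENNReal.mul_le_mul_iff_left hne hnt, ← ENNReal.rpow_add _ _ h0 hJtop]
        have : 1 / P + 1 / Q = 1 := by
          rw [one_div, one_div]; exact hpqr.inv_add_inv_eq_one
        rw [this, ENNReal.rpow_one]
        exact h3
      rwa [one_div, ENNReal.rpow_inv_le_iff hP0] at h4
  have hnorm : eLpNorm h p m ≤ ‖Λ‖ₑ := by
    rw [eLpNorm_eq_lintegral_rpow_enorm_toReal hp0 hp, ← hP, one_div, ENNReal.rpow_inv_le_iff hP0]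
    have hU : (⋃ n : ℕ, {x | ‖h x‖ ≤ n}) = Set.univ :=
      Set.eq_univ_of_forall fun x ↦ Set.mem_iUnion.2 (exists_nat_ge ‖h x‖)
    rw [← setLIntegral_univ, ← hU, setLIntegral_iUnion_of_directed]
    · exact iSup_le hbound
    · refine Monotone.directed_le fun a b hab x hx ↦ ?_
      exact le_trans (show ‖h x‖ ≤ a from hx) (by exact_mod_cast hab)
  have hmem : MemLp h p m := ⟨hm.aestronglyMeasurable, hnorm.trans_lt enorm_lt_top⟩
  refine ⟨h, hmem, hnorm, ?_⟩
  have : Λ = (ContinuousLinearMap.mul ℂ ℂ).lpPairing m p q hmem.toLp := by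
    refine clm_ext_indicatorConstLp hq fun s hs hμ ↦ ?_
    rw [hh s hs, ContinuousLinearMap.lpPairing_eq_integral, ← integral_indicator hs]
    apply integral_congr_ae
    filter_upwards [indicatorConstLp_coeFn (p := q) (hs := hs) (hμs := hμ) (c := (1 : ℂ)),
      hmem.coeFn_toLp] with x h1 h2
    rw [h1, h2]
    by_cases hx : x ∈ s <;> simp [hx]
  intro u
  rw [this, ContinuousLinearMap.lpPairing_eq_integral]
  apply integral_congr_ae
  filter_upwards [hmem.coeFn_toLp] with x h2
  rw [h2]
  rfl

theorem eLpNorm_rpow_smul_withDensity {ν : Measure α} {g : α → ℝ≥0} (hg : Measurable g) {q : ℝ≥0∞}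
    (hq0 : q ≠ 0) (hq : q ≠ ⊤) (u : α → ℂ) :
    eLpNorm (fun x ↦ (((g x : ℝ) ^ (1 / q.toReal) : ℝ) : ℂ) * u x) q ν =
      eLpNorm u q (ν.withDensity fun x ↦ g x) := by
  have hQ : 0 < q.toReal := ENNReal.toReal_pos hq0 hq
  rw [eLpNorm_eq_lintegral_rpow_enorm_toReal hq0 hq, eLpNorm_eq_lintegral_rpow_enorm_toReal hq0 hq,
    lintegral_withDensity_eq_lintegral_mul_non_measurable _ hg.coe_nnreal_ennreal
      (Filter.Eventually.of_forall fun x ↦ ENNReal.coe_lt_top)]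
  congr 1
  refine lintegral_congr fun x ↦ ?_
  rw [enorm_mul, ENNReal.mul_rpow_of_nonneg _ _ hQ.le, Pi.mul_apply]
  congr 1
  rw [← ofReal_norm, Complex.norm_real, Real.norm_of_nonneg (by positivity),
    ENNReal.ofReal_rpow_of_nonneg (by positivity) hQ.le, ← Real.rpow_mul (by positivity),
    one_div, inv_mul_cancel₀ hQ.ne', Real.rpow_one, ENNReal.ofReal_coe_nnreal]

/-- The Riesz representation of `(L^q)*` for a σ-finite measure `ν`; multiplication by a power of
a positive integrable weight reduces it to a finite measure. -/
theorem exists_memLp_of_dual {ν : Measure α} [SigmaFinite ν] {p q : ℝ≥0∞}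
    [Fact (1 ≤ p)] [Fact (1 ≤ q)] (hp1 : 1 < p) (hp : p ≠ ⊤) (hq : q ≠ ⊤)
    [hpq : ENNReal.HolderConjugate p q] (Λ : Lp ℂ q ν →L[ℂ] ℂ) :
    ∃ f : α → ℂ, MemLp f p ν ∧ eLpNorm f p ν ≤ ‖Λ‖ₑ ∧ ∀ u : Lp ℂ q ν, Λ u = ∫ x, f x * u x ∂ν := by
  obtain ⟨g, hg0, hg, hgi⟩ := exists_pos_lintegral_lt_of_sigmaFinite ν one_ne_zero
  set m := ν.withDensity fun x ↦ (g x : ℝ≥0∞) with hmdef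
  have : IsFiniteMeasure m := isFiniteMeasure_withDensity hgi.ne_top
  have hνm : ν ≪ m := withDensity_absolutelyContinuous' hg.coe_nnreal_ennreal.aemeasurable
    (Filter.Eventually.of_forall fun x ↦ by simpa using (hg0 x).ne')
  have hmν : m ≪ ν := withDensity_absolutelyContinuous _ _
  have hpqr : p.toReal.HolderConjugate q.toReal := ENNReal.HolderConjugate.toReal_of_ne_top hp hq
  have hp0 : p ≠ 0 := (zero_lt_one.trans hp1).ne'
  have hq0 : q ≠ 0 := (zero_lt_one.trans_le (Fact.out : 1 ≤ q)).ne'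
  have hw : ∀ a : ℝ, Measurable fun x ↦ (((g x : ℝ) ^ a : ℝ) : ℂ) := fun a ↦
    Complex.measurable_ofReal.comp (hg.coe_nnreal_real.pow_const _)
  have hmem : ∀ (q : ℝ≥0∞), q ≠ 0 → q ≠ ⊤ → ∀ u : α → ℂ, MemLp u q m →
      MemLp (fun x ↦ (((g x : ℝ) ^ (1 / q.toReal) : ℝ) : ℂ) * u x) q ν := fun q hq0 hq u hu ↦
    ⟨(hw _).aestronglyMeasurable.mul (hu.1.mono_ac hνm), by
      rw [eLpNorm_rpow_smul_withDensity hg hq0 hq]; exact hu.2⟩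
  let Φ : Lp ℂ q m →L[ℂ] Lp ℂ q ν := LinearMap.mkContinuous
    { toFun := fun u ↦ (hmem q hq0 hq u (Lp.memLp u)).toLp
      map_add' := fun u v ↦ by
        rw [← MemLp.toLp_add]
        apply MemLp.toLp_congr
        filter_upwards [hνm.ae_le (Lp.coeFn_add u v)] with x hx
        rw [hx, Pi.add_apply, Pi.add_apply, mul_add]
      map_smul' := fun c u ↦ by
        rw [RingHom.id_apply, ← MemLp.toLp_const_smul]
        apply MemLp.toLp_congr
        filter_upwards [hνm.ae_le (Lp.coeFn_smul c u)] with x hx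
        rw [hx, Pi.smul_apply, Pi.smul_apply, smul_eq_mul, smul_eq_mul]
        ring }
    1 fun u ↦ by
      rw [one_mul, LinearMap.coe_mk, AddHom.coe_mk, Lp.norm_toLp, Lp.norm_def,
        eLpNorm_rpow_smul_withDensity hg hq0 hq]
  have hΦ : ∀ u : Lp ℂ q m, Φ u =ᵐ[ν] fun x ↦ (((g x : ℝ) ^ (1 / q.toReal) : ℝ) : ℂ) * u x :=
    fun u ↦ MemLp.coeFn_toLp (hmem q hq0 hq u (Lp.memLp u))
  obtain ⟨h, hh, hhn, hhr⟩ := exists_memLp_of_dual_of_finite hp1 hp hq (Λ.comp Φ)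
  refine ⟨fun x ↦ (((g x : ℝ) ^ (1 / p.toReal) : ℝ) : ℂ) * h x, hmem p hp0 hp h hh, ?_, fun w ↦ ?_⟩
  · rw [eLpNorm_rpow_smul_withDensity hg hp0 hp]
    refine hhn.trans ?_
    rw [← ofReal_norm, ← ofReal_norm]
    refine ENNReal.ofReal_le_ofReal ((Λ.opNorm_comp_le Φ).trans ?_)
    exact mul_le_of_le_one_right (norm_nonneg _) (LinearMap.mkContinuous_norm_le _ zero_le_one _)
  · have hinv : ∀ x, (((g x : ℝ) ^ (1 / q.toReal) : ℝ) : ℂ) *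
        ((((g x : ℝ) ^ (-(1 / q.toReal)) : ℝ) : ℂ) * w x) = w x := fun x ↦ by
      rw [← mul_assoc, ← Complex.ofReal_mul, ← Real.rpow_add (by exact_mod_cast hg0 x),
        add_neg_cancel, Real.rpow_zero, Complex.ofReal_one, one_mul]
    have hu : MemLp (fun x ↦ (((g x : ℝ) ^ (-(1 / q.toReal)) : ℝ) : ℂ) * w x) q m := by
      refine ⟨(hw _).aestronglyMeasurable.mul ((Lp.aestronglyMeasurable w).mono_ac hmν), ?_⟩
      rw [← eLpNorm_rpow_smul_withDensity hg hq0 hq]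
      simp only [hinv]
      exact Lp.eLpNorm_lt_top w
    have e1 : Φ hu.toLp = w := by
      ext1
      filter_upwards [hΦ hu.toLp, hνm.ae_le hu.coeFn_toLp] with x h1 h2
      rw [h1, h2, hinv]
    rw [← e1, ← ContinuousLinearMap.comp_apply, hhr, e1]
    refine (integral_withDensity_eq_integral_smul hg _).trans ?_
    apply integral_congr_ae
    filter_upwards [hνm.ae_le hu.coeFn_toLp] with x h2
    rw [h2, NNReal.smul_def, Complex.real_smul]
    have : (g x : ℝ) * (g x : ℝ) ^ (-(1 / q.toReal)) = (g x : ℝ) ^ (1 / p.toReal) := by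
      rw [← Real.rpow_one_add' (by positivity)]
      · congr 1
        have := hpqr.inv_add_inv_eq_one
        rw [one_div, one_div]; linarith
      · have := hpqr.inv_add_inv_eq_one
        have h3 := hpqr.inv_pos
        rw [one_div]; linarith
    rw [← this]
    push_cast
    ring

end Riesz

/-- A linear functional on a space of Schwartz functions which is bounded for the `L^q` norm is
represented by a function in `L^p`, by the Hahn-Banach and Riesz theorems. -/
theorem exists_memLp_of_schwartz_functional {d : ℕ} {p q : ℝ≥0∞} (hp1 : 1 < p) (hp : p ≠ ⊤)
    (hq1 : 1 ≤ q) (hq : q ≠ ⊤) [hpq : ENNReal.HolderConjugate p q]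
    (W : Submodule ℂ 𝓢(Space d, ℂ)) (l : W →ₗ[ℂ] ℂ) {B : ℝ≥0∞} (hB : B ≠ ⊤)
    (hl : ∀ ψ : W, ‖l ψ‖ₑ ≤ B * eLpNorm (ψ : 𝓢(Space d, ℂ)) q volume) :
    ∃ g : Space d → ℂ, MemLp g p volume ∧ eLpNorm g p volume ≤ B ∧
      ∀ ψ : W, l ψ = ∫ x, g x * (ψ : 𝓢(Space d, ℂ)) x := by
  have : Fact (1 ≤ q) := ⟨hq1⟩
  have : Fact (1 ≤ p) := ⟨hp1.le⟩
  let ι : W →ₗ[ℂ] Lp ℂ q (volume : Measure (Space d)) :=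
    (SchwartzMap.toLpCLM ℂ ℂ q volume).toLinearMap ∘ₗ W.subtype
  have hι : ∀ ψ : W, ι ψ = (ψ : 𝓢(Space d, ℂ)).toLp q volume := fun ψ ↦ rfl
  have hinj : Function.Injective ι := fun a b hab ↦
    Subtype.ext (SchwartzMap.injective_toLp q volume hab)
  let e := LinearEquiv.ofInjective ι hinj
  have hbd : ∀ w : LinearMap.range ι, ‖(l ∘ₗ e.symm.toLinearMap) w‖ ≤ B.toReal * ‖w‖ := by
    intro w
    obtain ⟨ψ, rfl⟩ := e.surjective w
    have h1 : ‖e ψ‖ = (eLpNorm (ψ : 𝓢(Space d, ℂ)) q volume).toReal := by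
      have : ‖e ψ‖ = ‖ι ψ‖ := rfl
      rw [this, hι, SchwartzMap.norm_toLp]
    rw [LinearMap.comp_apply, LinearEquiv.coe_coe, e.symm_apply_apply, h1, ← ENNReal.toReal_mul]
    have h2 := ENNReal.toReal_mono
      (ENNReal.mul_ne_top hB ((ψ : 𝓢(Space d, ℂ)).memLp q volume).2.ne) (hl ψ)
    rwa [toReal_enorm] at h2
  obtain ⟨Λ, hΛ, hΛn⟩ := exists_extension_norm_eq (LinearMap.range ι)
    (LinearMap.mkContinuous (l ∘ₗ e.symm.toLinearMap) B.toReal hbd)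
  obtain ⟨g, hg, hgn, hgr⟩ := exists_memLp_of_dual hp1 hp hq Λ
  refine ⟨g, hg, hgn.trans ?_, fun ψ ↦ ?_⟩
  · rw [← ofReal_norm, hΛn]
    refine ENNReal.ofReal_le_of_le_toReal ?_
    exact LinearMap.mkContinuous_norm_le _ ENNReal.toReal_nonneg _
  · have h1 := hΛ (e ψ)
    have h2 : ((e ψ : LinearMap.range ι) : Lp ℂ q (volume : Measure (Space d))) =
      (ψ : 𝓢(Space d, ℂ)).toLp q volume := rfl
    rw [LinearMap.mkContinuous_apply, LinearMap.comp_apply, LinearEquiv.coe_coe,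
      e.symm_apply_apply, h2, hgr] at h1
    rw [← h1]
    apply integral_congr_ae
    filter_upwards [(ψ : 𝓢(Space d, ℂ)).coeFn_toLp q volume] with x hx
    rw [hx]

/-! ### Convolution with an integrable kernel -/

section Convolution

variable {d : ℕ} {p q : ℝ≥0∞}

/-- The convolution `∫ K y h (x - y) dy` of scalar functions on `ℝ^d`. -/
def conv (K h : Space d → ℂ) (x : Space d) : ℂ := ∫ y, K y * h (x - y)

theorem conv_eq_convolution (K h : Space d → ℂ) :
    conv K h = MeasureTheory.convolution K h (ContinuousLinearMap.mul ℂ ℂ) volume := rfl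

/-- A continuous integrable function with integrable Fourier transform; such functions are bounded
and Fourier inversion holds pointwise. -/
structure IsWienerFunction (h : Space d → ℂ) : Prop where
  continuous : Continuous h
  integrable : Integrable h
  integrable_fourier : Integrable (𝓕 h)

namespace IsWienerFunction

variable {h : Space d → ℂ}

theorem schwartz (ψ : 𝓢(Space d, ℂ)) : IsWienerFunction ψ :=
  ⟨ψ.continuous, ψ.integrable, by rw [← SchwartzMap.fourier_coe]; exact (𝓕 ψ).integrable⟩

theorem fourierInv_fourier (hh : IsWienerFunction h) : 𝓕⁻ (𝓕 h) = h :=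
  hh.continuous.fourierInv_fourier_eq hh.integrable hh.integrable_fourier

theorem bddAbove (hh : IsWienerFunction h) : BddAbove (Set.range fun x ↦ ‖h x‖) := by
  refine ⟨∫ ξ, ‖𝓕 h ξ‖, ?_⟩
  rintro _ ⟨x, rfl⟩
  simp only
  rw [← hh.fourierInv_fourier, Real.fourierInv_eq]
  refine (norm_integral_le_integral_norm _).trans (le_of_eq ?_)
  rw [hh.fourierInv_fourier]
  exact integral_congr_ae (Filter.Eventually.of_forall fun ξ ↦ by simp)

theorem conv {K : Space d → ℂ} (hK : Integrable K) (hh : IsWienerFunction h) :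
    IsWienerFunction (conv K h) ∧ 𝓕 (GevreyHeat.conv K h) = fun ξ ↦ 𝓕 K ξ * 𝓕 h ξ := by
  have hF : 𝓕 (GevreyHeat.conv K h) = fun ξ ↦ 𝓕 K ξ * 𝓕 h ξ := by
    ext ξ
    rw [conv_eq_convolution, Real.fourier_mul_convolution_eq hK hh.integrable]
  refine ⟨⟨?_, ?_, ?_⟩, hF⟩
  · exact hh.bddAbove.continuous_convolution_right_of_integrable (ContinuousLinearMap.mul ℂ ℂ) hK
      hh.continuous
  · exact hK.integrable_convolution (ContinuousLinearMap.mul ℂ ℂ) hh.integrable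
  · rw [hF]
    have hc : Continuous (𝓕 K) := VectorFourier.fourierIntegral_continuous
      Real.continuous_fourierChar (innerSL ℝ (E := Space d)).continuous₂ hK
    exact hh.integrable_fourier.bdd_mul (c := ∫ x, ‖K x‖) hc.aestronglyMeasurable
      (Filter.Eventually.of_forall fun ξ ↦
        VectorFourier.norm_fourierIntegral_le_integral_norm _ _ _ _ _)

end IsWienerFunction

theorem fourierInv_fourier_mul_fourier {K h : Space d → ℂ} (hK : Integrable K)
    (hh : IsWienerFunction h) : 𝓕⁻ (fun ξ ↦ 𝓕 K ξ * 𝓕 h ξ) = conv K h := by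
  rw [← (hh.conv hK).2, (hh.conv hK).1.fourierInv_fourier]

/-- Young's inequality `L¹ * L^q → L^q`. -/
theorem eLpNorm_conv_le {K h : Space d → ℂ} (hK : Measurable K) (hh : Measurable h)
    (hq1 : 1 ≤ q) (hq : q ≠ ⊤) :
    eLpNorm (conv K h) q volume ≤ (∫⁻ x, ‖K x‖ₑ) * eLpNorm h q volume := by
  have hq0 : q ≠ 0 := (zero_lt_one.trans_le hq1).ne'
  have hQ : 1 ≤ q.toReal := by
    rwa [← ENNReal.toReal_one, ENNReal.toReal_le_toReal ENNReal.one_ne_top hq]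
  have hQ0 : 0 < q.toReal := zero_lt_one.trans_le hQ
  have h1 : ∀ x, ‖conv K h x‖ₑ ≤ ∫⁻ y, ‖K (x - y)‖ₑ * ‖h y‖ₑ := fun x ↦ by
    have : conv K h x = ∫ y, K (x - y) * h y := by
      rw [conv, ← integral_sub_left_eq_self _ volume x]
      simp
    rw [this]
    refine (enorm_integral_le_lintegral_enorm _).trans (le_of_eq ?_)
    simp only [enorm_mul]
  rw [eLpNorm_eq_lintegral_rpow_enorm_toReal hq0 hq, eLpNorm_eq_lintegral_rpow_enorm_toReal hq0 hq]
  calc (∫⁻ x, ‖conv K h x‖ₑ ^ q.toReal) ^ (1 / q.toReal)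
      ≤ (∫⁻ x, (∫⁻ y, ‖K (x - y)‖ₑ * ‖h y‖ₑ) ^ q.toReal) ^ (1 / q.toReal) := by
        gcongr with x
        exact h1 x
    _ ≤ ((∫⁻ x, ‖K x‖ₑ) ^ q.toReal * ∫⁻ x, ‖h x‖ₑ ^ q.toReal) ^ (1 / q.toReal) := by
        gcongr
        exact lintegral_convolution_rpow_le hK.enorm hh.enorm hQ
    _ = _ := by
        rw [ENNReal.mul_rpow_of_nonneg _ _ (by positivity), ← ENNReal.rpow_mul,
          mul_one_div_cancel hQ0.ne', ENNReal.rpow_one]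

theorem enorm_integral_mul_le [ENNReal.HolderConjugate p q] {g h : Space d → ℂ}
    (hg : AEStronglyMeasurable g) (hh : AEStronglyMeasurable h) :
    ‖∫ x, g x * h x‖ₑ ≤ eLpNorm g p volume * eLpNorm h q volume := by
  refine (enorm_integral_le_lintegral_enorm _).trans ?_
  have := eLpNorm_smul_le_mul_eLpNorm (p := p) (q := q) (r := 1) hh hg
  rwa [eLpNorm_one_eq_lintegral_enorm] at this

theorem lintegral_enorm_mul_le [ENNReal.HolderConjugate p q] {g h : Space d → ℂ}
    (hg : AEStronglyMeasurable g) (hh : AEStronglyMeasurable h) :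
    ∫⁻ x, ‖g x * h x‖ₑ ≤ eLpNorm g p volume * eLpNorm h q volume := by
  have := eLpNorm_smul_le_mul_eLpNorm (p := p) (q := q) (r := 1) hh hg
  rwa [eLpNorm_one_eq_lintegral_enorm] at this

/-- Fubini's theorem for the pairing of `g ∈ L^p` with the convolution of `K ∈ L¹` and `h ∈ L^q`. -/
theorem integral_mul_conv [ENNReal.HolderConjugate p q] {g K h : Space d → ℂ} (hg : MemLp g p)
    (hK : Integrable K) (hh : Measurable h) (hhq : MemLp h q) :
    ∫ x, g x * conv K h x = ∫ y, K y * ∫ x, g x * h (x - y) := by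
  have hmeas : AEStronglyMeasurable (fun z : Space d × Space d ↦ K z.1 * (g z.2 * h (z.2 - z.1)))
      (volume.prod volume) :=
    hK.1.comp_fst.mul (hg.1.comp_snd.mul
      (hh.comp (measurable_snd.sub measurable_fst)).aestronglyMeasurable)
  have hint : Integrable (fun z : Space d × Space d ↦ K z.1 * (g z.2 * h (z.2 - z.1)))
      (volume.prod volume) := by
    refine ⟨hmeas, ?_⟩
    rw [hasFiniteIntegral_iff_enorm, lintegral_prod _ hmeas.enorm]
    calc ∫⁻ y, ∫⁻ x, ‖K y * (g x * h (x - y))‖ₑ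
        ≤ ∫⁻ y, ‖K y‖ₑ * (eLpNorm g p volume * eLpNorm h q volume) := by
          refine lintegral_mono fun y ↦ ?_
          have hm := (hh.comp (measurable_id.sub_const y)).aestronglyMeasurable (μ := volume)
          have e : eLpNorm (fun x ↦ h (x - y)) q volume = eLpNorm h q volume :=
            eLpNorm_comp_measurePreserving hh.aestronglyMeasurable (measurePreserving_sub_right _ y)
          simp only [enorm_mul]
          rw [lintegral_const_mul' _ _ enorm_ne_top, ← e]
          gcongr
          simp only [← enorm_mul]
          exact lintegral_enorm_mul_le hg.1 hm
      _ < ⊤ := by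
          rw [lintegral_mul_const' _ _ (ENNReal.mul_ne_top hg.2.ne hhq.2.ne)]
          exact ENNReal.mul_lt_top hK.2 (ENNReal.mul_lt_top hg.2 hhq.2)
  calc ∫ x, g x * conv K h x = ∫ x, ∫ y, K y * (g x * h (x - y)) := by
        congr with x
        rw [conv, ← integral_const_mul]
        congr with y
        ring
    _ = ∫ y, ∫ x, K y * (g x * h (x - y)) := (integral_integral_swap hint).symm
    _ = _ := by
        congr with y
        rw [integral_const_mul]

theorem IsL1Multiplier.isWienerFunction {m : Space d → ℂ} {A : ℝ} (hm : IsL1Multiplier m A)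
    (ψ : 𝓢(Space d, ℂ)) : IsWienerFunction (𝓕⁻ fun ξ ↦ m ξ * 𝓕 ψ ξ) ∧
      𝓕 (𝓕⁻ fun ξ ↦ m ξ * 𝓕 ψ ξ) = fun ξ ↦ m ξ * 𝓕 ψ ξ := by
  obtain ⟨K, -, hi, -, rfl⟩ := hm
  rw [SchwartzMap.fourier_coe, fourierInv_fourier_mul_fourier hi (.schwartz ψ)]
  exact (IsWienerFunction.schwartz ψ).conv hi

theorem IsL1Multiplier.eLpNorm_le {m : Space d → ℂ} {A : ℝ} (hm : IsL1Multiplier m A)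
    (hq1 : 1 ≤ q) (hq : q ≠ ⊤) (ψ : 𝓢(Space d, ℂ)) :
    eLpNorm (𝓕⁻ fun ξ ↦ m ξ * 𝓕 ψ ξ) q volume ≤ ENNReal.ofReal A * eLpNorm ψ q volume := by
  obtain ⟨K, hK, hi, hA, rfl⟩ := hm
  rw [SchwartzMap.fourier_coe, fourierInv_fourier_mul_fourier hi (.schwartz ψ)]
  refine (eLpNorm_conv_le hK ψ.continuous.measurable hq1 hq).trans ?_
  rw [← ofReal_integral_norm_eq_lintegral_enorm hi]
  gcongr

end Convolution

/-! ### Band-limited test functions -/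

section BandLimited

variable {d : ℕ} {p q : ℝ≥0∞}

/-- The Schwartz functions whose Fourier transform has compact support. -/
def bandLimited (d : ℕ) : Submodule ℂ 𝓢(Space d, ℂ) where
  carrier := {ψ | HasCompactSupport fun ξ ↦ 𝓕 ψ ξ}
  zero_mem' := by
    have : (fun ξ ↦ (𝓕 (0 : 𝓢(Space d, ℂ))) ξ) = 0 := by
      ext ξ
      rw [FourierTransform.fourier_zero]
      rfl
    rw [Set.mem_ofPred_eq, this]
    exact HasCompactSupport.zero
  add_mem' {ψ θ} hψ hθ := by
    have : (fun ξ ↦ (𝓕 (ψ + θ)) ξ) = fun ξ ↦ 𝓕 ψ ξ + 𝓕 θ ξ := by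
      ext ξ
      rw [FourierTransform.fourier_add]
      rfl
    rw [Set.mem_ofPred_eq, this]
    exact HasCompactSupport.add hψ hθ
  smul_mem' c ψ hψ := by
    have : (fun ξ ↦ (𝓕 (c • ψ)) ξ) = fun ξ ↦ c * 𝓕 ψ ξ := by
      ext ξ
      rw [FourierTransform.fourier_smul]
      rfl
    rw [Set.mem_ofPred_eq, this]
    exact HasCompactSupport.mul_left hψ

theorem mem_bandLimited {ψ : 𝓢(Space d, ℂ)} :
    ψ ∈ bandLimited d ↔ HasCompactSupport fun ξ ↦ 𝓕 ψ ξ := Iff.rfl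

theorem exists_bandLimited_fourier_eq {h : Space d → ℂ} (hc : HasCompactSupport h)
    (hs : ContDiff ℝ ∞ h) : ∃ ψ ∈ bandLimited d, ∀ ξ, 𝓕 ψ ξ = h ξ := by
  have e : ∀ ξ, 𝓕 (𝓕⁻ (hc.toSchwartzMap hs)) ξ = h ξ := fun ξ ↦ by
    rw [FourierTransform.fourier_fourierInv_eq]
    rfl
  refine ⟨𝓕⁻ (hc.toSchwartzMap hs), ?_, e⟩
  rw [mem_bandLimited]
  simpa only [e] using hc

theorem fourier_compSubConst (ψ : 𝓢(Space d, ℂ)) (y ξ : Space d) :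
    𝓕 (ψ.compSubConstCLM ℂ y) ξ = Real.fourierChar (-inner ℝ y ξ) • 𝓕 ψ ξ := by
  simp only [SchwartzMap.fourier_coe, Real.fourier_eq, SchwartzMap.compSubConstCLM_apply]
  rw [← integral_add_right_eq_self _ y]
  simp only [add_sub_cancel_right, Circle.smul_def]
  rw [← integral_smul]
  congr with x
  rw [smul_smul, ← Circle.coe_mul, ← AddChar.map_add_eq_mul, inner_add_left, neg_add, add_comm]

theorem compSubConst_mem_bandLimited {ψ : 𝓢(Space d, ℂ)} (hψ : ψ ∈ bandLimited d) (y : Space d) :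
    ψ.compSubConstCLM ℂ y ∈ bandLimited d := by
  rw [mem_bandLimited] at hψ ⊢
  refine hψ.mono fun ξ hξ h ↦ hξ ?_
  simp only at h
  simp only [fourier_compSubConst, h, smul_zero]

theorem gevreyTest_compSubConst (a : ℝ) (ψ : 𝓢(Space d, ℂ)) (y x : Space d) :
    gevreyTest a (ψ.compSubConstCLM ℂ y) x = gevreyTest a ψ (x - y) := by
  simp only [gevreyTest, Real.fourierInv_eq, fourier_compSubConst]
  congr with ξ
  rw [mul_smul_comm, smul_smul, ← AddChar.map_add_eq_mul, inner_sub_right, real_inner_comm ξ y,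
    sub_eq_add_neg]

theorem contDiff_norm_two_pi_smul_sq :
    ContDiff ℝ ∞ fun ξ : Space d ↦ ‖(2 * Real.pi) • ξ‖ ^ 2 :=
  (contDiff_norm_sq ℝ).comp (contDiff_const_smul _)

/-- `e^{aΛ₁} ψ` is the image of the band-limited function `e^{-Δ} ψ` under the multiplier
`e^{a|ξ|₁ - |ξ|²}`, which has an integrable kernel. -/
theorem exists_gevreyTest_eq {a : ℝ} (ha : 0 ≤ a) {ψ : 𝓢(Space d, ℂ)} (hψ : ψ ∈ bandLimited d) :
    ∃ ψ' ∈ bandLimited d, ∃ (m : Space d → ℂ) (A : ℝ), IsL1Multiplier m A ∧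
      ∀ ξ, m ξ * 𝓕 ψ' ξ = ((Real.exp (a * l1Norm ((2 * Real.pi) • ξ)) : ℝ) : ℂ) * 𝓕 ψ ξ := by
  have hsm : ContDiff ℝ ∞ fun ξ : Space d ↦
      ((Real.exp (1 * ‖(2 * Real.pi) • ξ‖ ^ 2) : ℝ) : ℂ) * 𝓕 ψ ξ :=
    (Complex.ofRealCLM.contDiff.comp (Real.contDiff_exp.comp
      (contDiff_const.mul contDiff_norm_two_pi_smul_sq))).mul ((𝓕 ψ).smooth _)
  obtain ⟨ψ', hψ', e⟩ := exists_bandLimited_fourier_eq (h := fun ξ : Space d ↦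
      ((Real.exp (1 * ‖(2 * Real.pi) • ξ‖ ^ 2) : ℝ) : ℂ) * 𝓕 ψ ξ) (HasCompactSupport.mul_left hψ) hsm
  refine ⟨ψ', hψ', _, _, isL1Multiplier_exp_l1Norm_sub_sq d ha one_pos, fun ξ ↦ ?_⟩
  rw [e, ← mul_assoc, ← Complex.ofReal_mul, ← Real.exp_add]
  congr 3
  ring

theorem isWienerFunction_gevreyTest {a : ℝ} (ha : 0 ≤ a) {ψ : 𝓢(Space d, ℂ)}
    (hψ : ψ ∈ bandLimited d) : IsWienerFunction (gevreyTest a ψ) ∧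
      𝓕 (gevreyTest a ψ) =
        fun ξ ↦ ((Real.exp (a * l1Norm ((2 * Real.pi) • ξ)) : ℝ) : ℂ) * 𝓕 ψ ξ := by
  obtain ⟨ψ', -, m, A, hm, e⟩ := exists_gevreyTest_eq ha hψ
  have := hm.isWienerFunction ψ'
  simp only [e] at this
  exact this

theorem memLp_gevreyTest (hq1 : 1 ≤ q) (hq : q ≠ ⊤) {a : ℝ} (ha : 0 ≤ a) {ψ : 𝓢(Space d, ℂ)}
    (hψ : ψ ∈ bandLimited d) : MemLp (gevreyTest a ψ) q volume := by
  refine ⟨(isWienerFunction_gevreyTest ha hψ).1.continuous.aestronglyMeasurable, ?_⟩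
  obtain ⟨ψ', -, m, A, hm, e⟩ := exists_gevreyTest_eq ha hψ
  have := hm.eLpNorm_le hq1 hq ψ'
  simp only [e] at this
  exact this.trans_lt (ENNReal.mul_lt_top ENNReal.ofReal_lt_top (ψ'.memLp q volume).2)

/-- The duality defining `e^{aΛ₁}` extends to convolutions of band-limited functions with
integrable kernels, because `e^{aΛ₁}` commutes with translations. -/
theorem integral_mul_conv_gevreyTest [ENNReal.HolderConjugate p q] (hq1 : 1 ≤ q) (hq : q ≠ ⊤)
    {a : ℝ} (ha : 0 ≤ a) {f g K : Space d → ℂ} (hf : MemLp f p) (hg : MemLp g p)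
    (hfg : ∀ ψ : 𝓢(Space d, ℂ), HasCompactSupport (fun ξ ↦ (𝓕 ψ) ξ) →
      ∫ x, g x * ψ x = ∫ x, f x * gevreyTest a ψ x)
    (hK : Integrable K) {ψ : 𝓢(Space d, ℂ)} (hψ : ψ ∈ bandLimited d) :
    ∫ x, g x * conv K ψ x = ∫ x, f x * conv K (gevreyTest a ψ) x := by
  rw [integral_mul_conv (q := q) hg hK ψ.continuous.measurable (ψ.memLp q volume),
    integral_mul_conv (q := q) hf hK (isWienerFunction_gevreyTest ha hψ).1.continuous.measurable
      (memLp_gevreyTest hq1 hq ha hψ)]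
  congr with y
  have := hfg _ (compSubConst_mem_bandLimited hψ y)
  simp only [SchwartzMap.compSubConstCLM_apply, gevreyTest_compSubConst] at this
  rw [this]

/-- The distribution `u` is controlled by the `L^p` norm of `e^{aΛ₁} u` tested against
`e^{-aΛ₁} ψ`. -/
theorem enorm_apply_le_gevreyLpNorm_mul [ENNReal.HolderConjugate p q] (hq1 : 1 ≤ q) (hq : q ≠ ⊤)
    {a : ℝ} (ha : 0 < a) (u : 𝓢'(Space d, ℂ)) {ψ : 𝓢(Space d, ℂ)} (hψ : ψ ∈ bandLimited d)
    {X : ℝ≥0∞} (hX0 : X ≠ 0) (hX : X ≠ ⊤)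
    (h : eLpNorm (𝓕⁻ fun ξ ↦ ((Real.exp (-a * l1Norm ((2 * Real.pi) • ξ)) : ℝ) : ℂ) * 𝓕 ψ ξ)
      q volume ≤ X) :
    ‖u ψ‖ₑ ≤ gevreyLpNorm p a u * X := by
  rw [gevreyLpNorm, ENNReal.iInf_mul_of_ne hX0 hX]
  refine le_iInf fun g ↦ ?_
  rw [ENNReal.iInf_mul_of_ne hX0 hX]
  refine le_iInf fun hg ↦ ?_
  obtain ⟨hg, f, ⟨hf, hfu⟩, hfg⟩ := hg
  obtain ⟨K, hKm, hK, -, eK⟩ := isL1Multiplier_exp_neg_l1Norm d ha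
  have e1 : conv K (gevreyTest a ψ) = ψ := by
    obtain ⟨h1, h2⟩ := isWienerFunction_gevreyTest ha.le hψ
    rw [← fourierInv_fourier_mul_fourier hK h1, eK, h2]
    have : (fun ξ : Space d ↦ ((Real.exp (-a * l1Norm ((2 * Real.pi) • ξ)) : ℝ) : ℂ) *
        (((Real.exp (a * l1Norm ((2 * Real.pi) • ξ)) : ℝ) : ℂ) * 𝓕 ψ ξ)) = 𝓕 (ψ : Space d → ℂ) := by
      ext ξ
      rw [← mul_assoc, ← Complex.ofReal_mul, ← Real.exp_add, neg_mul, neg_add_cancel, Real.exp_zero,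
        Complex.ofReal_one, one_mul, SchwartzMap.fourier_coe]
    rw [this, (IsWienerFunction.schwartz ψ).fourierInv_fourier]
  have e2 : conv K ψ =
      𝓕⁻ fun ξ ↦ ((Real.exp (-a * l1Norm ((2 * Real.pi) • ξ)) : ℝ) : ℂ) * 𝓕 ψ ξ := by
    rw [← fourierInv_fourier_mul_fourier hK (.schwartz ψ), eK, SchwartzMap.fourier_coe]
  rw [hfu ψ, ← e1, ← integral_mul_conv_gevreyTest (q := q) hq1 hq ha.le hf hg hfg hK hψ]
  refine (enorm_integral_mul_le (p := p) (q := q) hg.1 ?_).trans ?_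
  · exact ((IsWienerFunction.schwartz ψ).conv hK).1.continuous.aestronglyMeasurable
  · rw [e2]
    gcongr

theorem enorm_apply_le_distLpNorm_mul [ENNReal.HolderConjugate p q]
    (u : 𝓢'(Space d, ℂ)) (ψ : 𝓢(Space d, ℂ))
    {X : ℝ≥0∞} (hX0 : X ≠ 0) (hX : X ≠ ⊤) (h : eLpNorm ψ q volume ≤ X) :
    ‖u ψ‖ₑ ≤ distLpNorm p u * X := by
  rw [distLpNorm, ENNReal.iInf_mul_of_ne hX0 hX]
  refine le_iInf fun f ↦ ?_
  rw [ENNReal.iInf_mul_of_ne hX0 hX]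
  refine le_iInf fun hf ↦ ?_
  rw [hf.2 ψ]
  refine (enorm_integral_mul_le (p := p) (q := q) hf.1.1 ψ.continuous.aestronglyMeasurable).trans ?_
  gcongr

end BandLimited

/-! ### Bounded sequences of Schwartz functions -/

section Synthesis

variable {E : Type*} [NormedAddCommGroup E] [NormedSpace ℝ E]

/-- The space `ℓ¹(ℕ)` of complex sequences. -/
abbrev EllOne : Type := lp (fun _ : ℕ ↦ ℂ) 1

theorem EllOne.summable_norm (x : EllOne) : Summable fun n ↦ ‖x n‖ := by
  have := lp.hasSum_norm (p := 1) (by simp) x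
  simp only [ENNReal.toReal_one, Real.rpow_one] at this
  exact this.summable

theorem EllOne.tsum_norm (x : EllOne) : ∑' n, ‖x n‖ = ‖x‖ := by
  have := lp.hasSum_norm (p := 1) (by simp) x
  simp only [ENNReal.toReal_one, Real.rpow_one] at this
  exact this.tsum_eq

theorem norm_iteratedFDeriv_const_mul (c : ℂ) (f : 𝓢(E, ℂ)) (m : ℕ) (ξ : E) :
    ‖iteratedFDeriv ℝ m (fun ξ ↦ c * f ξ) ξ‖ = ‖c‖ * ‖iteratedFDeriv ℝ m f ξ‖ := by
  have : (fun ξ ↦ c * f ξ) = c • (f : E → ℂ) := rfl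
  rw [this, iteratedFDeriv_const_smul_apply (f.smooth m).contDiffAt, norm_smul]

theorem norm_iteratedFDeriv_tsum_le {β : ℕ → 𝓢(E, ℂ)} {k m : ℕ} {A : ℕ → ℝ}
    (hA : ∀ m n, SchwartzMap.seminorm ℂ 0 m (β n) ≤ A m) {B : ℝ}
    (hB : ∀ n, SchwartzMap.seminorm ℂ k m (β n) ≤ B) (x : EllOne) :
    ContDiff ℝ ∞ (fun ξ ↦ ∑' n, x n * β n ξ) ∧
      ∀ ξ, ‖ξ‖ ^ k * ‖iteratedFDeriv ℝ m (fun ξ ↦ ∑' n, x n * β n ξ) ξ‖ ≤ B * ‖x‖ := by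
  have hs : ∀ n, ContDiff ℝ ((⊤ : ℕ∞) : ℕ∞ω) fun ξ ↦ x n * β n ξ := fun n ↦
    contDiff_const.mul ((β n).smooth _)
  have hv : ∀ j : ℕ, (j : ℕ∞) ≤ (⊤ : ℕ∞) → Summable fun n ↦ ‖x n‖ * A j := fun j _ ↦
    (EllOne.summable_norm x).mul_right _
  have hb : ∀ (j n : ℕ) (ξ : E), (j : ℕ∞) ≤ (⊤ : ℕ∞) →
      ‖iteratedFDeriv ℝ j (fun ξ ↦ x n * β n ξ) ξ‖ ≤ ‖x n‖ * A j := fun j n ξ _ ↦ by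
    rw [norm_iteratedFDeriv_const_mul]
    gcongr
    exact ((β n).norm_iteratedFDeriv_le_seminorm ℂ j ξ).trans (hA j n)
  refine ⟨contDiff_tsum hs hv hb, fun ξ ↦ ?_⟩
  rw [iteratedFDeriv_tsum hs hv hb le_top]
  have hsum : Summable fun n ↦ ‖iteratedFDeriv ℝ m (fun ξ ↦ x n * β n ξ) ξ‖ :=
    Summable.of_nonneg_of_le (fun n ↦ norm_nonneg _) (fun n ↦ hb m n ξ le_top) (hv m le_top)
  calc _ ≤ ‖ξ‖ ^ k * ∑' n, ‖iteratedFDeriv ℝ m (fun ξ ↦ x n * β n ξ) ξ‖ := by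
        gcongr
        exact norm_tsum_le_tsum_norm hsum
    _ = ∑' n, ‖ξ‖ ^ k * ‖iteratedFDeriv ℝ m (fun ξ ↦ x n * β n ξ) ξ‖ := by rw [tsum_mul_left]
    _ ≤ ∑' n, B * ‖x n‖ := by
        refine (hsum.mul_left _).tsum_le_tsum (fun n ↦ ?_) ((EllOne.summable_norm x).mul_left _)
        rw [norm_iteratedFDeriv_const_mul, mul_left_comm, mul_comm B]
        gcongr
        exact ((β n).le_seminorm ℂ k m ξ).trans (hB n)
    _ = B * ‖x‖ := by rw [tsum_mul_left, EllOne.tsum_norm]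

/-- A sequence which is bounded in the Schwartz space synthesises `ℓ¹` continuously:
`x ↦ ∑ xₙ βₙ`. -/
theorem exists_clm_ellOne_schwartz {β : ℕ → 𝓢(E, ℂ)}
    (hβ : ∀ k m, ∃ A : ℝ, ∀ n, SchwartzMap.seminorm ℂ k m (β n) ≤ A) :
    ∃ L : EllOne →L[ℂ] 𝓢(E, ℂ), ∀ x ξ, L x ξ = ∑' n, x n * β n ξ := by
  choose A hA using hβ
  have key := fun k m ↦ norm_iteratedFDeriv_tsum_le (k := k) (m := m) (hA 0) (hA k m)
  let S : EllOne → 𝓢(E, ℂ) := fun x ↦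
    { toFun := fun ξ ↦ ∑' n, x n * β n ξ
      smooth' := (key 0 0 x).1
      decay' := fun k m ↦ ⟨_, (key k m x).2⟩ }
  have hS : ∀ x ξ, S x ξ = ∑' n, x n * β n ξ := fun x ξ ↦ rfl
  have hsum : ∀ (x : EllOne) ξ, Summable fun n ↦ x n * β n ξ := fun x ξ ↦ by
    refine Summable.of_norm_bounded (g := fun n ↦ ‖x n‖ * A 0 0)
      ((EllOne.summable_norm x).mul_right _) fun n ↦ ?_
    rw [norm_mul]
    gcongr
    exact ((β n).norm_le_seminorm ℂ ξ).trans (hA 0 0 n)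
  let Sl : EllOne →ₗ[ℂ] 𝓢(E, ℂ) :=
    { toFun := S
      map_add' := fun x y ↦ by
        ext ξ
        rw [add_apply, hS, hS, hS, ← (hsum x ξ).tsum_add (hsum y ξ)]
        simp only [lp.coeFn_add, Pi.add_apply, add_mul]
      map_smul' := fun c x ↦ by
        ext ξ
        rw [RingHom.id_apply, smul_apply, hS, hS, smul_eq_mul, ← tsum_mul_left]
        simp only [lp.coeFn_smul, Pi.smul_apply, smul_eq_mul, mul_assoc] }
  have hcont : Continuous Sl := by
    refine WithSeminorms.continuous_normedSpace_dom EllOne (schwartz_withSeminorms ℂ E ℂ) Sl ?_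
    rintro ⟨k, m⟩
    refine ⟨Real.toNNReal (A k m), fun x ↦ ?_⟩
    have hA0 : 0 ≤ A k m := (apply_nonneg _ _).trans (hA k m 0)
    rw [Seminorm.comp_apply]
    refine (SchwartzMap.seminorm_le_bound ℂ k m (Sl x)
      (mul_nonneg hA0 (norm_nonneg x)) (key k m x).2).trans (le_of_eq ?_)
    rw [smul_apply, coe_normSeminorm, NNReal.smul_def, Real.coe_toNNReal _ hA0, smul_eq_mul]
  exact ⟨⟨Sl, hcont⟩, hS⟩

/-- Multiplication by a Schwartz function acts on the derivatives up to order `m` as a bounded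
operator for the supremum norm. -/
theorem exists_norm_iteratedFDeriv_pow_mul_le (B f : 𝓢(E, ℂ)) (m : ℕ) :
    ∃ C S : ℝ, 0 ≤ C ∧ 0 ≤ S ∧ ∀ n, ∀ i ≤ m, ∀ ξ,
      ‖iteratedFDeriv ℝ i (fun ξ ↦ B ξ ^ n * f ξ) ξ‖ ≤ C ^ n * S := by
  set b : ℝ := ∑ j ∈ Finset.range (m + 1), SchwartzMap.seminorm ℂ 0 j B with hb
  set S : ℝ := ∑ j ∈ Finset.range (m + 1), SchwartzMap.seminorm ℂ 0 j f with hS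
  have hle : ∀ (g : 𝓢(E, ℂ)), ∀ i ≤ m, ∀ ξ, ‖iteratedFDeriv ℝ i g ξ‖ ≤
      ∑ j ∈ Finset.range (m + 1), SchwartzMap.seminorm ℂ 0 j g := fun g i hi ξ ↦
    (g.norm_iteratedFDeriv_le_seminorm ℂ i ξ).trans
      (Finset.single_le_sum (f := fun j ↦ SchwartzMap.seminorm ℂ 0 j g)
        (fun j _ ↦ apply_nonneg _ _) (Finset.mem_range.2 (Nat.lt_succ_of_le hi)))
  have hb0 : 0 ≤ b := Finset.sum_nonneg fun j _ ↦ apply_nonneg _ _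
  have hS0 : 0 ≤ S := Finset.sum_nonneg fun j _ ↦ apply_nonneg _ _
  refine ⟨2 ^ m * b, S, by positivity, hS0, fun n ↦ ?_⟩
  induction n with
  | zero => simpa using hle f
  | succ n ih =>
    intro i hi ξ
    have hsm : ContDiff ℝ ∞ fun ξ ↦ B ξ ^ n * f ξ := ((B.smooth _).pow n).mul (f.smooth _)
    have e : (fun ξ ↦ B ξ ^ (n + 1) * f ξ) = fun ξ ↦ B ξ * (B ξ ^ n * f ξ) := by
      ext ξ; ring
    rw [e]
    refine (norm_iteratedFDeriv_mul_le (B.smooth ⊤) hsm ξ (by exact_mod_cast le_top)).trans ?_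
    calc ∑ j ∈ Finset.range (i + 1), (i.choose j : ℝ) * ‖iteratedFDeriv ℝ j B ξ‖ *
          ‖iteratedFDeriv ℝ (i - j) (fun ξ ↦ B ξ ^ n * f ξ) ξ‖
        ≤ ∑ j ∈ Finset.range (i + 1), (i.choose j : ℝ) * b * ((2 ^ m * b) ^ n * S) := by
          refine Finset.sum_le_sum fun j hj ↦ ?_
          have hj' : j ≤ i := Nat.lt_succ_iff.1 (Finset.mem_range.1 hj)
          gcongr
          · exact hle B j (hj'.trans hi) ξ
          · exact ih (i - j) ((Nat.sub_le _ _).trans hi) ξ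
      _ = 2 ^ i * b * ((2 ^ m * b) ^ n * S) := by
          rw [← Finset.sum_mul, ← Finset.sum_mul]
          congr 2
          exact_mod_cast Nat.sum_range_choose i
      _ ≤ 2 ^ m * b * ((2 ^ m * b) ^ n * S) := by
          gcongr
          norm_num
      _ = _ := by ring

end Synthesis

/-! ### The power series of the heat semigroup on band-limited functions -/

section Exponential

variable {d : ℕ}

/-- For a band-limited `ψ`, the functions `βₙ = Rⁿ/n! Δⁿ ψ` are bounded in the Schwartz space, so
that they synthesise `ℓ¹`. -/
theorem exists_clm_ellOne_laplacian_pow {ψ : 𝓢(Space d, ℂ)} (hψ : ψ ∈ bandLimited d) (R : ℝ) :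
    ∃ L : EllOne →L[ℂ] 𝓢(Space d, ℂ), ∀ x ξ, 𝓕 (L x) ξ =
      ∑' n, x n * ((R ^ n / n.factorial : ℝ) * ((-‖(2 * Real.pi) • ξ‖ ^ 2 : ℝ) : ℂ) ^ n * 𝓕 ψ ξ) := by
  obtain ⟨ρ, hρ0, hρ⟩ : ∃ ρ : ℝ, 0 < ρ ∧ tsupport (fun ξ ↦ 𝓕 ψ ξ) ⊆ Metric.closedBall 0 ρ := by
    obtain ⟨ρ, hρ⟩ := hψ.isBounded.subset_closedBall (0 : Space d)
    exact ⟨max ρ 1, by positivity, hρ.trans (Metric.closedBall_subset_closedBall (le_max_left _ _))⟩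
  -- a smooth compactly supported function equal to `-|2πξ|²` on the support of `𝓕 ψ`
  let cut : ContDiffBump (0 : Space d) := ⟨ρ, ρ + 1, hρ0, by linarith⟩
  have hBs : ContDiff ℝ ∞ fun ξ : Space d ↦
      (((-‖(2 * Real.pi) • ξ‖ ^ 2 : ℝ) : ℂ)) * ((cut ξ : ℝ) : ℂ) :=
    (Complex.ofRealCLM.contDiff.comp contDiff_norm_two_pi_smul_sq.neg).mul
      (Complex.ofRealCLM.contDiff.comp cut.contDiff)
  have hBc : HasCompactSupport fun ξ : Space d ↦
      (((-‖(2 * Real.pi) • ξ‖ ^ 2 : ℝ) : ℂ)) * ((cut ξ : ℝ) : ℂ) :=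
    HasCompactSupport.mul_left (cut.hasCompactSupport.comp_left (g := ((↑) : ℝ → ℂ)) (by simp))
  set B : 𝓢(Space d, ℂ) := hBc.toSchwartzMap hBs with hB
  have hBψ : ∀ (n : ℕ) ξ, B ξ ^ n * 𝓕 ψ ξ = ((-‖(2 * Real.pi) • ξ‖ ^ 2 : ℝ) : ℂ) ^ n * 𝓕 ψ ξ := by
    intro n ξ
    by_cases h : 𝓕 ψ ξ = 0
    · rw [h, mul_zero, mul_zero]
    · have h1 : ξ ∈ Metric.closedBall (0 : Space d) ρ := hρ (subset_tsupport _ h)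
      have h2 : B ξ = (((-‖(2 * Real.pi) • ξ‖ ^ 2 : ℝ) : ℂ)) * ((cut ξ : ℝ) : ℂ) := rfl
      rw [h2, cut.one_of_mem_closedBall h1, Complex.ofReal_one, mul_one]
  have hcs : ∀ n : ℕ, HasCompactSupport fun ξ ↦
      ((R ^ n / n.factorial : ℝ) : ℂ) * (B ξ ^ n * 𝓕 ψ ξ) := fun n ↦
    HasCompactSupport.mul_left (HasCompactSupport.mul_left hψ)
  have hsm : ∀ n : ℕ, ContDiff ℝ ∞ fun ξ ↦
      ((R ^ n / n.factorial : ℝ) : ℂ) * (B ξ ^ n * 𝓕 ψ ξ) := fun n ↦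
    contDiff_const.mul (((B.smooth _).pow n).mul ((𝓕 ψ).smooth _))
  let γ : ℕ → 𝓢(Space d, ℂ) := fun n ↦ (hcs n).toSchwartzMap (hsm n)
  have hγ : ∀ n ξ, γ n ξ = ((R ^ n / n.factorial : ℝ) : ℂ) * (B ξ ^ n * 𝓕 ψ ξ) := fun n ξ ↦ rfl
  obtain ⟨L, hL⟩ := exists_clm_ellOne_schwartz (β := γ) (by
    intro k m
    obtain ⟨C, S, hC, hS, h⟩ := exists_norm_iteratedFDeriv_pow_mul_le B (𝓕 ψ) m
    obtain ⟨M, hM⟩ := (FloorSemiring.tendsto_pow_div_factorial_atTop (|R| * C)).bddAbove_range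
    have hM0 : 0 ≤ M := le_trans (by positivity) (hM ⟨0, rfl⟩)
    refine ⟨ρ ^ k * (M * S), fun n ↦ SchwartzMap.seminorm_le_bound ℂ k m _ (by positivity)
      fun ξ ↦ ?_⟩
    have hBf : ContDiff ℝ ∞ fun ξ ↦ B ξ ^ n * 𝓕 ψ ξ :=
      ((B.smooth _).pow n).mul ((𝓕 ψ).smooth _)
    by_cases hξ : ξ ∈ Metric.closedBall (0 : Space d) ρ
    · have h1 : ‖iteratedFDeriv ℝ m (γ n) ξ‖ ≤ M * S := by
        have e : (γ n : Space d → ℂ) =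
            ((R ^ n / n.factorial : ℝ) : ℂ) • fun ξ ↦ B ξ ^ n * 𝓕 ψ ξ := rfl
        rw [e, iteratedFDeriv_const_smul_apply (hBf.of_le (by exact_mod_cast le_top)).contDiffAt,
          norm_smul]
        calc _ ≤ ‖((R ^ n / n.factorial : ℝ) : ℂ)‖ * (C ^ n * S) := by
              gcongr
              exact h n m le_rfl ξ
          _ = (|R| * C) ^ n / n.factorial * S := by
              rw [Complex.norm_real, norm_div, norm_pow, Real.norm_eq_abs, Real.norm_natCast,
                mul_pow]
              ring
          _ ≤ M * S := by
              gcongr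
              exact hM ⟨n, rfl⟩
      gcongr
      simpa using hξ
    · have h0 : iteratedFDeriv ℝ m (γ n) ξ = 0 := by
        by_contra hne
        refine hξ (hρ ?_)
        have h1 := support_iteratedFDeriv_subset (𝕜 := ℝ) m hne
        refine closure_mono (Function.support_subset_iff'.2 fun η hη ↦ ?_) h1
        rw [hγ, Function.notMem_support.1 hη, mul_zero, mul_zero]
      rw [h0, norm_zero, mul_zero]
      positivity)
  refine ⟨(FourierTransform.fourierInvCLM ℂ 𝓢(Space d, ℂ)).comp L, fun x ξ ↦ ?_⟩
  have : 𝓕 (((FourierTransform.fourierInvCLM ℂ 𝓢(Space d, ℂ)).comp L) x) = L x :=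
    FourierTransform.fourier_fourierInv_eq (L x)
  rw [this, hL]
  simp only [hγ, hBψ, mul_assoc]

end Exponential

/-! ### The Duhamel formula -/

section Duhamel

/-- A weakly integrable family of functionals on a Banach space is bounded into `L¹`, by the closed
graph theorem. -/
theorem exists_integral_norm_le_of_weakly_integrable {α X : Type*} [MeasurableSpace α]
    {m : Measure α} [NormedAddCommGroup X] [NormedSpace ℂ X] [CompleteSpace X]
    (u : α → X →L[ℂ] ℂ) (hu : ∀ x, Integrable (fun s ↦ u s x) m) :
    ∃ A : ℝ, 0 ≤ A ∧ ∀ x, ∫ s, ‖u s x‖ ∂m ≤ A * ‖x‖ := by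
  let T : X →ₗ[ℂ] Lp ℂ 1 m :=
    { toFun := fun x ↦ (hu x).toL1
      map_add' := fun x y ↦ by
        rw [← Integrable.toL1_add]
        congr 1
        ext s
        simp
      map_smul' := fun c x ↦ by
        rw [RingHom.id_apply, ← Integrable.toL1_smul]
        congr 1
        ext s
        simp }
  have hT : ∀ x, T x =ᵐ[m] fun s ↦ u s x := fun x ↦ (hu x).coeFn_toL1
  have hc : Continuous T := by
    refine T.continuous_of_seq_closed_graph fun y x z hy hTy ↦ ?_
    obtain ⟨ns, hns, hlim⟩ := (tendstoInMeasure_of_tendsto_Lp hTy).exists_seq_tendsto_ae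
    ext1
    filter_upwards [hlim, hT x, ae_all_iff.2 fun n ↦ hT (y n)] with s h1 h2 h3
    rw [h2]
    refine tendsto_nhds_unique h1 ?_
    have h4 : Filter.Tendsto (fun i ↦ u s (y (ns i))) Filter.atTop (nhds (u s x)) :=
      ((u s).continuous.tendsto x).comp (hy.comp hns.tendsto_atTop)
    refine h4.congr fun i ↦ ?_
    rw [← h3 (ns i)]
    rfl
  refine ⟨‖(⟨T, hc⟩ : X →L[ℂ] Lp ℂ 1 m)‖, norm_nonneg _, fun x ↦ ?_⟩
  have h1 : ‖T x‖ = ∫ s, ‖u s x‖ ∂m := by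
    rw [L1.norm_eq_integral_norm]
    exact integral_congr_ae ((hT x).mono fun s hs ↦ by simp only [hs])
  rw [← h1]
  exact ContinuousLinearMap.le_opNorm (⟨T, hc⟩ : X →L[ℂ] Lp ℂ 1 m) x

/-- Integration by parts against an indefinite integral. -/
theorem integral_mul_eq_sub_integral_deriv_mul {t : ℝ} (ht : 0 ≤ t) {w w' A b : ℝ → ℂ}
    (hw : ∀ s, HasDerivAt w (w' s) s) (hw' : Continuous w') (hb : IntegrableOn b (Set.Ioc 0 t))
    (hA : ∀ s ∈ Set.Icc 0 t, A s = A 0 + ∫ r in (0 : ℝ)..s, b r) :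
    ∫ s in (0 : ℝ)..t, w s * b s = w t * A t - w 0 * A 0 - ∫ s in (0 : ℝ)..t, w' s * A s := by
  have hint : ∀ x y, ∫ s in x..y, w' s = w y - w x := fun x y ↦
    intervalIntegral.integral_eq_sub_of_hasDerivAt (fun s _ ↦ hw s) (hw'.intervalIntegrable _ _)
  have hwc : Continuous w := continuous_iff_continuousAt.2 fun s ↦ (hw s).continuousAt
  have hw'i : IntegrableOn w' (Set.Ioc 0 t) := hw'.integrableOn_Ioc
  have hwb : IntegrableOn (fun s ↦ w s * b s) (Set.Ioc 0 t) := by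
    obtain ⟨M, hM⟩ := isCompact_Icc.exists_bound_of_continuousOn (s := Set.Icc 0 t) hwc.continuousOn
    exact hb.bdd_mul hwc.aestronglyMeasurable
      ((ae_restrict_mem measurableSet_Ioc).mono fun s hs ↦ hM s (Set.Ioc_subset_Icc_self hs))
  set D : Set (ℝ × ℝ) := {z | z.2 ≤ z.1} with hD
  have hDm : MeasurableSet D := measurableSet_le measurable_snd measurable_fst
  have hprod : Integrable (fun z : ℝ × ℝ ↦ D.indicator (fun z ↦ w' z.1 * b z.2) z)
      ((volume.restrict (Set.Ioc 0 t)).prod (volume.restrict (Set.Ioc 0 t))) :=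
    (Integrable.mul_prod hw'i hb).indicator hDm
  have e1 : ∀ s ∈ Set.Ioc 0 t,
      ∫ r in Set.Ioc 0 t, D.indicator (fun z ↦ w' z.1 * b z.2) (s, r) =
        w' s * A s - w' s * A 0 := by
    intro s hs
    have h1 : (fun r ↦ D.indicator (fun z ↦ w' z.1 * b z.2) (s, r)) =
        (Set.Iic s).indicator fun r ↦ w' s * b r := by
      ext r
      by_cases h : r ≤ s
      · rw [Set.indicator_of_mem (show (s, r) ∈ D from h), Set.indicator_of_mem (Set.mem_Iic.2 h)]
      · rw [Set.indicator_of_notMem (show (s, r) ∉ D from h),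
          Set.indicator_of_notMem (fun h' ↦ h (Set.mem_Iic.1 h'))]
    rw [h1, setIntegral_indicator measurableSet_Iic, Set.Ioc_inter_Iic, min_eq_right hs.2,
      integral_const_mul, hA s (Set.Ioc_subset_Icc_self hs), intervalIntegral.integral_of_le hs.1.le]
    ring
  have e2 : ∀ r ∈ Set.Ioc 0 t,
      ∫ s in Set.Ioc 0 t, D.indicator (fun z ↦ w' z.1 * b z.2) (s, r) =
        w t * b r - w r * b r := by
    intro r hr
    have h1 : (fun s ↦ D.indicator (fun z ↦ w' z.1 * b z.2) (s, r)) =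
        (Set.Ici r).indicator fun s ↦ w' s * b r := by
      ext s
      by_cases h : r ≤ s
      · rw [Set.indicator_of_mem (show (s, r) ∈ D from h), Set.indicator_of_mem (Set.mem_Ici.2 h)]
      · rw [Set.indicator_of_notMem (show (s, r) ∉ D from h),
          Set.indicator_of_notMem (fun h' ↦ h (Set.mem_Ici.1 h'))]
    have h2 : Set.Ioc 0 t ∩ Set.Ici r = Set.Icc r t := by
      ext s
      simp only [Set.mem_inter_iff, Set.mem_Ioc, Set.mem_Ici, Set.mem_Icc]
      exact ⟨fun h ↦ ⟨h.2, h.1.2⟩, fun h ↦ ⟨⟨hr.1.trans_le h.1, h.2⟩, h.1⟩⟩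
    rw [h1, setIntegral_indicator measurableSet_Ici, h2, integral_Icc_eq_integral_Ioc,
      integral_mul_const, ← intervalIntegral.integral_of_le hr.2, hint]
    ring
  have hswap := integral_integral_swap (f := fun s r ↦ D.indicator (fun z ↦ w' z.1 * b z.2) (s, r))
    hprod
  rw [setIntegral_congr_fun measurableSet_Ioc e1, setIntegral_congr_fun measurableSet_Ioc e2,
    integral_sub (hb.const_mul _) hwb, integral_const_mul] at hswap
  have hw'A : IntegrableOn (fun s ↦ w' s * A s) (Set.Ioc 0 t) := by
    have := (hprod.integral_prod_left).add (hw'i.mul_const (A 0))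
    refine this.congr ?_
    filter_upwards [ae_restrict_mem measurableSet_Ioc] with s hs
    rw [Pi.add_apply, e1 s hs]
    ring
  rw [integral_sub hw'A (hw'i.mul_const _), integral_mul_const] at hswap
  have h3 := hint 0 t
  have h4 := hA t ⟨ht, le_rfl⟩
  rw [intervalIntegral.integral_of_le ht] at h3 h4 ⊢
  rw [intervalIntegral.integral_of_le ht]
  rw [h3] at hswap
  rw [h4]
  linear_combination hswap

variable {d : ℕ}

theorem fourier_laplacian (ψ : 𝓢(Space d, ℂ)) (ξ : Space d) :
    𝓕 (Δ ψ) ξ = ((-‖(2 * Real.pi) • ξ‖ ^ 2 : ℝ) : ℂ) * 𝓕 ψ ξ := by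
  have hg : (fun x : Space d ↦ ‖x‖ ^ 2).HasTemperateGrowth := by fun_prop
  rw [SchwartzMap.laplacian_eq_fourierMultiplierCLM, SchwartzMap.fourierMultiplierCLM_apply,
    ← FourierTransform.fourierInv_smul, FourierTransform.fourier_fourierInv_eq, smul_apply,
    SchwartzMap.smulLeftCLM_apply_apply (by fun_prop)]
  rw [Complex.real_smul, Complex.real_smul, ← mul_assoc, ← Complex.ofReal_mul, norm_smul, mul_pow,
    Real.norm_of_nonneg (by positivity)]
  exact congrArg (fun r : ℝ ↦ (r : ℂ) * 𝓕 ψ ξ) (by ring)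

theorem schwartz_ext_fourier {ψ θ : 𝓢(Space d, ℂ)} (h : ∀ ξ, 𝓕 ψ ξ = 𝓕 θ ξ) : ψ = θ := by
  have h1 : 𝓕 ψ = 𝓕 θ := by ext ξ; exact h ξ
  rw [← FourierTransform.fourierInv_fourier_eq (F := 𝓢(Space d, ℂ)) ψ, h1,
    FourierTransform.fourierInv_fourier_eq]

/-- The geometric sequence `cⁿ` in `ℓ¹`. -/
def geomEllOne (c : ℂ) (hc : ‖c‖ < 1) : EllOne :=
  ⟨fun n ↦ c ^ n, memℓp_gen (by
    simpa using summable_geometric_of_lt_one (norm_nonneg c) hc)⟩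

theorem geomEllOne_apply (c : ℂ) (hc : ‖c‖ < 1) (n : ℕ) : geomEllOne c hc n = c ^ n := rfl

theorem EllOne.hasSum_apply {V : Type*} [AddCommGroup V] [Module ℂ V] [TopologicalSpace V]
    [ContinuousAdd V] (L : EllOne →L[ℂ] V) (x : EllOne) :
    HasSum (fun n ↦ x n • L (lp.single 1 n 1)) (L x) := by
  have h := (lp.hasSum_single (p := 1) ENNReal.one_ne_top x).mapL L
  convert h using 2 with n
  rw [← map_smul]
  congr 1
  ext k
  rw [lp.coeFn_smul, Pi.smul_apply, lp.single_apply, lp.single_apply]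
  by_cases hk : k = n
  · subst hk; simp
  · simp [hk]

/-- The composition of a tempered distribution with a synthesis operator. -/
def compEllOne (u : 𝓢'(Space d, ℂ)) (L : EllOne →L[ℂ] 𝓢(Space d, ℂ)) : EllOne →L[ℂ] ℂ :=
  ⟨(u : 𝓢(Space d, ℂ) →ₗ[ℂ] ℂ) ∘ₗ (L : EllOne →ₗ[ℂ] 𝓢(Space d, ℂ)),
    (map_continuous u).comp L.continuous⟩

theorem compEllOne_apply (u : 𝓢'(Space d, ℂ)) (L : EllOne →L[ℂ] 𝓢(Space d, ℂ)) (x : EllOne) :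
    compEllOne u L x = u (L x) := rfl

/-- The weight `(t - s)/(2t)` of the power series of the backward heat evolution on `[0, t]`. The
factor `1/2`, compensated by `R = 2μt` in the functions `Rⁿ/n! Δⁿψ`, makes its powers summable up to
`s = 0`. -/
def heatWeight (t s : ℝ) : ℂ := (((t - s) / (2 * t) : ℝ) : ℂ)

theorem norm_heatWeight_le {t s : ℝ} (hs : s ∈ Set.Icc 0 t) : ‖heatWeight t s‖ ≤ 1 / 2 := by
  rcases hs.1.trans hs.2 |>.eq_or_lt with ht | ht
  · rw [heatWeight, ← ht]; simp
  · rw [heatWeight, Complex.norm_real,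
      Real.norm_of_nonneg (div_nonneg (by linarith [hs.2]) (by positivity)),
      div_le_div_iff₀ (by positivity) (by norm_num)]
    linarith [hs.1]

theorem hasDerivAt_heatWeight (t s : ℝ) :
    HasDerivAt (heatWeight t) (-(1 / (2 * t) : ℝ) : ℂ) s := by
  have h1 : HasDerivAt (fun s : ℝ ↦ (t - s) / (2 * t)) (-1 / (2 * t)) s :=
    ((hasDerivAt_id s).const_sub t).div_const _
  have h2 : (-(1 / (2 * t) : ℝ) : ℂ) = ((-1 / (2 * t) : ℝ) : ℂ) := by push_cast; ring
  rw [h2]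
  exact h1.ofReal_comp

theorem continuous_heatWeight (t : ℝ) : Continuous (heatWeight t) :=
  continuous_iff_continuousAt.2 fun s ↦ (hasDerivAt_heatWeight t s).continuousAt

/-- With `βₙ = (2μt)ⁿ/n! Δⁿ ψ`, the backward heat evolution `e^{μ(t-s)Δ} ψ` of a band-limited `ψ`
is the sum of `((t-s)/(2t))ⁿ βₙ`. -/
theorem exists_clm_heat_series {μ t : ℝ} (hμ : 0 < μ) (ht : 0 < t) {ψ : 𝓢(Space d, ℂ)}
    (hψ : ψ ∈ bandLimited d) :
    ∃ (L : EllOne →L[ℂ] 𝓢(Space d, ℂ)) (β : ℕ → 𝓢(Space d, ℂ)),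
      (∀ n, L (lp.single 1 n 1) = β n) ∧ β 0 = ψ ∧
      (∀ n, Δ (β n) = (((n + 1) / (2 * μ * t) : ℝ) : ℂ) • β (n + 1)) ∧
      ∀ s ∈ Set.Icc 0 t, ∀ θ : 𝓢(Space d, ℂ), (∀ ξ, 𝓕 θ ξ =
        ((Real.exp (-(μ * (t - s)) * ‖(2 * Real.pi) • ξ‖ ^ 2) : ℝ) : ℂ) * 𝓕 ψ ξ) →
        ∀ u : 𝓢'(Space d, ℂ), HasSum (fun n ↦ heatWeight t s ^ n * u (β n)) (u θ) := by
  obtain ⟨R, hR⟩ : ∃ R, R = 2 * μ * t := ⟨_, rfl⟩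
  have hR0 : R ≠ 0 := by rw [hR]; positivity
  rw [← hR]
  obtain ⟨L, hL⟩ := exists_clm_ellOne_laplacian_pow hψ R
  have hβ : ∀ n ξ, 𝓕 (L (lp.single 1 n 1)) ξ =
      (R ^ n / n.factorial : ℝ) * ((-‖(2 * Real.pi) • ξ‖ ^ 2 : ℝ) : ℂ) ^ n * 𝓕 ψ ξ := by
    intro n ξ
    rw [hL, tsum_eq_single n]
    · rw [lp.single_apply_self, one_mul]
    · intro k hk
      rw [lp.single_apply_ne 1 n _ hk, zero_mul]
  refine ⟨L, fun n ↦ L (lp.single 1 n 1), fun n ↦ rfl, ?_, fun n ↦ ?_, fun s hs θ hθ u ↦ ?_⟩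
  · exact schwartz_ext_fourier fun ξ ↦ by rw [hβ]; simp
  · refine schwartz_ext_fourier fun ξ ↦ ?_
    rw [fourier_laplacian, FourierTransform.fourier_smul, smul_apply, hβ, hβ, smul_eq_mul,
      Nat.factorial_succ]
    generalize ((-‖(2 * Real.pi) • ξ‖ ^ 2 : ℝ) : ℂ) = z
    have h1 : ((n + 1 : ℕ) : ℂ) ≠ 0 := by exact_mod_cast n.succ_ne_zero
    have h2 : ((n.factorial : ℕ) : ℂ) ≠ 0 := by exact_mod_cast n.factorial_ne_zero
    have h3 : (R : ℂ) ≠ 0 := by exact_mod_cast hR0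
    push_cast at h1 ⊢
    field_simp
    ring
  · have hlt : ‖heatWeight t s‖ < 1 := (norm_heatWeight_le hs).trans_lt (by norm_num)
    have e : θ = L (geomEllOne (heatWeight t s) hlt) := schwartz_ext_fourier fun ξ ↦ by
      rw [hL, hθ ξ]
      simp only [geomEllOne_apply]
      have h1 : ∀ n : ℕ, heatWeight t s ^ n * ((R ^ n / n.factorial : ℝ) *
          ((-‖(2 * Real.pi) • ξ‖ ^ 2 : ℝ) : ℂ) ^ n * 𝓕 ψ ξ) =
          (((-(μ * (t - s)) * ‖(2 * Real.pi) • ξ‖ ^ 2 : ℝ) : ℂ) ^ n / n.factorial) * 𝓕 ψ ξ := by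
        intro n
        have h2 : (-(μ * (t - s)) * ‖(2 * Real.pi) • ξ‖ ^ 2 : ℝ) =
            (t - s) / (2 * t) * R * (-‖(2 * Real.pi) • ξ‖ ^ 2) := by
          rw [hR]; field_simp
        rw [h2, heatWeight, Complex.ofReal_mul, Complex.ofReal_mul, mul_pow, mul_pow,
          Complex.ofReal_div (R ^ n), Complex.ofReal_pow, Complex.ofReal_natCast]
        ring
      simp only [h1]
      rw [tsum_mul_right, Complex.ofReal_exp, Complex.exp_eq_exp_ℂ,
        NormedSpace.exp_eq_tsum_div]
    rw [e]
    have h3 := EllOne.hasSum_apply (compEllOne u L) (geomEllOne (heatWeight t s) hlt)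
    simp only [compEllOne_apply, geomEllOne_apply, smul_eq_mul] at h3
    exact h3

/-- Multiplication by the `n`-th power of the weight gains a factor `2⁻ⁿ` in `L¹`. -/
theorem integrableOn_heatWeight_pow_mul {t : ℝ} (n : ℕ) {g : ℝ → ℂ}
    (hg : IntegrableOn g (Set.Ioc 0 t)) :
    IntegrableOn (fun s ↦ heatWeight t s ^ n * g s) (Set.Ioc 0 t) ∧
      ∫ s in Set.Ioc 0 t, ‖heatWeight t s ^ n * g s‖ ≤
        (1 / 2) ^ n * ∫ s in Set.Ioc 0 t, ‖g s‖ := by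
  have hb : ∀ᵐ s ∂volume.restrict (Set.Ioc 0 t), ‖heatWeight t s ^ n‖ ≤ (1 / 2) ^ n :=
    (ae_restrict_mem measurableSet_Ioc).mono fun s hs ↦ by
      rw [norm_pow]
      exact pow_le_pow_left₀ (norm_nonneg _) (norm_heatWeight_le (Set.Ioc_subset_Icc_self hs)) n
  have hi : IntegrableOn (fun s ↦ heatWeight t s ^ n * g s) (Set.Ioc 0 t) :=
    hg.bdd_mul ((continuous_heatWeight t).pow n).aestronglyMeasurable hb
  refine ⟨hi, ?_⟩
  rw [← integral_const_mul]
  refine integral_mono_ae hi.norm (hg.norm.const_mul _) (hb.mono fun s hs ↦ ?_)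
  simp only [norm_mul]
  gcongr

/-- Integration by parts against the powers of the weight, summed over `n`: the terms
`∫ (n+1)/(2t) cⁿ aₙ₊₁` telescope and the last one tends to zero. -/
theorem hasSum_telescope {t : ℝ} (ht : 0 < t) {a f : ℕ → ℝ → ℂ} {Av AF : ℝ}
    (haint : ∀ n, IntegrableOn (a n) (Set.Ioc 0 t)) (hfint : ∀ n, IntegrableOn (f n) (Set.Ioc 0 t))
    (hAv : ∀ n, ∫ s in Set.Ioc 0 t, ‖a n s‖ ≤ Av) (hAF : ∀ n, ∫ s in Set.Ioc 0 t, ‖f n s‖ ≤ AF)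
    (hA : ∀ n : ℕ, ∀ s ∈ Set.Icc 0 t, a n s = a n 0 +
      ∫ r in (0 : ℝ)..s, ((((n + 1) / (2 * t) : ℝ) : ℂ) * a (n + 1) r + f n r))
    {S : ℂ} (hS : HasSum (fun n ↦ heatWeight t 0 ^ n * a n 0) S) {Φ : ℝ → ℂ}
    (hΦ : ∀ s ∈ Set.Ioc 0 t, HasSum (fun n ↦ heatWeight t s ^ n * f n s) (Φ s)) :
    a 0 t = S + ∫ s in (0 : ℝ)..t, Φ s := by
  have hbint : ∀ n : ℕ, IntegrableOn
      (fun r ↦ (((n + 1) / (2 * t) : ℝ) : ℂ) * a (n + 1) r + f n r) (Set.Ioc 0 t) := fun n ↦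
    ((haint _).const_mul _).add (hfint _)
  set I : ℕ → ℂ := fun n ↦
    (((n + 1) / (2 * t) : ℝ) : ℂ) * ∫ s in Set.Ioc 0 t, heatWeight t s ^ n * a (n + 1) s with hI
  set J : ℕ → ℂ := fun n ↦ ∫ s in Set.Ioc 0 t, heatWeight t s ^ n * f n s with hJ
  have hct : heatWeight t t = 0 := by rw [heatWeight]; simp
  have hparts : ∀ n, I n + J n = heatWeight t t ^ n * a n t - heatWeight t 0 ^ n * a n 0 -
      ∫ s in Set.Ioc 0 t, (n * heatWeight t s ^ (n - 1) * (-(1 / (2 * t) : ℝ) : ℂ)) * a n s := by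
    intro n
    have h1 := integral_mul_eq_sub_integral_deriv_mul ht.le (w := fun s ↦ heatWeight t s ^ n)
      (w' := fun s ↦ n * heatWeight t s ^ (n - 1) * (-(1 / (2 * t) : ℝ) : ℂ)) (fun s ↦ (hasDerivAt_heatWeight t s).pow n)
      (by have := continuous_heatWeight t; fun_prop) (hbint n) (hA n)
    rw [intervalIntegral.integral_of_le ht.le, intervalIntegral.integral_of_le ht.le] at h1
    rw [← h1, hI, hJ]
    simp only
    rw [← integral_const_mul, ← integral_add ((integrableOn_heatWeight_pow_mul n (haint _)).1.const_mul _)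
      (integrableOn_heatWeight_pow_mul n (hfint _)).1]
    congr with s
    ring
  have htel : ∀ N, ∑ n ∈ Finset.range (N + 1), J n =
      a 0 t - (∑ n ∈ Finset.range (N + 1), heatWeight t 0 ^ n * a n 0) - I N := by
    intro N
    induction N with
    | zero =>
      have h1 := hparts 0
      simp only [pow_zero, one_mul, Nat.cast_zero, zero_mul, integral_zero, sub_zero] at h1
      simp only [zero_add, Finset.range_one, Finset.sum_singleton, pow_zero, one_mul]
      linear_combination h1
    | succ N ih =>
      have h1 := hparts (N + 1)
      rw [hct, zero_pow N.succ_ne_zero, zero_mul] at h1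
      have h2 : ∫ s in Set.Ioc 0 t,
          (((N + 1 : ℕ) : ℂ) * heatWeight t s ^ (N + 1 - 1) * (-(1 / (2 * t) : ℝ) : ℂ)) * a (N + 1) s =
          - I N := by
        rw [hI]
        simp only
        rw [← integral_const_mul, ← integral_neg]
        congr with s
        rw [Nat.add_sub_cancel]
        push_cast
        ring
      rw [h2] at h1
      rw [Finset.sum_range_succ, ih, Finset.sum_range_succ _ (N + 1)]
      linear_combination h1
  have hIlim : Filter.Tendsto I Filter.atTop (nhds 0) := by
    have h1 : ∀ n, ‖I n‖ ≤ (n + 1) * (1 / 2) ^ n * (Av / (2 * t)) := fun n ↦ by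
      rw [hI]
      simp only
      rw [norm_mul, Complex.norm_real, Real.norm_of_nonneg (by positivity)]
      calc _ ≤ (n + 1) / (2 * t) * ((1 / 2) ^ n * Av) := by
            gcongr
            refine (norm_integral_le_integral_norm _).trans ((integrableOn_heatWeight_pow_mul n (haint _)).2.trans ?_)
            gcongr
            exact hAv _
        _ = _ := by ring
    have h2 : Filter.Tendsto (fun n : ℕ ↦ ((n : ℝ) + 1) * (1 / 2) ^ n * (Av / (2 * t)))
        Filter.atTop (nhds 0) := by
      have h3 := tendsto_self_mul_const_pow_of_lt_one (r := (1 / 2 : ℝ)) (by norm_num) (by norm_num)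
      have h4 := tendsto_pow_atTop_nhds_zero_of_lt_one (r := (1 / 2 : ℝ)) (by norm_num) (by norm_num)
      have h5 := (h3.add h4).mul_const (Av / (2 * t))
      rw [add_zero, zero_mul] at h5
      refine h5.congr fun n ↦ ?_
      ring
    exact squeeze_zero_norm h1 h2
  have hJsum : HasSum J (∫ s in Set.Ioc 0 t, Φ s) := by
    have h1 := hasSum_integral_of_summable_integral_norm (μ := volume.restrict (Set.Ioc 0 t))
      (F := fun n s ↦ heatWeight t s ^ n * f n s) (fun n ↦ (integrableOn_heatWeight_pow_mul n (hfint _)).1) (by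
        refine Summable.of_nonneg_of_le (fun n ↦ integral_nonneg fun s ↦ norm_nonneg _)
          (fun n ↦ (integrableOn_heatWeight_pow_mul n (hfint _)).2.trans
            (mul_le_mul_of_nonneg_left (hAF n) (by positivity)))
          ((summable_geometric_of_lt_one (by norm_num) (by norm_num)).mul_right _))
    have h2 : ∫ s in Set.Ioc 0 t, (∑' n, heatWeight t s ^ n * f n s) = ∫ s in Set.Ioc 0 t, Φ s :=
      setIntegral_congr_fun measurableSet_Ioc fun s hs ↦
        (hΦ s hs).tsum_eq
    rwa [h2] at h1
  have hlim1 := ((hJsum.tendsto_sum_nat).comp (Filter.tendsto_add_atTop_nat 1))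
  have hlim2 := (hS.tendsto_sum_nat).comp (Filter.tendsto_add_atTop_nat 1)
  have hlim3 := (hlim2.const_sub (a 0 t)).sub hIlim
  have h9 := tendsto_nhds_unique hlim1 (hlim3.congr fun N ↦ (htel N).symm)
  rw [intervalIntegral.integral_of_le ht.le, h9]
  ring

/-- The Duhamel formula for band-limited test functions. The equation is tested against the
terms of the power series of the backward heat evolution. -/
theorem IsHeatSolution.duhamel {μ T : ℝ} {v₀ : 𝓢'(Space d, ℂ)} {F v : ℝ → 𝓢'(Space d, ℂ)}
    (h : IsHeatSolution μ T v₀ F v) (hμ : 0 < μ) {t : ℝ} (ht : 0 < t) (htT : t < T)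
    {ψ : 𝓢(Space d, ℂ)} (hψ : ψ ∈ bandLimited d) (θ : ℝ → 𝓢(Space d, ℂ))
    (hθ : ∀ s ∈ Set.Icc 0 t, ∀ ξ, 𝓕 (θ s) ξ =
      ((Real.exp (-(μ * (t - s)) * ‖(2 * Real.pi) • ξ‖ ^ 2) : ℝ) : ℂ) * 𝓕 ψ ξ) :
    v t ψ = v₀ (θ 0) + ∫ s in (0 : ℝ)..t, F s (θ s) := by
  obtain ⟨L, β, hL, hβ0, hΔ, hsum⟩ := exists_clm_heat_series hμ ht hψ
  have htI : t ∈ Set.Ico 0 T := ⟨ht.le, htT⟩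
  have hvint : ∀ ψ : 𝓢(Space d, ℂ), IntegrableOn (fun s ↦ v s ψ) (Set.Ioc 0 t) := fun ψ ↦
    (((h.continuousOn ψ).mono (Set.Icc_subset_Ico_right htT)).integrableOn_Icc).mono_set
      Set.Ioc_subset_Icc_self
  have hFint : ∀ ψ : 𝓢(Space d, ℂ), IntegrableOn (fun s ↦ F s ψ) (Set.Ioc 0 t) := fun ψ ↦
    h.integrableOn ψ t htI
  obtain ⟨Av, -, hAv⟩ := exists_integral_norm_le_of_weakly_integrable
    (m := volume.restrict (Set.Ioc 0 t)) (fun s ↦ compEllOne (v s) L) fun x ↦ hvint (L x)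
  obtain ⟨AF, -, hAF⟩ := exists_integral_norm_le_of_weakly_integrable
    (m := volume.restrict (Set.Ioc 0 t)) (fun s ↦ compEllOne (F s) L) fun x ↦ hFint (L x)
  have hsn : ∀ n, ‖(lp.single 1 n (1 : ℂ) : EllOne)‖ = 1 := fun n ↦ by
    rw [lp.norm_single (by simp), norm_one]
  have hav : ∀ n, ∫ s in Set.Ioc 0 t, ‖v s (β n)‖ ≤ Av := fun n ↦ by
    have := hAv (lp.single 1 n 1)
    simp only [compEllOne_apply, hL, hsn, mul_one] at this
    exact this
  have hfF : ∀ n, ∫ s in Set.Ioc 0 t, ‖F s (β n)‖ ≤ AF := fun n ↦ by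
    have := hAF (lp.single 1 n 1)
    simp only [compEllOne_apply, hL, hsn, mul_one] at this
    exact this
  have hA : ∀ n : ℕ, ∀ s ∈ Set.Icc 0 t, v s (β n) = v 0 (β n) +
      ∫ r in (0 : ℝ)..s, ((((n + 1 : ℝ) / (2 * t) : ℝ) : ℂ) * v r (β (n + 1)) + F r (β n)) := by
    intro n s hs
    have h1 := h.equation (β n) s ⟨hs.1, hs.2.trans_lt htT⟩
    rw [h.initial, ← sub_eq_iff_eq_add', h1]
    refine intervalIntegral.integral_congr fun r _ ↦ ?_
    rw [TemperedDistribution.laplacian_apply_apply, hΔ, map_smul, smul_eq_mul, ← mul_assoc,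
      ← Complex.ofReal_mul]
    congr 3
    field_simp
  have hS := hsum 0 ⟨le_rfl, ht.le⟩ (θ 0) (hθ 0 ⟨le_rfl, ht.le⟩) (v 0)
  have key := hasSum_telescope ht (a := fun n s ↦ v s (β n)) (f := fun n s ↦ F s (β n))
    (fun n ↦ hvint _) (fun n ↦ hFint _) hav hfF hA hS (Φ := fun s ↦ F s (θ s)) fun s hs ↦
      hsum s (Set.Ioc_subset_Icc_self hs) (θ s) (hθ s (Set.Ioc_subset_Icc_self hs)) (F s)
  simp only [hβ0, h.initial] at key
  exact key

end Duhamel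

/-! ### Dyadic blocks of test functions -/

section Blocks

variable {d : ℕ} (Θ : DyadicCutoff d)

theorem fourier_fourier_schwartz (h : 𝓢(Space d, ℂ)) (ξ : Space d) : 𝓕 (𝓕 h) ξ = h (-ξ) := by
  have h1 : (𝓕⁻ (𝓕 h) : 𝓢(Space d, ℂ)) (-ξ) = h (-ξ) := by
    rw [FourierTransform.fourierInv_fourier_eq]
  rw [← h1, SchwartzMap.fourierInv_coe, Real.fourierInv_eq_fourier_neg, neg_neg,
    SchwartzMap.fourier_coe]

theorem DyadicCutoff.φ_neg (η : Space d) : Θ.φ (-η) = Θ.φ η := by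
  rw [φ, φ, Θ.radial (-η) η (norm_neg η), Θ.radial ((1 / 2 : ℝ) • -η) ((1 / 2 : ℝ) • η)
    (by rw [smul_neg, norm_neg])]

/-- The symbol of the dyadic block `Δ̇_j`, as a function of Mathlib's frequency variable. -/
def blockSymbol (j : ℤ) (ξ : Space d) : ℂ :=
  ((Θ.φ (((2 : ℝ) ^ (-j) * (2 * Real.pi)) • ξ) : ℝ) : ℂ)

theorem hasCompactSupport_comp_smul {f : Space d → ℂ} (hf : HasCompactSupport f) {c : ℝ}
    (hc : c ≠ 0) : HasCompactSupport fun ξ ↦ f (c • ξ) :=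
  hf.comp_homeomorph (Homeomorph.smulOfNeZero c hc)

theorem blockSymbol_contDiff (j : ℤ) : ContDiff ℝ ∞ (blockSymbol Θ j) :=
  Complex.ofRealCLM.contDiff.comp (Θ.φ_contDiff.comp (contDiff_const_smul _))

theorem hasCompactSupport_blockSymbol (j : ℤ) : HasCompactSupport (blockSymbol Θ j) :=
  hasCompactSupport_comp_smul (f := fun η ↦ ((Θ.φ η : ℝ) : ℂ))
    (DyadicCutoff.hasCompactSupport_of_ge (R := 8 / 3) fun η hη ↦ by
      rw [Θ.φ_eq_zero_of_ge hη, Complex.ofReal_zero]) (by positivity)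

/-- The transpose of the dyadic block, which is the dyadic block itself because `φ` is even. -/
def blockTest (j : ℤ) (ψ : 𝓢(Space d, ℂ)) : 𝓢(Space d, ℂ) :=
  𝓕 (SchwartzMap.smulLeftCLM ℂ (blockSymbol Θ j) (𝓕⁻ ψ))

theorem dyadicBlock_apply (j : ℤ) (u : 𝓢'(Space d, ℂ)) (ψ : 𝓢(Space d, ℂ)) :
    dyadicBlock Θ j u ψ = u (blockTest Θ j ψ) := rfl

theorem fourier_blockTest (j : ℤ) (ψ : 𝓢(Space d, ℂ)) (ξ : Space d) :
    𝓕 (blockTest Θ j ψ) ξ = blockSymbol Θ j ξ * 𝓕 ψ ξ := by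
  rw [blockTest, fourier_fourier_schwartz, SchwartzMap.smulLeftCLM_apply_apply
    ((hasCompactSupport_blockSymbol Θ j).hasTemperateGrowth (blockSymbol_contDiff Θ j)),
    SchwartzMap.fourierInv_coe, Real.fourierInv_eq_fourier_neg, neg_neg, smul_eq_mul,
    SchwartzMap.fourier_coe, blockSymbol, blockSymbol, smul_neg, Θ.φ_neg]

theorem blockTest_mem_bandLimited (j : ℤ) (ψ : 𝓢(Space d, ℂ)) :
    blockTest Θ j ψ ∈ bandLimited d := by
  rw [mem_bandLimited]
  simp only [fourier_blockTest]
  exact (hasCompactSupport_blockSymbol Θ j).mul_right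

/-- The symbol `φ̃(lξ) e^{a|ξ|₁ - b|ξ|²}` of the Gevrey heat flow localised to an annulus of size
`1/l`. -/
def fatSymbol (l a b : ℝ) (ξ : Space d) : ℂ :=
  ((Θ.fat (l • ((2 * Real.pi) • ξ)) : ℝ) : ℂ) *
    ((Real.exp (a * l1Norm ((2 * Real.pi) • ξ) - b * ‖(2 * Real.pi) • ξ‖ ^ 2) : ℝ) : ℂ)

theorem fatSymbol_mul_exp (l a a' b : ℝ) (ξ : Space d) :
    ((Real.exp (a' * l1Norm ((2 * Real.pi) • ξ)) : ℝ) : ℂ) * fatSymbol Θ l a b ξ =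
      fatSymbol Θ l (a' + a) b ξ := by
  rw [fatSymbol, fatSymbol, mul_left_comm, ← Complex.ofReal_mul, ← Real.exp_add]
  congr 3
  ring

/-- The localised heat evolution of a Schwartz function is a Schwartz function. -/
theorem exists_heatTest {l : ℝ} (hl : 0 < l) (b : ℝ) (ψ : 𝓢(Space d, ℂ)) :
    ∃ θ ∈ bandLimited d, ∀ ξ, 𝓕 θ ξ = fatSymbol Θ l 0 b ξ * 𝓕 ψ ξ := by
  have e : fatSymbol Θ l 0 b = fun ξ : Space d ↦ ((Θ.fat (l • ((2 * Real.pi) • ξ)) : ℝ) : ℂ) *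
      ((Real.exp (-b * ‖(2 * Real.pi) • ξ‖ ^ 2) : ℝ) : ℂ) := by
    ext ξ
    rw [fatSymbol, zero_mul, zero_sub, neg_mul]
  have hs : ContDiff ℝ ∞ (fatSymbol Θ l 0 b) := by
    rw [e]
    exact (Complex.ofRealCLM.contDiff.comp (Θ.fat_contDiff.comp ((contDiff_const_smul _).comp
      (contDiff_const_smul _)))).mul (Complex.ofRealCLM.contDiff.comp (Real.contDiff_exp.comp
        (contDiff_const.mul contDiff_norm_two_pi_smul_sq)))
  have hc : HasCompactSupport (fatSymbol Θ l 0 b) := by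
    rw [e]
    have h1 : HasCompactSupport fun ξ : Space d ↦
        ((Θ.fat (l • ((2 * Real.pi) • ξ)) : ℝ) : ℂ) :=
      hasCompactSupport_comp_smul (f := fun η ↦ ((Θ.fat (l • η) : ℝ) : ℂ))
        (hasCompactSupport_comp_smul (f := fun η ↦ ((Θ.fat η : ℝ) : ℂ))
          (DyadicCutoff.hasCompactSupport_of_ge (R := 16 / 3) fun η hη ↦ by
            rw [Θ.fat_eq_zero_of_ge hη, Complex.ofReal_zero]) hl.ne') (by positivity)
    exact h1.mul_right
  exact exists_bandLimited_fourier_eq (h := fun ξ ↦ fatSymbol Θ l 0 b ξ * 𝓕 ψ ξ) hc.mul_right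
    (hs.mul ((𝓕 ψ).smooth _))

/-- Decreasing the Gevrey weight costs nothing, because `e^{-a|ξ|₁}` has a kernel of norm `1`. -/
theorem isL1Multiplier_fatSymbol_neg {l a b A : ℝ} (ha : 0 ≤ a)
    (h : IsL1Multiplier (fatSymbol Θ l 0 b) A) : IsL1Multiplier (fatSymbol Θ l (-a) b) A := by
  rcases ha.eq_or_lt with rfl | ha
  · rwa [neg_zero]
  · have := (isL1Multiplier_exp_neg_l1Norm d ha).mul h
    simp only [fatSymbol_mul_exp, add_zero, one_mul] at this
    exact this

end Blocks

/-! ### The pointwise in time estimate of a dyadic block -/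

section Pointwise

variable {d : ℕ} {Θ : DyadicCutoff d} {p q : ℝ≥0∞}

theorem fourierInv_fun_add {f g : Space d → ℂ} (hf : Integrable f) (hg : Integrable g) :
    (𝓕⁻ fun ξ ↦ f ξ + g ξ) = fun x ↦ 𝓕⁻ f x + 𝓕⁻ g x := by
  ext x
  have hi : ∀ {h : Space d → ℂ}, Integrable h →
      Integrable fun ξ ↦ Real.fourierChar (inner ℝ ξ x) • h ξ := fun {h} hh ↦ by
    simpa using (Real.fourierIntegral_convergent_iff (-x)).2 hh
  simp only [Real.fourierInv_eq, smul_add]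
  exact integral_add (hi hf) (hi hg)

theorem fourierInv_fun_const_mul (c : ℂ) (f : Space d → ℂ) :
    (𝓕⁻ fun ξ ↦ c * f ξ) = fun x ↦ c * 𝓕⁻ f x := by
  ext x
  simp only [Real.fourierInv_eq]
  rw [← integral_const_mul]
  congr with ξ
  rw [mul_smul_comm]

/-- The time-dependent bound for the block of size `1/l` of the solution: Duhamel's formula with the
operators replaced by their norms `k (t - s)`. -/
def duhamelBound (k : ℝ → ℝ) (t : ℝ) (D : ℝ≥0∞) (N : ℝ → ℝ≥0∞) : ℝ≥0∞ :=
  ENNReal.ofReal (k t) * D + ∫⁻ s in Set.Ioo 0 t, ENNReal.ofReal (k (t - s)) * N s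

/-- Duhamel's formula for a dyadic block tested against `η`. The Gevrey weight of the forcing at time
`s` is transferred to the test function as `e^{-√(c₀s)Λ₁}`. -/
theorem IsHeatSolution.enorm_dyadicBlock_apply_le [ENNReal.HolderConjugate p q] (hq1 : 1 ≤ q)
    (hq : q ≠ ⊤) {c₀ μ T : ℝ} {v₀ : 𝓢'(Space d, ℂ)} {F v : ℝ → 𝓢'(Space d, ℂ)}
    (h : IsHeatSolution μ T v₀ F v) (hc₀ : 0 < c₀) (hμ : 0 < μ) {t : ℝ} (ht : 0 < t) (htT : t < T)
    (j : ℤ) {k : ℝ → ℝ} (hk : ∀ τ, 0 < τ → 0 < k τ) {η : 𝓢(Space d, ℂ)} {Y : ℝ≥0∞} (hY0 : Y ≠ 0)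
    (hY : Y ≠ ⊤)
    (hη : ∀ s, 0 ≤ s → s < t → eLpNorm (𝓕⁻ fun ξ ↦
      fatSymbol Θ (2 ^ (-j)) (-Real.sqrt (c₀ * s)) (μ * (t - s)) ξ * 𝓕 η ξ) q volume ≤
        ENNReal.ofReal (k (t - s)) * Y) :
    ‖dyadicBlock Θ j (v t) η‖ₑ ≤ duhamelBound k t (distLpNorm p (dyadicBlock Θ j v₀))
      (fun s ↦ gevreyLpNorm p (Real.sqrt (c₀ * s)) (dyadicBlock Θ j (F s))) * Y := by
  have hl : (0 : ℝ) < 2 ^ (-j) := by positivity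
  choose θ hθb hθ using fun s ↦ exists_heatTest Θ hl (μ * (t - s)) η
  have hduh := h.duhamel hμ ht htT (blockTest_mem_bandLimited Θ j η)
    (fun s ↦ blockTest Θ j (θ s)) fun s _ ξ ↦ by
      rw [fourier_blockTest, fourier_blockTest, hθ, fatSymbol, blockSymbol]
      have h1 := Θ.fat_mul_φ (((2 : ℝ) ^ (-j) * (2 * Real.pi)) • ξ)
      rw [smul_smul, zero_mul, zero_sub, neg_mul]
      have h2 := congrArg (fun r : ℝ ↦ (r : ℂ)) h1
      simp only [Complex.ofReal_mul] at h2 ⊢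
      linear_combination (((Real.exp (-(μ * (t - s) * ‖(2 * Real.pi) • ξ‖ ^ 2)) : ℝ) : ℂ) *
        𝓕 η ξ) * h2
  simp only [← dyadicBlock_apply] at hduh
  have hX : ∀ s, s < t → ENNReal.ofReal (k (t - s)) * Y ≠ 0 ∧
      ENNReal.ofReal (k (t - s)) * Y ≠ ⊤ := fun s hs ↦
    ⟨mul_ne_zero (by simpa using hk _ (sub_pos.2 hs)) hY0,
      ENNReal.mul_ne_top ENNReal.ofReal_ne_top hY⟩
  have h0 : ‖dyadicBlock Θ j v₀ (θ 0)‖ₑ ≤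
      distLpNorm p (dyadicBlock Θ j v₀) * (ENNReal.ofReal (k t) * Y) := by
    have h1 := hη 0 le_rfl ht
    have h2 : (𝓕⁻ fun ξ ↦ fatSymbol Θ (2 ^ (-j)) (-Real.sqrt (c₀ * 0)) (μ * (t - 0)) ξ * 𝓕 η ξ) =
        (θ 0 : Space d → ℂ) := by
      rw [mul_zero, Real.sqrt_zero, neg_zero]
      simp only [← hθ]
      rw [SchwartzMap.fourier_coe, (IsWienerFunction.schwartz (θ 0)).fourierInv_fourier]
    rw [h2, sub_zero] at h1
    have h3 := hX 0 ht
    rw [sub_zero] at h3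
    exact enorm_apply_le_distLpNorm_mul _ _ h3.1 h3.2 h1
  have hs : ∀ s ∈ Set.Ioo 0 t, ‖dyadicBlock Θ j (F s) (θ s)‖ₑ ≤ ENNReal.ofReal (k (t - s)) *
      gevreyLpNorm p (Real.sqrt (c₀ * s)) (dyadicBlock Θ j (F s)) * Y := fun s hs ↦ by
    have h1 := hη s hs.1.le hs.2
    have h2 : (fun ξ : Space d ↦
        fatSymbol Θ (2 ^ (-j)) (-Real.sqrt (c₀ * s)) (μ * (t - s)) ξ * 𝓕 η ξ) =
        fun ξ ↦ ((Real.exp (-Real.sqrt (c₀ * s) * l1Norm ((2 * Real.pi) • ξ)) : ℝ) : ℂ) *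
          𝓕 (θ s) ξ := by
      ext ξ
      rw [hθ, ← mul_assoc, fatSymbol_mul_exp, add_zero]
    rw [h2] at h1
    have h3 := enorm_apply_le_gevreyLpNorm_mul (p := p) hq1 hq
      (Real.sqrt_pos.2 (mul_pos hc₀ hs.1)) (dyadicBlock Θ j (F s)) (hθb s)
      (hX s hs.2).1 (hX s hs.2).2 h1
    rw [← mul_assoc, mul_comm (gevreyLpNorm _ _ _)] at h3
    exact h3
  rw [hduh, duhamelBound, add_mul]
  refine (enorm_add_le _ _).trans (add_le_add (h0.trans (le_of_eq (by ring))) ?_)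
  rw [intervalIntegral.integral_of_le ht.le, ← restrict_Ioo_eq_restrict_Ioc,
    ← lintegral_mul_const' _ _ hY]
  exact (enorm_integral_le_lintegral_enorm _).trans (setLIntegral_mono' measurableSet_Ioo hs)

end Pointwise

section GevreyBound

variable {d : ℕ} {Θ : DyadicCutoff d} {p q : ℝ≥0∞}

theorem exists_schwartz_integral_norm_sub_lt {K : Space d → ℂ} (hK : Integrable K) {δ : ℝ}
    (hδ : 0 < δ) : ∃ K' : 𝓢(Space d, ℂ), ∫ x, ‖K' x - K x‖ ≤ δ := by
  have hd := SchwartzMap.denseRange_toLpCLM (E := Space d) (F := ℂ) (p := 1) ENNReal.one_ne_top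
    (μ := volume)
  obtain ⟨K', hK'⟩ := hd.exists_dist_lt hK.toL1 hδ
  refine ⟨K', le_trans (le_of_eq ?_) hK'.le⟩
  rw [dist_comm, dist_eq_norm, L1.norm_eq_integral_norm]
  apply integral_congr_ae
  filter_upwards [Lp.coeFn_sub (SchwartzMap.toLpCLM ℝ ℂ 1 volume K') hK.toL1, hK.coeFn_toL1,
    K'.coeFn_toLp 1 volume] with x h1 h2 h3
  rw [h1, Pi.sub_apply, h2]
  exact congrArg (fun z ↦ ‖z - K x‖) h3.symm

theorem IsL1Multiplier.integrable_mul {m : Space d → ℂ} {A : ℝ} (hm : IsL1Multiplier m A)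
    (ψ : 𝓢(Space d, ℂ)) : Integrable fun ξ ↦ m ξ * 𝓕 ψ ξ := by
  obtain ⟨h1, h2⟩ := hm.isWienerFunction ψ
  rw [← h2]
  exact h1.integrable_fourier

/-- The function `e^{aΛ₁} ψ` is approximated by Schwartz functions on which a multiplier `M` is
controlled by the kernel of `M e^{aΛ₁}`: the integrable kernel of `e^{aΛ₁ + Δ}` is approximated
by Schwartz functions. -/
theorem exists_schwartz_approx_gevreyTest (hq1 : 1 ≤ q) (hq : q ≠ ⊤) {a : ℝ} (ha : 0 ≤ a)
    {ψ : 𝓢(Space d, ℂ)} (hψ : ψ ∈ bandLimited d) {ε : ℝ} (hε : 0 < ε) :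
    ∃ η : 𝓢(Space d, ℂ), eLpNorm (fun x ↦ η x - gevreyTest a ψ x) q volume ≤ ENNReal.ofReal ε ∧
      ∀ (M M' : Space d → ℂ) (A : ℝ), IsL1Multiplier M A → IsL1Multiplier M' A →
        (∀ ξ, M' ξ = ((Real.exp (a * l1Norm ((2 * Real.pi) • ξ)) : ℝ) : ℂ) * M ξ) →
        eLpNorm (𝓕⁻ fun ξ ↦ M ξ * 𝓕 η ξ) q volume ≤
          ENNReal.ofReal A * (eLpNorm ψ q volume + ENNReal.ofReal ε) := by
  obtain ⟨ψ', hψ', m, A₀, hm, e⟩ := exists_gevreyTest_eq ha hψ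
  have hX : eLpNorm ψ' q volume ≠ ⊤ := (ψ'.memLp q volume).2.ne
  set X := (eLpNorm ψ' q volume).toReal with hXdef
  have hX0 : 0 ≤ X := ENNReal.toReal_nonneg
  have hmm := hm
  obtain ⟨K, hKm, hK, -, hKF⟩ := hm
  obtain ⟨K', hK'⟩ := exists_schwartz_integral_norm_sub_lt hK
    (show 0 < ε / (X + 1) by positivity)
  set δ := ε / (X + 1) with hδ
  have hδ0 : 0 < δ := by positivity
  have hδX : ENNReal.ofReal δ * eLpNorm ψ' q volume ≤ ENNReal.ofReal ε := by
    rw [← ENNReal.ofReal_toReal hX, ← ENNReal.ofReal_mul hδ0.le]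
    apply ENNReal.ofReal_le_ofReal
    rw [hδ, div_mul_eq_mul_div, div_le_iff₀ (by positivity)]
    nlinarith
  -- the error kernel
  have hE : IsL1Multiplier (fun ξ ↦ 𝓕 K' ξ - m ξ) δ := by
    refine ⟨fun x ↦ K' x - K x, K'.continuous.measurable.sub hKm, K'.integrable.sub hK, hK', ?_⟩
    ext ξ
    rw [← hKF, SchwartzMap.fourier_coe]
    simp only [Real.fourier_eq, smul_sub]
    exact integral_sub ((Real.fourierIntegral_convergent_iff ξ).2 K'.integrable)
      ((Real.fourierIntegral_convergent_iff ξ).2 hK)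
  obtain ⟨η, -, hη⟩ := exists_bandLimited_fourier_eq (h := fun ξ ↦ 𝓕 K' ξ * 𝓕 ψ' ξ)
    (HasCompactSupport.mul_left hψ') (((𝓕 K').smooth _).mul ((𝓕 ψ').smooth _))
  have hsplit : ∀ ξ, 𝓕 η ξ = ((Real.exp (a * l1Norm ((2 * Real.pi) • ξ)) : ℝ) : ℂ) * 𝓕 ψ ξ +
      (𝓕 K' ξ - m ξ) * 𝓕 ψ' ξ := fun ξ ↦ by
    rw [hη, ← e]; ring
  refine ⟨η, ?_, fun M M' A hM hM' hMM ↦ ?_⟩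
  · have h1 : (fun x ↦ η x - gevreyTest a ψ x) = 𝓕⁻ fun ξ ↦ (𝓕 K' ξ - m ξ) * 𝓕 ψ' ξ := by
      have h2 : (η : Space d → ℂ) = fun x ↦ gevreyTest a ψ x +
          (𝓕⁻ fun ξ ↦ (𝓕 K' ξ - m ξ) * 𝓕 ψ' ξ) x := by
        have hi : Integrable fun ξ ↦
            ((Real.exp (a * l1Norm ((2 * Real.pi) • ξ)) : ℝ) : ℂ) * 𝓕 ψ ξ := by
          simp only [← e]
          exact hmm.integrable_mul ψ'
        rw [gevreyTest, ← fourierInv_fun_add hi (hE.integrable_mul ψ')]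
        simp only [← hsplit]
        rw [SchwartzMap.fourier_coe, (IsWienerFunction.schwartz η).fourierInv_fourier]
      ext x
      have h3 := congrFun h2 x
      rw [h3, add_sub_cancel_left]
    rw [h1]
    exact (hE.eLpNorm_le hq1 hq ψ').trans hδX
  · have h1 : (fun ξ ↦ M ξ * 𝓕 η ξ) =
        fun ξ ↦ M' ξ * 𝓕 ψ ξ + (M ξ * (𝓕 K' ξ - m ξ)) * 𝓕 ψ' ξ := by
      ext ξ
      rw [hsplit, hMM]
      ring
    have hME := hM.mul hE
    rw [h1, fourierInv_fun_add (hM'.integrable_mul ψ) (hME.integrable_mul ψ')]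
    refine (eLpNorm_add_le (hM'.isWienerFunction ψ).1.continuous.aestronglyMeasurable
      (hME.isWienerFunction ψ').1.continuous.aestronglyMeasurable hq1).trans ?_
    rw [mul_add]
    refine add_le_add (hM'.eLpNorm_le hq1 hq ψ) ((hME.eLpNorm_le hq1 hq ψ').trans ?_)
    rw [ENNReal.ofReal_mul hM.nonneg, mul_assoc]
    gcongr

theorem sqrt_sub_sqrt_sq_le {x y : ℝ} (hy : 0 ≤ y) (hxy : y ≤ x) :
    (Real.sqrt x - Real.sqrt y) ^ 2 ≤ x - y := by
  have h1 := Real.sqrt_le_sqrt hxy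
  have h2 := Real.sq_sqrt (hy.trans hxy)
  have h3 := Real.sq_sqrt hy
  nlinarith [Real.sqrt_nonneg y]

/-- The kernel bound of the heat flow on the annulus of size `2^j`. -/
def heatDecay (C μ : ℝ) (j : ℤ) (τ : ℝ) : ℝ := C * (1 + (μ * τ / ((2 : ℝ) ^ (-j)) ^ 2) ^ 2)⁻¹

theorem heatDecay_pos {C : ℝ} (hC : 0 < C) (μ : ℝ) (j : ℤ) (τ : ℝ) : 0 < heatDecay C μ j τ := by
  rw [heatDecay]; positivity

theorem gevreyTest_add {a : ℝ} (ha : 0 ≤ a) {ψ θ : 𝓢(Space d, ℂ)} (hψ : ψ ∈ bandLimited d)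
    (hθ : θ ∈ bandLimited d) :
    gevreyTest a (ψ + θ) = fun x ↦ gevreyTest a ψ x + gevreyTest a θ x := by
  have hi : ∀ {ψ : 𝓢(Space d, ℂ)}, ψ ∈ bandLimited d → Integrable fun ξ ↦
      ((Real.exp (a * l1Norm ((2 * Real.pi) • ξ)) : ℝ) : ℂ) * 𝓕 ψ ξ := fun {ψ} hψ ↦ by
    obtain ⟨h1, h2⟩ := isWienerFunction_gevreyTest ha hψ
    rw [← h2]
    exact h1.integrable_fourier
  simp only [gevreyTest]
  rw [← fourierInv_fun_add (hi hψ) (hi hθ)]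
  congr 1
  ext ξ
  rw [FourierTransform.fourier_add, add_apply, mul_add]

theorem gevreyTest_smul (a : ℝ) (c : ℂ) (ψ : 𝓢(Space d, ℂ)) :
    gevreyTest a (c • ψ) = fun x ↦ c * gevreyTest a ψ x := by
  simp only [gevreyTest]
  rw [← fourierInv_fun_const_mul]
  congr 1
  ext ξ
  rw [FourierTransform.fourier_smul, smul_apply, smul_eq_mul, mul_left_comm]

/-- The Gevrey norm of a dyadic block of the solution at time `t` is bounded by Duhamel's formula
with the operators replaced by their norms. -/
theorem IsHeatSolution.gevreyLpNorm_dyadicBlock_le (hp1 : 1 < p) (hp : p ≠ ⊤) (hq1 : 1 ≤ q)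
    (hq : q ≠ ⊤) [ENNReal.HolderConjugate p q] {C κ : ℝ} (hC : 0 < C)
    (hmul : ∀ a b l : ℝ, 0 ≤ a → 0 < b → 0 < l → a ^ 2 ≤ κ * b →
      IsL1Multiplier (fatSymbol Θ l a b) (C * (1 + (b / l ^ 2) ^ 2)⁻¹))
    {c₀ μ T : ℝ} {v₀ : 𝓢'(Space d, ℂ)} {F v : ℝ → 𝓢'(Space d, ℂ)}
    (h : IsHeatSolution μ T v₀ F v) (hc₀ : 0 < c₀) (hμ : 0 < μ) (hκ : c₀ / μ ≤ κ) {t : ℝ}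
    (ht : 0 < t) (htT : t < T) (j : ℤ) :
    gevreyLpNorm p (Real.sqrt (c₀ * t)) (dyadicBlock Θ j (v t)) ≤
      duhamelBound (heatDecay C μ j) t (distLpNorm p (dyadicBlock Θ j v₀))
        (fun s ↦ gevreyLpNorm p (Real.sqrt (c₀ * s)) (dyadicBlock Θ j (F s))) := by
  set B := duhamelBound (heatDecay C μ j) t (distLpNorm p (dyadicBlock Θ j v₀))
        (fun s ↦ gevreyLpNorm p (Real.sqrt (c₀ * s)) (dyadicBlock Θ j (F s))) with hB
  rcases eq_or_ne B ⊤ with hBtop | hBtop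
  · rw [hBtop]; exact le_top
  have hc₀κ : c₀ ≤ κ * μ := (div_le_iff₀ hμ).1 hκ
  have hκ0 : 0 < κ := (div_pos hc₀ hμ).trans_le hκ
  have hl : (0 : ℝ) < 2 ^ (-j) := by positivity
  have hm0 : ∀ s, 0 ≤ s → s < t → IsL1Multiplier
      (fatSymbol Θ (2 ^ (-j)) (-Real.sqrt (c₀ * s)) (μ * (t - s))) (heatDecay C μ j (t - s)) :=
    fun s hs hst ↦ by
      have hb : 0 < μ * (t - s) := mul_pos hμ (sub_pos.2 hst)
      exact isL1Multiplier_fatSymbol_neg Θ (Real.sqrt_nonneg _)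
        (hmul 0 _ _ le_rfl hb hl (by rw [sq, mul_zero]; positivity))
  have hm1 : ∀ s, 0 ≤ s → s < t → IsL1Multiplier
      (fatSymbol Θ (2 ^ (-j)) (Real.sqrt (c₀ * t) + -Real.sqrt (c₀ * s)) (μ * (t - s)))
      (heatDecay C μ j (t - s)) := fun s hs hst ↦ by
    have hb : 0 < μ * (t - s) := mul_pos hμ (sub_pos.2 hst)
    have hle : c₀ * s ≤ c₀ * t := by gcongr
    refine hmul _ _ _ ?_ hb hl ?_
    · linarith [Real.sqrt_le_sqrt hle]
    · rw [← sub_eq_add_neg]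
      refine (sqrt_sub_sqrt_sq_le (by positivity) hle).trans ?_
      have h2 : 0 ≤ t - s := by linarith
      nlinarith
  have happly := fun (η : 𝓢(Space d, ℂ)) (Y : ℝ≥0∞) (hY0 : Y ≠ 0) (hY : Y ≠ ⊤) ↦
    h.enorm_dyadicBlock_apply_le (Θ := Θ) (p := p) hq1 hq hc₀ hμ ht htT j
      (k := heatDecay C μ j) (fun τ _ ↦ heatDecay_pos hC μ j τ) (η := η) hY0 hY
  have hzero : ∀ ψ : 𝓢(Space d, ℂ), eLpNorm ψ q volume = 0 → ψ = 0 := fun ψ h0 ↦ by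
    have hae := (eLpNorm_eq_zero_iff ψ.continuous.aestronglyMeasurable
      (zero_lt_one.trans_le hq1).ne').1 h0
    ext x
    exact congrFun ((ψ.continuous.ae_eq_iff_eq volume continuous_zero).1 hae) x
  -- the block of the solution is a function of `L^p`
  obtain ⟨f, hf, -, hfv⟩ := exists_memLp_of_schwartz_functional hp1 hp hq1 hq
    (⊤ : Submodule ℂ 𝓢(Space d, ℂ))
    (((dyadicBlock Θ j (v t) : 𝓢'(Space d, ℂ)) : 𝓢(Space d, ℂ) →ₗ[ℂ] ℂ) ∘ₗ Submodule.subtype ⊤)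
    hBtop (fun ψ ↦ by
      rw [LinearMap.comp_apply, Submodule.subtype_apply]
      change ‖dyadicBlock Θ j (v t) (ψ : 𝓢(Space d, ℂ))‖ₑ ≤ _
      rcases eq_or_ne (eLpNorm (ψ : 𝓢(Space d, ℂ)) q volume) 0 with h0 | h0
      · rw [hzero _ h0, map_zero, enorm_zero]
        positivity
      · exact happly ψ _ h0 ((ψ : 𝓢(Space d, ℂ)).memLp q volume).2.ne fun s hs hst ↦
          (hm0 s hs hst).eLpNorm_le hq1 hq _)
  have hfv' : ∀ ψ : 𝓢(Space d, ℂ), dyadicBlock Θ j (v t) ψ = ∫ x, f x * ψ x := fun ψ ↦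
    hfv ⟨ψ, Submodule.mem_top⟩
  -- the functional `ψ ↦ ⟨f, e^{aΛ₁} ψ⟩`
  set a := Real.sqrt (c₀ * t) with ha
  have ha0 : 0 ≤ a := Real.sqrt_nonneg _
  have hint : ∀ {ψ : 𝓢(Space d, ℂ)}, ψ ∈ bandLimited d →
      Integrable fun x ↦ f x * gevreyTest a ψ x := fun {ψ} hψ ↦
    hf.integrable_mul (memLp_gevreyTest hq1 hq ha0 hψ)
  let Γ : bandLimited d →ₗ[ℂ] ℂ :=
    { toFun := fun ψ ↦ ∫ x, f x * gevreyTest a (ψ : 𝓢(Space d, ℂ)) x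
      map_add' := fun ψ θ ↦ by
        rw [Submodule.coe_add, gevreyTest_add ha0 ψ.2 θ.2]
        simp only [mul_add]
        exact integral_add (hint ψ.2) (hint θ.2)
      map_smul' := fun c ψ ↦ by
        rw [Submodule.coe_smul, gevreyTest_smul, RingHom.id_apply, smul_eq_mul,
          ← integral_const_mul]
        congr with x
        ring }
  have hΓ : ∀ ψ : bandLimited d, ‖Γ ψ‖ₑ ≤ B * eLpNorm (ψ : 𝓢(Space d, ℂ)) q volume := by
    intro ψ
    have hε : ∀ ε : ℝ, 0 < ε → ‖Γ ψ‖ₑ ≤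
        B * (eLpNorm (ψ : 𝓢(Space d, ℂ)) q volume + ENNReal.ofReal ε) +
          eLpNorm f p volume * ENNReal.ofReal ε := by
      intro ε hε
      obtain ⟨η, hη, hηM⟩ := exists_schwartz_approx_gevreyTest hq1 hq ha0 ψ.2 hε
      have h1 := happly η (eLpNorm (ψ : 𝓢(Space d, ℂ)) q volume + ENNReal.ofReal ε)
        (by simp [hε]) (ENNReal.add_ne_top.2 ⟨((ψ : 𝓢(Space d, ℂ)).memLp q volume).2.ne,
          ENNReal.ofReal_ne_top⟩) fun s hs hst ↦
        hηM _ _ _ (hm0 s hs hst) (hm1 s hs hst) fun ξ ↦ (fatSymbol_mul_exp Θ _ _ _ _ ξ).symm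
      have hηint : Integrable fun x ↦ f x * η x := hf.integrable_mul (η.memLp q volume)
      have h2 : Γ ψ = dyadicBlock Θ j (v t) η -
          ∫ x, f x * (η x - gevreyTest a (ψ : 𝓢(Space d, ℂ)) x) := by
        have h3 : Γ ψ = ∫ x, f x * gevreyTest a (ψ : 𝓢(Space d, ℂ)) x := rfl
        simp only [mul_sub]
        rw [integral_sub hηint (hint ψ.2), hfv', h3, sub_sub_cancel]
      rw [h2]
      refine enorm_sub_le.trans (add_le_add h1 ?_)
      refine (enorm_integral_mul_le (p := p) (q := q) hf.1 ?_).trans ?_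
      · exact (η.memLp q volume).1.sub (memLp_gevreyTest hq1 hq ha0 ψ.2).1
      · gcongr
    have hlim : Filter.Tendsto (fun ε : ℝ ↦
        B * (eLpNorm (ψ : 𝓢(Space d, ℂ)) q volume + ENNReal.ofReal ε) +
          eLpNorm f p volume * ENNReal.ofReal ε) (nhdsWithin 0 (Set.Ioi 0))
        (nhds (B * (eLpNorm (ψ : 𝓢(Space d, ℂ)) q volume + ENNReal.ofReal 0) +
          eLpNorm f p volume * ENNReal.ofReal 0)) := by
      have h0 : Filter.Tendsto (fun ε : ℝ ↦ ENNReal.ofReal ε) (nhdsWithin 0 (Set.Ioi 0))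
          (nhds (ENNReal.ofReal 0)) :=
        (ENNReal.continuous_ofReal.tendsto 0).mono_left nhdsWithin_le_nhds
      exact (ENNReal.Tendsto.const_mul (h0.const_add _) (Or.inr hBtop)).add
        (ENNReal.Tendsto.const_mul h0 (Or.inr hf.2.ne))
    rw [ENNReal.ofReal_zero, add_zero, mul_zero, add_zero] at hlim
    exact ge_of_tendsto hlim (eventually_mem_nhdsWithin.mono hε)
  obtain ⟨g, hg, hgB, hgΓ⟩ := exists_memLp_of_schwartz_functional hp1 hp hq1 hq
    (bandLimited d) Γ hBtop hΓ
  refine le_trans (iInf₂_le g ⟨hg, f, ⟨hf, hfv'⟩, fun ψ hψ ↦ ?_⟩) hgB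
  exact (hgΓ ⟨ψ, hψ⟩).symm

end GevreyBound

/-! ### The estimate in time -/

section Time

/-- The decay kernel `1/(1 + (Λτ)²)` in time. -/
def timeKernel (Λ τ : ℝ) : ℝ := (1 + (Λ * τ) ^ 2)⁻¹

theorem timeKernel_pos (Λ τ : ℝ) : 0 < timeKernel Λ τ := by rw [timeKernel]; positivity

theorem timeKernel_le_one (Λ τ : ℝ) : timeKernel Λ τ ≤ 1 :=
  inv_le_one_of_one_le₀ (by nlinarith [sq_nonneg (Λ * τ)])

theorem measurable_timeKernel (Λ : ℝ) : Measurable fun τ ↦ ENNReal.ofReal (timeKernel Λ τ) := by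
  unfold timeKernel
  fun_prop

theorem lintegral_timeKernel {Λ : ℝ} (hΛ : 0 < Λ) :
    ∫⁻ τ, ENNReal.ofReal (timeKernel Λ τ) = ENNReal.ofReal (Real.pi / Λ) := by
  have hi : Integrable (timeKernel Λ) := integrable_inv_one_add_sq.comp_mul_left' hΛ.ne'
  rw [← ofReal_integral_eq_lintegral_ofReal hi (.of_forall fun τ ↦ (timeKernel_pos Λ τ).le)]
  congr 1
  have h1 := Measure.integral_comp_mul_left (fun x : ℝ ↦ (1 + x ^ 2)⁻¹) Λ
  rw [integral_univ_inv_one_add_sq, abs_of_pos (inv_pos.2 hΛ), smul_eq_mul] at h1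
  rw [div_eq_inv_mul, ← h1]
  rfl

theorem eLpNorm_timeKernel_le {Λ : ℝ} (hΛ : 0 < Λ) {ρ : ℝ≥0∞} (hρ : 1 ≤ ρ) :
    eLpNorm (fun τ ↦ ENNReal.ofReal (timeKernel Λ τ)) ρ volume ≤
      ENNReal.ofReal (Real.pi / Λ) ^ (ρ⁻¹).toReal := by
  have hk1 : ∀ τ, ENNReal.ofReal (timeKernel Λ τ) ≤ 1 := fun τ ↦
    ENNReal.ofReal_le_one.2 (timeKernel_le_one Λ τ)
  rcases eq_or_ne ρ ⊤ with rfl | hρt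
  · simpa using eLpNorm_top_le_of_forall (ν := volume) hk1
  · have h0 : ρ ≠ 0 := (zero_lt_one.trans_le hρ).ne'
    have h1 : 1 ≤ ρ.toReal := by
      rw [← ENNReal.toReal_one]
      exact ENNReal.toReal_mono hρt hρ
    rw [eLpNorm_ennreal_eq _ h0 hρt, ENNReal.toReal_inv, one_div, ← lintegral_timeKernel hΛ]
    refine ENNReal.rpow_le_rpow (lintegral_mono fun τ ↦ ?_) (by positivity)
    calc _ ≤ ENNReal.ofReal (timeKernel Λ τ) ^ (1 : ℝ) :=
          ENNReal.rpow_le_rpow_of_exponent_ge (hk1 τ) h1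
      _ = _ := ENNReal.rpow_one _

/-- The time norm of Duhamel's bound, by Young's inequality. The forcing `N` is not assumed to be
measurable; it is replaced by its largest measurable minorant. -/
theorem eLpNorm_duhamelBound_le {Λ : ℝ} (hΛ : 0 < Λ) {ρ₁ ρ₂ : ℝ≥0∞} (h₂ : 1 ≤ ρ₂) (h₁ : ρ₂ ≤ ρ₁)
    (T : ℝ) (D : ℝ≥0∞) (N : ℝ → ℝ≥0∞) :
    eLpNorm (fun t ↦ duhamelBound (timeKernel Λ) t D N) ρ₁ (volume.restrict (Set.Ioo 0 T)) ≤
      ENNReal.ofReal (Real.pi / Λ) ^ (ρ₁⁻¹).toReal * D +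
        ENNReal.ofReal (Real.pi / Λ) ^ (1 - (ρ₂⁻¹).toReal + (ρ₁⁻¹).toReal) *
          eLpNorm N ρ₂ (volume.restrict (Set.Ioo 0 T)) := by
  have hI0 : ENNReal.ofReal (Real.pi / Λ) ≠ 0 := by simp [Real.pi_pos, hΛ]
  rcases eq_or_ne D ⊤ with rfl | hD
  · rw [ENNReal.mul_top (by simp [ENNReal.rpow_eq_zero_iff, hI0]), top_add]
    exact le_top
  set k : ℝ → ℝ≥0∞ := fun τ ↦ ENNReal.ofReal (timeKernel Λ τ) with hk
  have hkm : Measurable k := measurable_timeKernel Λ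
  have hk1 : ∀ τ, k τ ≤ 1 := fun τ ↦ ENNReal.ofReal_le_one.2 (timeKernel_le_one Λ τ)
  obtain ⟨G, hGm, hGN, hG⟩ := exists_largest_measurable_minorant (volume.restrict (Set.Ioo 0 T)) N
  set n : ℝ → ℝ≥0∞ := (Set.Ioo 0 T).indicator G with hn
  have hnm : Measurable n := hGm.indicator measurableSet_Ioo
  have hρ₁ : 1 ≤ ρ₁ := h₂.trans h₁
  have hpt : ∀ t ∈ Set.Ioo 0 T, duhamelBound (timeKernel Λ) t D N ≤
      (fun τ ↦ k τ * D) t + (fun τ ↦ ∫⁻ s, k (τ - s) * n s) t := by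
    intro t ht
    rw [duhamelBound]
    refine add_le_add le_rfl ?_
    have hsub : Set.Ioo 0 t ⊆ Set.Ioo 0 T := Set.Ioo_subset_Ioo_right ht.2.le
    calc ∫⁻ s in Set.Ioo 0 t, k (t - s) * N s ≤ ∫⁻ s in Set.Ioo 0 t, k (t - s) * G s :=
          lintegral_mul_le_of_largest_minorant (k := fun s ↦ k (t - s))
            (Measure.absolutelyContinuous_of_le (Measure.restrict_mono hsub le_rfl)) hG
            (hkm.comp (measurable_const.sub measurable_id))
            (fun s ↦ by simpa [hk] using timeKernel_pos Λ (t - s)) (fun s ↦ ENNReal.ofReal_ne_top)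
      _ = ∫⁻ s in Set.Ioo 0 t, k (t - s) * n s :=
          setLIntegral_congr_fun measurableSet_Ioo fun s hs ↦ by
            simp only [hn]
            rw [Set.indicator_of_mem (hsub hs)]
      _ ≤ _ := setLIntegral_le_lintegral _ _
  have hcm : Measurable fun τ ↦ ∫⁻ s, k (τ - s) * n s := measurable_lintegral_convolution hkm hnm
  calc _ ≤ eLpNorm ((fun τ ↦ k τ * D) + fun τ ↦ ∫⁻ s, k (τ - s) * n s) ρ₁
        (volume.restrict (Set.Ioo 0 T)) := by
        refine eLpNorm_mono_enorm_ae ((ae_restrict_mem measurableSet_Ioo).mono fun t ht ↦ ?_)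
        exact hpt t ht
    _ ≤ eLpNorm ((fun τ ↦ k τ * D) + fun τ ↦ ∫⁻ s, k (τ - s) * n s) ρ₁ volume :=
        eLpNorm_mono_measure _ Measure.restrict_le_self
    _ ≤ eLpNorm (fun τ ↦ k τ * D) ρ₁ volume +
          eLpNorm (fun τ ↦ ∫⁻ s, k (τ - s) * n s) ρ₁ volume :=
        eLpNorm_add_le (hkm.mul_const D).aestronglyMeasurable hcm.aestronglyMeasurable hρ₁
    _ ≤ _ := by
        refine add_le_add ?_ ?_
        · have h3 := eLpNorm_le_nnreal_smul_eLpNorm_of_ae_le_mul' (μ := volume) (c := D.toNNReal)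
            (f := fun τ ↦ k τ * D) (g := k) (.of_forall fun τ ↦ by
              rw [ENNReal.coe_toNNReal hD, mul_comm]; exact le_rfl) ρ₁
          rw [ENNReal.smul_def, ENNReal.coe_toNNReal hD, smul_eq_mul, mul_comm] at h3
          refine h3.trans ?_
          gcongr
          exact eLpNorm_timeKernel_le hΛ hρ₁
        · refine (eLpNorm_convolution_le hkm hk1 hnm h₂ h₁).trans ?_
          rw [lintegral_timeKernel hΛ]
          gcongr
          rw [hn, eLpNorm_indicator_eq_eLpNorm_restrict measurableSet_Ioo]
          exact eLpNorm_mono_enorm_ae (.of_forall fun s ↦ hGN s)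

theorem duhamelBound_const_mul (C : ℝ) (k : ℝ → ℝ) (hC : 0 ≤ C) (t : ℝ) (D : ℝ≥0∞)
    (N : ℝ → ℝ≥0∞) : duhamelBound (fun τ ↦ C * k τ) t D N =
      ENNReal.ofReal C * duhamelBound k t D N := by
  simp only [duhamelBound, ENNReal.ofReal_mul hC, mul_assoc]
  rw [lintegral_const_mul' _ _ ENNReal.ofReal_ne_top, mul_add]

end Time

/-! ### Weights and summation over the dyadic blocks -/

section Summation

variable {d : ℕ} {Θ : DyadicCutoff d} {p : ℝ≥0∞}

/-- The powers of `Λ = μ 2^{2j}` produced by the time estimates match the weights of the norms. -/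
theorem weight_identity {μ : ℝ} (hμ : 0 < μ) (j : ℤ) (σ r₁ e : ℝ) :
    μ ^ r₁ * ((2 : ℝ) ^ ((j : ℝ) * (σ + 2 * r₁)) *
      (Real.pi / (μ / ((2 : ℝ) ^ (-j)) ^ 2)) ^ (e + r₁)) =
      Real.pi ^ (e + r₁) * (μ ^ (-e) * (2 : ℝ) ^ ((j : ℝ) * (σ - 2 * e))) := by
  have h2 : ((2 : ℝ) ^ (-j)) ^ 2 = (2 : ℝ) ^ (-(2 * (j : ℝ))) := by
    rw [← zpow_natCast, ← zpow_mul, ← Real.rpow_intCast]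
    congr 1
    push_cast
    ring
  have h3 : Real.pi / (μ / ((2 : ℝ) ^ (-j)) ^ 2) = Real.pi * (μ⁻¹ * (2 : ℝ) ^ (-(2 * (j : ℝ)))) := by
    rw [h2]; field_simp
  rw [h3, Real.mul_rpow Real.pi_pos.le (by positivity), Real.mul_rpow (by positivity)
    (by positivity), Real.inv_rpow hμ.le, ← Real.rpow_neg hμ.le, ← Real.rpow_mul (by norm_num)]
  have h4 : μ ^ (-e) = μ ^ r₁ * μ ^ (-(e + r₁)) := by
    rw [← Real.rpow_add hμ]; congr 1; ring
  have h5 : (2 : ℝ) ^ ((j : ℝ) * (σ - 2 * e)) =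
      (2 : ℝ) ^ ((j : ℝ) * (σ + 2 * r₁)) * (2 : ℝ) ^ (-(2 * (j : ℝ)) * (e + r₁)) := by
    rw [← Real.rpow_add (by norm_num)]; congr 1; ring
  rw [h4, h5]
  ring

theorem toReal_inv_le_one {ρ : ℝ≥0∞} (h : 1 ≤ ρ) : (ρ⁻¹).toReal ≤ 1 := by
  rw [← ENNReal.toReal_one]
  exact ENNReal.toReal_mono ENNReal.one_ne_top (ENNReal.inv_le_one.2 h)

theorem toReal_inv_anti {ρ₁ ρ₂ : ℝ≥0∞} (h₂ : 1 ≤ ρ₂) (h : ρ₂ ≤ ρ₁) :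
    (ρ₁⁻¹).toReal ≤ (ρ₂⁻¹).toReal :=
  ENNReal.toReal_mono (ENNReal.inv_ne_top.2 (zero_lt_one.trans_le h₂).ne')
    (ENNReal.inv_le_inv.2 h)

theorem weighted_ofReal_le {μ : ℝ} (hμ : 0 < μ) (j : ℤ) (σ r₁ e : ℝ) (h0 : 0 ≤ e + r₁)
    (h1 : e + r₁ ≤ 1) (X : ℝ≥0∞) :
    ENNReal.ofReal (μ ^ r₁) * (ENNReal.ofReal ((2 : ℝ) ^ ((j : ℝ) * (σ + 2 * r₁))) *
      (ENNReal.ofReal (Real.pi / (μ / ((2 : ℝ) ^ (-j)) ^ 2)) ^ (e + r₁) * X)) ≤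
      ENNReal.ofReal Real.pi * (ENNReal.ofReal (μ ^ (-e)) *
        (ENNReal.ofReal ((2 : ℝ) ^ ((j : ℝ) * (σ - 2 * e))) * X)) := by
  have hπ : Real.pi ^ (e + r₁) ≤ Real.pi := by
    conv_rhs => rw [← Real.rpow_one Real.pi]
    exact Real.rpow_le_rpow_of_exponent_le (by linarith [Real.pi_gt_three]) h1
  rw [ENNReal.ofReal_rpow_of_nonneg (by positivity) h0, ← mul_assoc, ← mul_assoc, ← mul_assoc,
    ← mul_assoc, ← ENNReal.ofReal_mul (by positivity), ← ENNReal.ofReal_mul (by positivity),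
    ← ENNReal.ofReal_mul (by positivity), ← ENNReal.ofReal_mul (by positivity), mul_assoc (μ ^ r₁),
    weight_identity hμ, mul_assoc Real.pi]
  gcongr

/-- The estimate of one dyadic block, with its weights. -/
theorem IsHeatSolution.weighted_block_le (hp1 : 1 < p) (hp : p ≠ ⊤) {C κ : ℝ} (hC : 0 < C)
    (hmul : ∀ a b l : ℝ, 0 ≤ a → 0 < b → 0 < l → a ^ 2 ≤ κ * b →
      IsL1Multiplier (fatSymbol Θ l a b) (C * (1 + (b / l ^ 2) ^ 2)⁻¹))
    {c₀ μ T : ℝ} {v₀ : 𝓢'(Space d, ℂ)} {F v : ℝ → 𝓢'(Space d, ℂ)}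
    (h : IsHeatSolution μ T v₀ F v) (hc₀ : 0 < c₀) (hμ : 0 < μ) (hκ : c₀ / μ ≤ κ) (σ : ℝ)
    {ρ₁ ρ₂ : ℝ≥0∞} (h₂ : 1 ≤ ρ₂) (h₁ : ρ₂ ≤ ρ₁) (j : ℤ) :
    ENNReal.ofReal (μ ^ (ρ₁⁻¹).toReal) *
      (ENNReal.ofReal ((2 : ℝ) ^ ((j : ℝ) * (σ + 2 * (ρ₁⁻¹).toReal))) *
        eLpNorm (fun t ↦ gevreyLpNorm p (Real.sqrt (c₀ * t)) (dyadicBlock Θ j (v t))) ρ₁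
          (volume.restrict (Set.Ioo 0 T))) ≤
      ENNReal.ofReal (C * Real.pi) *
        (ENNReal.ofReal ((2 : ℝ) ^ ((j : ℝ) * σ)) * distLpNorm p (dyadicBlock Θ j v₀) +
          ENNReal.ofReal (μ ^ ((ρ₂⁻¹).toReal - 1)) *
            (ENNReal.ofReal ((2 : ℝ) ^ ((j : ℝ) * (σ - 2 + 2 * (ρ₂⁻¹).toReal))) *
              eLpNorm (fun t ↦ gevreyLpNorm p (Real.sqrt (c₀ * t)) (dyadicBlock Θ j (F t))) ρ₂
                (volume.restrict (Set.Ioo 0 T)))) := by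
  obtain ⟨q, hq1, hq, hpq⟩ : ∃ q : ℝ≥0∞, 1 ≤ q ∧ q ≠ ⊤ ∧ ENNReal.HolderConjugate p q := by
    have hpi : p⁻¹ < 1 := ENNReal.inv_lt_one.2 hp1
    refine ⟨(1 - p⁻¹)⁻¹, ?_, ?_, ?_⟩
    · rw [ENNReal.one_le_inv]; exact tsub_le_self
    · rw [ENNReal.inv_ne_top]; exact (tsub_pos_of_lt hpi).ne'
    · rw [ENNReal.holderConjugate_iff, inv_inv, add_tsub_cancel_of_le hpi.le]
  -- `2^{-j}` enters through the symbol `φ(2^{-j} ξ)`, so that `Λ = μ 4^j`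
  set Λ : ℝ := μ / ((2 : ℝ) ^ (-j)) ^ 2 with hΛ
  have hΛ0 : 0 < Λ := by positivity
  set D := distLpNorm p (dyadicBlock Θ j v₀)
  set N : ℝ → ℝ≥0∞ := fun t ↦ gevreyLpNorm p (Real.sqrt (c₀ * t)) (dyadicBlock Θ j (F t)) with hN
  have hk : heatDecay C μ j = fun τ ↦ C * timeKernel Λ τ := by
    ext τ
    rw [heatDecay, timeKernel, hΛ, div_mul_eq_mul_div]
  set r₁ := (ρ₁⁻¹).toReal with hr₁
  set r₂ := (ρ₂⁻¹).toReal with hr₂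
  have hr₁0 : 0 ≤ r₁ := ENNReal.toReal_nonneg
  have hr₁₂ : r₁ ≤ r₂ := toReal_inv_anti h₂ h₁
  have hr₂1 : r₂ ≤ 1 := toReal_inv_le_one h₂
  have hblock : eLpNorm (fun t ↦ gevreyLpNorm p (Real.sqrt (c₀ * t)) (dyadicBlock Θ j (v t))) ρ₁
      (volume.restrict (Set.Ioo 0 T)) ≤ ENNReal.ofReal C *
        (ENNReal.ofReal (Real.pi / Λ) ^ (0 + r₁) * D +
          ENNReal.ofReal (Real.pi / Λ) ^ (1 - r₂ + r₁) *
            eLpNorm N ρ₂ (volume.restrict (Set.Ioo 0 T))) := by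
    have h3 := eLpNorm_le_nnreal_smul_eLpNorm_of_ae_le_mul'
      (μ := volume.restrict (Set.Ioo 0 T)) (c := C.toNNReal)
      (f := fun t ↦ gevreyLpNorm p (Real.sqrt (c₀ * t)) (dyadicBlock Θ j (v t)))
      (g := fun t ↦ duhamelBound (timeKernel Λ) t D N)
      ((ae_restrict_mem measurableSet_Ioo).mono fun t ht ↦ by
        have h4 := h.gevreyLpNorm_dyadicBlock_le hp1 hp hq1 hq hC hmul hc₀ hμ hκ ht.1 ht.2 j
        rw [hk, duhamelBound_const_mul C _ hC.le] at h4
        exact h4) ρ₁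
    rw [ENNReal.smul_def, smul_eq_mul] at h3
    rw [zero_add]
    refine h3.trans ?_
    gcongr
    · exact le_rfl
    · exact eLpNorm_duhamelBound_le hΛ0 h₂ h₁ T D N
  calc _ ≤ ENNReal.ofReal (μ ^ r₁) * (ENNReal.ofReal ((2 : ℝ) ^ ((j : ℝ) * (σ + 2 * r₁))) *
        (ENNReal.ofReal C *
        (ENNReal.ofReal (Real.pi / Λ) ^ (0 + r₁) * D +
          ENNReal.ofReal (Real.pi / Λ) ^ (1 - r₂ + r₁) *
            eLpNorm N ρ₂ (volume.restrict (Set.Ioo 0 T))))) := by gcongr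
    _ = ENNReal.ofReal C * (ENNReal.ofReal (μ ^ r₁) *
          (ENNReal.ofReal ((2 : ℝ) ^ ((j : ℝ) * (σ + 2 * r₁))) *
            (ENNReal.ofReal (Real.pi / Λ) ^ (0 + r₁) * D)) + ENNReal.ofReal (μ ^ r₁) *
          (ENNReal.ofReal ((2 : ℝ) ^ ((j : ℝ) * (σ + 2 * r₁))) *
            (ENNReal.ofReal (Real.pi / Λ) ^ (1 - r₂ + r₁) *
              eLpNorm N ρ₂ (volume.restrict (Set.Ioo 0 T))))) := by ring
    _ ≤ ENNReal.ofReal C * (ENNReal.ofReal Real.pi * (ENNReal.ofReal (μ ^ (-(0 : ℝ))) *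
          (ENNReal.ofReal ((2 : ℝ) ^ ((j : ℝ) * (σ - 2 * 0))) * D)) +
        ENNReal.ofReal Real.pi * (ENNReal.ofReal (μ ^ (-(1 - r₂))) *
          (ENNReal.ofReal ((2 : ℝ) ^ ((j : ℝ) * (σ - 2 * (1 - r₂)))) *
            eLpNorm N ρ₂ (volume.restrict (Set.Ioo 0 T))))) := by
        exact mul_le_mul' le_rfl (add_le_add
          (weighted_ofReal_le hμ j σ r₁ 0 (by linarith) (by linarith) D)
          (weighted_ofReal_le hμ j σ r₁ (1 - r₂) (by linarith) (by linarith) _))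
    _ = _ := by
        rw [neg_zero, Real.rpow_zero, ENNReal.ofReal_one, one_mul, mul_zero, sub_zero,
          ← mul_add, ← mul_assoc, ← ENNReal.ofReal_mul hC.le, neg_sub,
          show σ - 2 * (1 - r₂) = σ - 2 + 2 * r₂ by ring]

/-- Summation in `ℓ^r` of an inequality between sequences. -/
theorem mul_eLpNorm_count_le {r : ℝ≥0∞} (hr : 1 ≤ r) {c₁ c₂ C : ℝ≥0} (hc₁ : c₁ ≠ 0)
    {A B D : ℤ → ℝ≥0∞} (h : ∀ j, c₁ * A j ≤ C * (B j + c₂ * D j)) :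
    c₁ * eLpNorm A r Measure.count ≤
      C * (eLpNorm B r Measure.count + c₂ * eLpNorm D r Measure.count) := by
  have hc : (c₁ : ℝ≥0∞) ≠ 0 := by simpa using hc₁
  have h1 := eLpNorm_le_nnreal_smul_eLpNorm_of_ae_le_mul' (μ := (Measure.count : Measure ℤ))
    (c := c₁⁻¹ * C) (f := A) (g := B + fun j ↦ c₂ * D j) (.of_forall fun j ↦ by
      rw [enorm_eq_self, enorm_eq_self, ENNReal.coe_mul, ENNReal.coe_inv hc₁, mul_assoc,
        ← ENNReal.mul_le_mul_iff_right hc ENNReal.coe_ne_top, ← mul_assoc (c₁ : ℝ≥0∞),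
        ENNReal.mul_inv_cancel hc ENNReal.coe_ne_top, one_mul]
      exact h j) r
  have h2 := eLpNorm_le_nnreal_smul_eLpNorm_of_ae_le_mul' (μ := (Measure.count : Measure ℤ))
    (c := c₂) (f := fun j ↦ c₂ * D j) (g := D) (.of_forall fun j ↦ le_rfl) r
  have hm : ∀ f : ℤ → ℝ≥0∞, AEStronglyMeasurable f (Measure.count : Measure ℤ) := fun f ↦
    (measurable_from_top).aestronglyMeasurable
  have h3 := eLpNorm_add_le (hm B) (hm fun j ↦ c₂ * D j) hr
  rw [ENNReal.smul_def, smul_eq_mul] at h1 h2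
  calc _ ≤ (c₁ : ℝ≥0∞) * (((c₁⁻¹ * C : ℝ≥0) : ℝ≥0∞) *
        (eLpNorm B r Measure.count + c₂ * eLpNorm D r Measure.count)) := by
        gcongr
        refine h1.trans ?_
        gcongr
        exact h3.trans (add_le_add le_rfl h2)
    _ = _ := by
        rw [← mul_assoc, ENNReal.coe_mul, ← mul_assoc, ENNReal.coe_inv hc₁,
          ENNReal.mul_inv_cancel hc ENNReal.coe_ne_top, one_mul]

end Summation

end GevreyHeat

end

theorem lemma2p5 (d : ℕ) (Θ : GevreyHeat.DyadicCutoff d) (p : ℝ≥0∞) (hp₁ : 1 < p) (hp : p < ⊤)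
    (κ : ℝ) :
    ∃ C : ℝ≥0, ∀ (c₀ μ T σ : ℝ) (ρ₂ r : ℝ≥0∞),
      0 < c₀ → 0 < μ → c₀ / μ ≤ κ → 0 < T → 1 ≤ ρ₂ → 1 ≤ r →
      ∀ (v₀ : 𝓢'(GevreyHeat.Space d, ℂ)) (F v : ℝ → 𝓢'(GevreyHeat.Space d, ℂ)),
        GevreyHeat.IsHeatSolution μ T v₀ F v →
        ∀ ρ₁ : ℝ≥0∞, ρ₂ ≤ ρ₁ →
          ENNReal.ofReal (μ ^ (ρ₁⁻¹).toReal) *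
              GevreyHeat.gevreyCheminLernerNorm Θ c₀ T ρ₁ (σ + 2 * (ρ₁⁻¹).toReal) p r v
            ≤ C * (GevreyHeat.besovNorm Θ σ p r v₀ +
                ENNReal.ofReal (μ ^ ((ρ₂⁻¹).toReal - 1)) *
                  GevreyHeat.gevreyCheminLernerNorm Θ c₀ T ρ₂ (σ - 2 + 2 * (ρ₂⁻¹).toReal) p r F) := by
  obtain ⟨C, hC, hmul⟩ := GevreyHeat.exists_isL1Multiplier_fat_gevreyHeat Θ κ
  refine ⟨(C * Real.pi).toNNReal, ?_⟩
  intro c₀ μ T σ ρ₂ r hc₀ hμ hκ _ h₂ hr v₀ F v hv ρ₁ h₁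
  exact GevreyHeat.mul_eLpNorm_count_le hr
    (c₁ := (μ ^ (ρ₁⁻¹).toReal).toNNReal) (c₂ := (μ ^ ((ρ₂⁻¹).toReal - 1)).toNNReal)
    (by simpa using Real.rpow_pos_of_pos hμ _) fun j ↦
      hv.weighted_block_le hp₁ hp.ne hC hmul hc₀ hμ hκ σ h₂ h₁ j
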